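/- Let $n\ge 2$ and let $\mathcal P_n$ be the partition monoid of degree $n$: the set partitions of $\{1,\dots,n\}\cup\{1',\dots,n'\}$, where $\alpha\beta$ is obtained by gluing the lower row of $\alpha$ to the upper row of $\beta$, taking connected components, and deleting the middle row. The rank of $\alpha$ is the number of its transversals (blocks meeting both rows). Let $I_q=\{\alpha:\operatorname{rank}\alpha\le q\}$. For a permutation $\sigma$ of $\{1,\dots,q\}$, $q\le n$, let $\overline\sigma\in\mathcal P_n$ have the transversals $\{i,(i\sigma)'\}$ $(1\le i\le q)$ and all other blocks singletons, and for $N\subseteq\mathcal S_q$ let $\overline N=\{\overline\sigma:\sigma\in N\}$. Write $\mathscr L,\mathscr R,\mathscr J$ and $\mathscr H=\mathscr L\cap\mathscr R$ for Green's relations and $\Delta,\nabla$ for the trivial and universal congruences. Ideals are two-sided and non-empty. An ideal $I$ is retractable if there is a retraction: a homomorphism $f$ from $I$ to the minimal ideal that fixes the minimal ideal pointwise (in a finite monoid it is unique). An IN-pair is a pair $(I,N)$ of an ideal $I$ and a normal subgroup $N$ of a maximal subgroup contained in a stable, regular $\mathscr J$-class $J$ that is minimal among the $\mathscr J$-classes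 outside $I$. A $\mathscr J$-class $J$ is stable if for all $x\in J$ and all $a$ in the monoid, $xa\mathrel{\mathscr J}x$ implies $xa\mathrel{\mathscr R}x$ and $ax\mathrel{\mathscr J}x$ implies $ax\mathrel{\mathscr L}x$. The IN-pair is proper if $|N|\ge 2$; it is retractable if $I$ is retractable and, for each $x$ in the minimal ideal, $|xN|=|Nx|=1$. Put $$\nu_N=\{(sut,svt)\in J\times J: u,v\in N,\ s,t\in\mathcal P_n\},\qquad R_I=\Delta\cup(I\times I),\qquad R_{I,N}=R_I\cup\nu_N,$$ and, for a retractable IN-pair $\mathcal C=(I,N)$ with retraction $f$, let $\lambda_{\mathcal C}$, $\rho_{\mathcal C}$, $\mu_{\mathcal C}$ be $\Delta\cup\nu_N\cup\{(x,y)\in I\times I: xf\mathrel{\mathscr K}yf\}$ for $\mathscr K=\mathscr L,\mathscr R,\mathscr H$ respectively. IN-pairs $(I,N)$, $(I,N')$ with $\nu_N=\nu_{N'}$ are regarded as the same; they differ only in the choice of a maximal subgroup in the $\mathscr J$-class. Then: 1. The ideals of $\mathcal P_n$ are exactly $I_0,\dots,I_n$; they yield the Rees congruences $R_q=R_{I_q}$.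 2. The proper IN-pairs of $\mathcal P_n$ are, up to this identification, exactly $(I_{q-1},\overline N)$ with $2\le q\le n$ and $N$ a non-trivial normal subgroup of $\mathcal S_q$; they yield the congruences $R_N=R_{I_{q-1},\overline N}$. If the group of a proper IN-pair with ideal $I_{q-1}$ lies in $\overline{\mathcal S}_q$, then the pair itself is one of these. 3. The retractable IN-pairs of $\mathcal P_n$ are, up to this identification, exactly $\mathcal C_0=(I_0,\{\overline{\mathrm{id}}_1\})$, $\mathcal C_1=(I_1,\{\overline{\mathrm{id}}_2\})$ and $\mathcal C_{\mathcal S_2}=(I_1,\overline{\mathcal S}_2)$, and literally so if the group lies in $\overline{\mathcal S}_1$ (for ideal $I_0$) or $\overline{\mathcal S}_2$ (for ideal $I_1$). They yield nine congruences $\lambda_i,\rho_i,\mu_i$, $i\in\{0,1,\mathcal S_2\}$. 4. The relations $R_q$ $(0\le q\le n)$, $R_N$ ($N$ a non-trivial normal subgroup of $\mathcal S_q$, $2\le q\le n$) and $\lambda_i,\rho_i,\mu_i$ $(i\in\{0,1,\mathcal S_2\})$ are congruences, are pairwise distinct, and are all the congruences of $\mathcal P_n$. 5. With $R_{\mathcal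 S_2}$ denoting $R_N$ for $N=\mathcal S_2$, the covering relations of the congruence lattice of $\mathcal P_n$ are exactly the following. (Prism.) $\mu_i\prec\lambda_i\prec R_i$ and $\mu_i\prec\rho_i\prec R_i$ for $i\in\{0,1,\mathcal S_2\}$, and $\kappa_0\prec\kappa_1\prec\kappa_{\mathcal S_2}$ for $\kappa\in\{\mu,\lambda,\rho,R\}$. (Wick.) The consecutive members of the chain $$R_{\mathcal S_2}\prec R_2\prec R_{\mathcal A_3}\prec R_{\mathcal S_3}\prec R_3\prec R_K\prec R_{\mathcal A_4}\prec R_{\mathcal S_4}\prec R_4\prec R_{\mathcal A_5}\prec R_{\mathcal S_5}\prec\cdots\prec R_{\mathcal S_n}\prec R_n,$$ truncated at $R_n$, where $\mathcal A_q$ is the alternating group and $K$ is the Klein four-group in $\mathcal S_4$. The least element is $\mu_0=\Delta$ and the greatest is $R_n=\nabla$. -/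

import Mathlib

/-! ### Green's relations, ideals, IN-pairs and the associated relations on a monoid -/

namespace SemigroupCong

variable {S : Type*} [Monoid S]

/-- Green's relation `R`: equality of principal right ideals. -/
def GreenR (a b : S) : Prop :=
  {x : S | ∃ s, x = a * s} = {x : S | ∃ s, x = b * s}

/-- Green's relation `L`: equality of principal left ideals. -/
def GreenL (a b : S) : Prop :=
  {x : S | ∃ s, x = s * a} = {x : S | ∃ s, x = s * b}

/-- Green's relation `J`: equality of principal two-sided ideals. -/
def GreenJ (a b : S) : Prop :=
  {x : S | ∃ s t, x = s * a * t} = {x : S | ∃ s t, x = s * b * t}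

/-- Green's relation `H`, the intersection of `R` and `L`. -/
def GreenH (a b : S) : Prop := GreenR a b ∧ GreenL a b

/-- The (two-sided, non-empty) ideals of a monoid. -/
def IsIdeal (I : Set S) : Prop :=
  I.Nonempty ∧ ∀ x ∈ I, ∀ a : S, a * x ∈ I ∧ x * a ∈ I

/-- `M` is a minimal ideal. -/
def IsMinimalIdeal (M : Set S) : Prop :=
  IsIdeal M ∧ ∀ I : Set S, IsIdeal I → I ⊆ M → I = M

/-- `f` restricts to a retraction of `I` onto the minimal ideal: a homomorphism from `I` to the
minimal ideal which is the identity on the minimal ideal. The values of `f` outside `I` are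
irrelevant. -/
def IsRetraction (I : Set S) (f : S → S) : Prop :=
  ∃ M : Set S, IsMinimalIdeal M ∧ (∀ x ∈ I, f x ∈ M) ∧
    (∀ x ∈ I, ∀ y ∈ I, f (x * y) = f x * f y) ∧ ∀ x ∈ M, f x = x

/-- Retractable ideals. -/
def IsRetractableIdeal (I : Set S) : Prop :=
  IsIdeal I ∧ ∃ f : S → S, IsRetraction I f

/-- The `J`-class of `e` is stable. -/
def StableJClass (e : S) : Prop :=
  ∀ x : S, GreenJ x e → ∀ a : S,
    (GreenJ (x * a) x → GreenR (x * a) x) ∧ (GreenJ (a * x) x → GreenL (a * x) x)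

/-- The `J`-class of `e` is regular. -/
def RegularJClass (e : S) : Prop :=
  ∀ x : S, GreenJ x e → ∃ y : S, x = x * y * x

/-- The `J`-class of `e` is minimal among the `J`-classes contained in the complement of `I`. -/
def MinimalJClassOutside (I : Set S) (e : S) : Prop :=
  (∀ x : S, GreenJ x e → x ∉ I) ∧
    ∀ y : S, (∀ z : S, GreenJ z y → z ∉ I) → (∃ s t : S, y = s * e * t) → GreenJ y e

/-- For an idempotent `e`, the maximal subgroup with identity `e` is the `H`-class of `e`.
This says that `N` is a normal subgroup of that group. -/
def IsNormalSubgroupAt (e : S) (N : Set S) : Prop :=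
  (∀ x ∈ N, GreenH x e) ∧ e ∈ N ∧ (∀ x ∈ N, ∀ y ∈ N, x * y ∈ N) ∧
    (∀ x ∈ N, ∃ y ∈ N, x * y = e ∧ y * x = e) ∧
    ∀ g h : S, GreenH g e → GreenH h e → g * h = e → h * g = e → ∀ x ∈ N, g * x * h ∈ N

/-- IN-pairs `(I, N)`: `I` is an ideal and `N` is a normal subgroup of a maximal subgroup
contained in a stable, regular `J`-class that is minimal outside `I`. -/
def IsINPair (I N : Set S) : Prop :=
  IsIdeal I ∧ ∃ e : S, e * e = e ∧ IsNormalSubgroupAt e N ∧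
    StableJClass e ∧ RegularJClass e ∧ MinimalJClassOutside I e

/-- Proper IN-pairs: those with `|N| ≥ 2`. -/
def IsProperINPair (I N : Set S) : Prop := IsINPair I N ∧ N.Nontrivial

/-- Retractable IN-pairs: `I` is retractable and all elements of `N` act in the same way, on the
left and on the right, on each element of the minimal ideal. -/
def IsRetractableINPair (I N : Set S) : Prop :=
  IsINPair I N ∧ IsRetractableIdeal I ∧
    ∀ M : Set S, IsMinimalIdeal M → ∀ x ∈ M, ∀ u ∈ N, ∀ v ∈ N, x * u = x * v ∧ u * x = v * x

/-- The relation `ν_N = S(N × N)S ∩ (J × J)`, where `J` is the `J`-class containing `N`. -/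
def nuRel (N : Set S) (x y : S) : Prop :=
  ∃ u ∈ N, ∃ v ∈ N, ∃ s t : S,
    x = s * u * t ∧ y = s * v * t ∧ GreenJ x u ∧ GreenJ y v

/-- The Rees congruence `R_I`, as a relation. -/
def reesRel (I : Set S) (x y : S) : Prop := x = y ∨ (x ∈ I ∧ y ∈ I)

/-- The relation `R_{I,N} = R_I ∪ ν_N`. -/
def inRel (I N : Set S) (x y : S) : Prop := reesRel I x y ∨ nuRel N x y

/-- The relation `Δ ∪ ν_N ∪ {(x, y) ∈ I × I | (xf, yf) ∈ ξ}`, where `f` is the (unique)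
retraction of `I` onto the minimal ideal. -/
def zetaRel (I N : Set S) (ξ : S → S → Prop) (x y : S) : Prop :=
  x = y ∨ nuRel N x y ∨ (x ∈ I ∧ y ∈ I ∧ ∃ f : S → S, IsRetraction I f ∧ ξ (f x) (f y))

/-- The relation `λ_{I,N}`. -/
def lamRel (I N : Set S) : S → S → Prop := zetaRel I N GreenL

/-- The relation `ρ_{I,N}`. -/
def rhoRel (I N : Set S) : S → S → Prop := zetaRel I N GreenR

/-- The relation `μ_{I,N}`. -/
def muRel (I N : Set S) : S → S → Prop := zetaRel I N GreenH

end SemigroupCong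

/-! ### The partition monoid -/

/-- The partitions of `{1, …, n} ∪ {1', …, n'}`, given by the equivalence relation `rel` whose
classes are the blocks. The upper vertex `i` is `Sum.inl i`, the lower vertex `i'` is
`Sum.inr i`. -/
@[ext]
structure PartitionMonoid (n : ℕ) where
  rel : Setoid (Fin n ⊕ Fin n)

namespace PartitionMonoid

variable {n : ℕ}

/-- Vertices of the product graph: upper, middle and lower row. -/
inductive Vertex (n : ℕ)
  | upper (i : Fin n)
  | middle (i : Fin n)
  | lower (i : Fin n)

/-- The rows of the first factor inside the product graph. -/
def top : Fin n ⊕ Fin n → Vertex n := Sum.elim Vertex.upper Vertex.middle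

/-- The rows of the second factor inside the product graph. -/
def bot : Fin n ⊕ Fin n → Vertex n := Sum.elim Vertex.middle Vertex.lower

/-- The rows of the product inside the product graph. -/
def outer : Fin n ⊕ Fin n → Vertex n := Sum.elim Vertex.upper Vertex.lower

/-- The connectedness relation of the product graph of `a` and `b`: the equivalence relation
generated by the copy of `a` on the upper and middle rows and the copy of `b` on the middle and
lower rows. -/
def productGraph (a b : PartitionMonoid n) : Setoid (Vertex n) :=
  a.rel.map top ⊔ b.rel.map bot

instance : Mul (PartitionMonoid n) where
  mul a b := ⟨(productGraph a b).comap outer⟩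

/-- The identity has the blocks `{i, i'}`. -/
instance : One (PartitionMonoid n) where
  one := ⟨Setoid.ker (Sum.elim id id)⟩

theorem mul_rel (a b : PartitionMonoid n) :
    (a * b).rel = (productGraph a b).comap outer := rfl

theorem map_le_iff {α β : Type*} {r : Setoid α} {f : α → β} {s : Setoid β} :
    r.map f ≤ s ↔ ∀ x y, r x y → s (f x) (f y) := by
  constructor
  · intro h x y hxy
    exact h (Setoid.le_comap_map hxy)
  · intro h x y hxy
    induction hxy with
    | rel _ _ hab => obtain ⟨a, b, hab, rfl, rfl⟩ := hab; exact h a b hab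
    | refl _ => exact s.refl' _
    | symm _ _ _ ih => exact s.symm' ih
    | trans _ _ _ _ _ ih1 ih2 => exact s.trans' ih1 ih2

theorem map_rel {α β : Type*} {r : Setoid α} {f : α → β} {x y : α} (h : r x y) :
    r.map f (f x) (f y) := map_le_iff.1 le_rfl x y h

theorem le_sup_left_rel {α : Type*} {r s : Setoid α} {x y : α} (h : r x y) : (r ⊔ s) x y :=
  (le_sup_left : r ≤ r ⊔ s) h

theorem le_sup_right_rel {α : Type*} {r s : Setoid α} {x y : α} (h : s x y) : (r ⊔ s) x y :=
  (le_sup_right : s ≤ r ⊔ s) h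

/-- Vertices outside the range of `f` can be eliminated when joining with a relation that lives
on the range of `f`. -/
theorem comap_sup_map {α β : Type*} (f : α → β) (s : Setoid β) (t : Setoid α) :
    (s ⊔ t.map f).comap f = s.comap f ⊔ t := by
  apply le_antisymm
  · let q : Setoid β :=
      { r := fun x y => s x y ∨ ∃ a b, s x (f a) ∧ (s.comap f ⊔ t) a b ∧ s (f b) y
        iseqv :=
          { refl := fun x => Or.inl (s.refl' x)
            symm := by
              rintro x y (h | ⟨a, b, h1, h2, h3⟩)
              · exact Or.inl (s.symm' h)
              · exact Or.inr ⟨b, a, s.symm' h3, Setoid.symm' _ h2, s.symm' h1⟩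
            trans := by
              rintro x y z (h | ⟨a, b, h1, h2, h3⟩) (h' | ⟨c, d, h1', h2', h3'⟩)
              · exact Or.inl (s.trans' h h')
              · exact Or.inr ⟨c, d, s.trans' h h1', h2', h3'⟩
              · exact Or.inr ⟨a, b, h1, h2, s.trans' h3 h'⟩
              · have hbc : (s.comap f ⊔ t) b c := le_sup_left_rel (s.trans' h3 h1')
                exact Or.inr ⟨a, d, h1, Setoid.trans' _ h2 (Setoid.trans' _ hbc h2'), h3'⟩ } }
    have hq : s ⊔ t.map f ≤ q := by
      refine sup_le (fun x y h => Or.inl h) (map_le_iff.2 fun x y h => ?_)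
      exact Or.inr ⟨x, y, s.refl' _, le_sup_right_rel h, s.refl' _⟩
    intro x y h
    rcases hq h with h | ⟨a, b, h1, h2, h3⟩
    · exact le_sup_left_rel h
    · have h1' : (s.comap f ⊔ t) x a := le_sup_left_rel h1
      have h3' : (s.comap f ⊔ t) b y := le_sup_left_rel h3
      exact Setoid.trans' _ h1' (Setoid.trans' _ h2 h3')
  · refine sup_le (fun x y h => le_sup_left_rel h) (fun x y h => ?_)
    exact le_sup_right_rel (map_rel h)

theorem map_rel_iff {α β : Type*} {r : Setoid α} {f : α → β} (hf : Function.Injective f)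
    {x y : β} : r.map f x y ↔ x = y ∨ ∃ a b, r a b ∧ f a = x ∧ f b = y := by
  have hk : Setoid.ker f ≤ r := by
    intro a b hab
    rw [hf hab]
  have h := congrFun (congrFun (Setoid.coe_map_of_ker_le r f hk) x) y
  rw [h]
  change (Relation.Map r f f x y ∨ x = y) ↔ _
  rw [or_comm]
  rfl

/-- Compatibility of restriction and extension of equivalence relations in a pullback square of
injective maps. -/
theorem comap_map_eq_map_comap {α β γ δ : Type*} {f : β → δ} {g : γ → δ} {p : α → β} {q : α → γ}
    (hf : Function.Injective f) (hg : Function.Injective g) (hp : Function.Injective p)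
    (hcomm : ∀ x, f (p x) = g (q x)) (hpull : ∀ y z, f y = g z → ∃ x, p x = y ∧ q x = z)
    (r : Setoid γ) : (r.map g).comap f = (r.comap q).map p := by
  ext x y
  rw [Setoid.comap_rel, map_rel_iff hg, map_rel_iff hp]
  constructor
  · rintro (h | ⟨a, b, hab, ha, hb⟩)
    · exact Or.inl (hf h)
    · obtain ⟨u, rfl, rfl⟩ := hpull x a ha.symm
      obtain ⟨v, rfl, rfl⟩ := hpull y b hb.symm
      exact Or.inr ⟨u, v, hab, rfl, rfl⟩
  · rintro (h | ⟨a, b, hab, rfl, rfl⟩)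
    · exact Or.inl (congrArg f h)
    · exact Or.inr ⟨q a, q b, hab, (hcomm a).symm, (hcomm b).symm⟩

theorem map_sup_map {α β : Type*} (f : α → β) (r s : Setoid α) :
    (r ⊔ s).map f = r.map f ⊔ s.map f := by
  apply le_antisymm
  · refine map_le_iff.2 fun x y h => ?_
    have hle : r ⊔ s ≤ (r.map f ⊔ s.map f).comap f :=
      sup_le (fun _ _ h => le_sup_left_rel (map_rel h))
        (fun _ _ h => le_sup_right_rel (map_rel h))
    exact hle h
  · exact sup_le (map_le_iff.2 fun _ _ h => map_rel (le_sup_left_rel h))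
      (map_le_iff.2 fun _ _ h => map_rel (le_sup_right_rel h))

theorem map_map_comp {α β γ : Type*} (f : α → β) (g : β → γ) (r : Setoid α) :
    (r.map f).map g = r.map (g ∘ f) := by
  apply le_antisymm
  · refine map_le_iff.2 fun x y h => ?_
    have hle : r.map f ≤ (r.map (g ∘ f)).comap g :=
      map_le_iff.2 fun a b hab => map_rel (f := g ∘ f) hab
    exact hle h
  · exact map_le_iff.2 fun _ _ h => map_rel (map_rel h)

/-- Vertices of the product graph of three partitions. -/
inductive Vertex₄ (n : ℕ)
  | row1 (i : Fin n)
  | row2 (i : Fin n)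
  | row3 (i : Fin n)
  | row4 (i : Fin n)

def rows123 : Vertex n → Vertex₄ n
  | .upper i => .row1 i
  | .middle i => .row2 i
  | .lower i => .row3 i

def rows234 : Vertex n → Vertex₄ n
  | .upper i => .row2 i
  | .middle i => .row3 i
  | .lower i => .row4 i

def rows134 : Vertex n → Vertex₄ n
  | .upper i => .row1 i
  | .middle i => .row3 i
  | .lower i => .row4 i

def rows124 : Vertex n → Vertex₄ n
  | .upper i => .row1 i
  | .middle i => .row2 i
  | .lower i => .row4 i

theorem rows123_injective : Function.Injective (rows123 (n := n)) := by
  rintro (i | i | i) (j | j | j) h <;> simp_all [rows123]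

theorem rows234_injective : Function.Injective (rows234 (n := n)) := by
  rintro (i | i | i) (j | j | j) h <;> simp_all [rows234]

theorem rows134_injective : Function.Injective (rows134 (n := n)) := by
  rintro (i | i | i) (j | j | j) h <;> simp_all [rows134]

theorem rows124_injective : Function.Injective (rows124 (n := n)) := by
  rintro (i | i | i) (j | j | j) h <;> simp_all [rows124]

theorem top_injective : Function.Injective (top (n := n)) := by
  rintro (i | i) (j | j) h <;> simp_all [top]

theorem bot_injective : Function.Injective (bot (n := n)) := by
  rintro (i | i) (j | j) h <;> simp_all [bot]

theorem mul_assoc_aux (a b c : PartitionMonoid n) : (a * b) * c = a * (b * c) := by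
  have e1 : rows134 ∘ bot = rows234 ∘ bot (n := n) := by
    funext x; rcases x with i | i <;> rfl
  have e2 : rows124 ∘ top = rows123 ∘ top (n := n) := by
    funext x; rcases x with i | i <;> rfl
  have e3 : rows123 ∘ bot = rows234 ∘ top (n := n) := by
    funext x; rcases x with i | i <;> rfl
  have e4 : rows134 ∘ outer = rows124 ∘ outer (n := n) := by
    funext x; rcases x with i | i <;> rfl
  have hl : ((productGraph a b).map rows123).comap rows134 = (a * b).rel.map top := by
    refine comap_map_eq_map_comap rows134_injective rows123_injective top_injective ?_ ?_ _
    · rintro (i | i) <;> rfl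
    · rintro (i | i | i) (j | j | j) h <;> simp only [rows134, rows123, reduceCtorEq] at h
      · exact ⟨Sum.inl i, rfl, by cases h; rfl⟩
      · exact ⟨Sum.inr i, rfl, by cases h; rfl⟩
  have hr : ((productGraph b c).map rows234).comap rows124 = (b * c).rel.map bot := by
    refine comap_map_eq_map_comap rows124_injective rows234_injective bot_injective ?_ ?_ _
    · rintro (i | i) <;> rfl
    · rintro (i | i | i) (j | j | j) h <;> simp only [rows124, rows234, reduceCtorEq] at h
      · exact ⟨Sum.inl i, rfl, by cases h; rfl⟩
      · exact ⟨Sum.inr i, rfl, by cases h; rfl⟩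
  have h1 : productGraph (a * b) c =
      ((productGraph a b).map rows123 ⊔ (c.rel.map bot).map rows134).comap rows134 := by
    rw [comap_sup_map, hl]; rfl
  have h2 : productGraph a (b * c) =
      ((productGraph b c).map rows234 ⊔ (a.rel.map top).map rows124).comap rows124 := by
    rw [comap_sup_map, hr, sup_comm]; rfl
  have h3 : (productGraph a b).map rows123 ⊔ (c.rel.map bot).map rows134 =
      (productGraph b c).map rows234 ⊔ (a.rel.map top).map rows124 := by
    simp only [productGraph, map_sup_map, map_map_comp, e1, e2, e3]
    ac_rfl
  apply PartitionMonoid.ext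
  rw [mul_rel, mul_rel, h1, h2, h3]
  exact congrArg (fun k => Setoid.comap k
    ((productGraph b c).map rows234 ⊔ (a.rel.map top).map rows124)) e4

theorem one_mul_aux (a : PartitionMonoid n) : 1 * a = a := by
  apply PartitionMonoid.ext
  have h : productGraph 1 a = a.rel.comap
      (fun v : Vertex n => match v with
        | .upper i => Sum.inl i
        | .middle i => Sum.inl i
        | .lower i => Sum.inr i) := by
    apply le_antisymm
    · refine sup_le (map_le_iff.2 ?_) (map_le_iff.2 ?_)
      · rintro (i | i) (j | j) h <;>
          (have h' : i = j := h
           subst h'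
           exact a.rel.refl' _)
      · rintro (i | i) (j | j) h <;> exact h
    · have hu : ∀ i : Fin n, productGraph 1 a (.upper i) (.middle i) := fun i =>
        le_sup_left_rel (map_rel (f := top) (x := Sum.inl i) (y := Sum.inr i) rfl)
      have hb : ∀ x y, a.rel x y → productGraph 1 a (bot x) (bot y) := fun x y h =>
        le_sup_right_rel (map_rel h)
      rintro (i | i | i) (j | j | j) h
      · exact Setoid.trans' _ (hu i) (Setoid.trans' _ (hb _ _ h) (Setoid.symm' _ (hu j)))
      · exact Setoid.trans' _ (hu i) (hb _ _ h)
      · exact Setoid.trans' _ (hu i) (hb _ _ h)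
      · exact Setoid.trans' _ (hb _ _ h) (Setoid.symm' _ (hu j))
      · exact hb _ _ h
      · exact hb _ _ h
      · exact Setoid.trans' _ (hb _ _ h) (Setoid.symm' _ (hu j))
      · exact hb _ _ h
      · exact hb _ _ h
  rw [mul_rel, h]
  ext x y
  rcases x with i | i <;> rcases y with j | j <;> rfl

theorem mul_one_aux (a : PartitionMonoid n) : a * 1 = a := by
  apply PartitionMonoid.ext
  have h : productGraph a 1 = a.rel.comap
      (fun v : Vertex n => match v with
        | .upper i => Sum.inl i
        | .middle i => Sum.inr i
        | .lower i => Sum.inr i) := by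
    apply le_antisymm
    · refine sup_le (map_le_iff.2 ?_) (map_le_iff.2 ?_)
      · rintro (i | i) (j | j) h <;> exact h
      · rintro (i | i) (j | j) h <;>
          (have h' : i = j := h
           subst h'
           exact a.rel.refl' _)
    · have hu : ∀ i : Fin n, productGraph a 1 (.middle i) (.lower i) := fun i =>
        le_sup_right_rel (map_rel (f := bot) (x := Sum.inl i) (y := Sum.inr i) rfl)
      have hb : ∀ x y, a.rel x y → productGraph a 1 (top x) (top y) := fun x y h =>
        le_sup_left_rel (map_rel h)
      rintro (i | i | i) (j | j | j) h
      · exact hb _ _ h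
      · exact hb _ _ h
      · exact Setoid.trans' _ (hb _ _ h) (hu j)
      · exact hb _ _ h
      · exact hb _ _ h
      · exact Setoid.trans' _ (hb _ _ h) (hu j)
      · exact Setoid.trans' _ (Setoid.symm' _ (hu i)) (hb _ _ h)
      · exact Setoid.trans' _ (Setoid.symm' _ (hu i)) (hb _ _ h)
      · exact Setoid.trans' _ (Setoid.symm' _ (hu i)) (Setoid.trans' _ (hb _ _ h) (hu j))
  rw [mul_rel, h]
  ext x y
  rcases x with i | i <;> rcases y with j | j <;> rfl

instance : Monoid (PartitionMonoid n) where
  mul_assoc := mul_assoc_aux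
  one_mul := one_mul_aux
  mul_one := mul_one_aux

/-- The rank: the number of transversals, i.e. of blocks meeting both rows. -/
noncomputable def rank (a : PartitionMonoid n) : ℕ :=
  {B : Set (Fin n ⊕ Fin n) |
    B ∈ a.rel.classes ∧ (∃ i, Sum.inl i ∈ B) ∧ ∃ j, Sum.inr j ∈ B}.ncard

/-- The set `I_q` of partitions of rank at most `q`. -/
def rankIdeal (n q : ℕ) : Set (PartitionMonoid n) := {a | a.rank ≤ q}

/-- For a permutation `σ` of `q ≤ n` letters, the partition whose transversals are the blocks
`{i, (iσ)'}` for `i` one of the first `q` letters, all other blocks being singletons. -/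
def bar (n : ℕ) {q : ℕ} (σ : Equiv.Perm (Fin q)) : PartitionMonoid n where
  rel :=
    { r := fun x y => x = y ∨ ∃ (i : Fin q) (a b : Fin n), a.val = i.val ∧ b.val = (σ i).val ∧
        ((x = Sum.inl a ∧ y = Sum.inr b) ∨ (x = Sum.inr b ∧ y = Sum.inl a))
      iseqv :=
        { refl := fun x => Or.inl rfl
          symm := by
            rintro x y (h | ⟨i, a, b, ha, hb, h | h⟩)
            · exact Or.inl h.symm
            · exact Or.inr ⟨i, a, b, ha, hb, Or.inr ⟨h.2, h.1⟩⟩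
            · exact Or.inr ⟨i, a, b, ha, hb, Or.inl ⟨h.2, h.1⟩⟩
          trans := by
            rintro x y z (rfl | ⟨i, a, b, ha, hb, h⟩) (rfl | ⟨j, c, d, hc, hd, h'⟩)
            · exact Or.inl rfl
            · exact Or.inr ⟨j, c, d, hc, hd, h'⟩
            · exact Or.inr ⟨i, a, b, ha, hb, h⟩
            · left
              rcases h with ⟨rfl, rfl⟩ | ⟨rfl, rfl⟩ <;> rcases h' with ⟨h1, rfl⟩ | ⟨h1, rfl⟩
              · simp at h1
              · have hbd : b = d := Sum.inr_injective h1
                subst hbd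
                have hij : i = j := σ.injective (Fin.ext (hb.symm.trans hd))
                subst hij
                exact congrArg Sum.inl (Fin.ext (ha.trans hc.symm))
              · have hac : a = c := Sum.inl_injective h1
                subst hac
                have hij : i = j := Fin.ext (ha.symm.trans hc)
                subst hij
                exact congrArg Sum.inr (Fin.ext (hb.trans hd.symm))
              · simp at h1 } }

/-- The image of a subgroup `N` of the symmetric group on `q` letters. The multiplication of
permutations is opposite to that of partitions, which does not affect which subsets are (normal)
subgroups. -/
def groupBar (n : ℕ) {q : ℕ} (N : Subgroup (Equiv.Perm (Fin q))) : Set (PartitionMonoid n) :=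
  bar n '' (N : Set (Equiv.Perm (Fin q)))

/-- Names of the three retractable IN-pairs. -/
inductive RetractablePair
  | c0
  | c1
  | cS2

/-- The rank bounding the ideal of the pair: `I_0`, `I_1`, `I_1`. -/
def RetractablePair.idealRank : RetractablePair → ℕ
  | .c0 => 0
  | .c1 => 1
  | .cS2 => 1

/-- The subgroup of the pair: trivial in the symmetric group on one letter, trivial in the
symmetric group on two letters, and the whole symmetric group on two letters. -/
def RetractablePair.subgroup :
    (C : RetractablePair) → Subgroup (Equiv.Perm (Fin (C.idealRank + 1)))
  | .c0 => ⊥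
  | .c1 => ⊥
  | .cS2 => ⊤

/-- The ideal of the pair. -/
def RetractablePair.ideal (n : ℕ) (C : RetractablePair) : Set (PartitionMonoid n) :=
  rankIdeal n C.idealRank

/-- The normal subgroup of a maximal subgroup of the partition monoid of the pair. -/
def RetractablePair.group (n : ℕ) (C : RetractablePair) : Set (PartitionMonoid n) :=
  groupBar n C.subgroup

/-- Names of the congruences: `R_q` for `0 ≤ q ≤ n`; `R_N` for a non-trivial normal subgroup `N`
of the symmetric group on `q` letters, `2 ≤ q ≤ n`; and `λ_C`, `ρ_C`, `μ_C` for the three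
retractable IN-pairs `C`. -/
inductive CongName (n : ℕ)
  | R (q : ℕ) (hq : q ≤ n)
  | RN (q : ℕ) (h2 : 2 ≤ q) (hq : q ≤ n) (N : Subgroup (Equiv.Perm (Fin q)))
      (hN : N.Normal) (hne : N ≠ ⊥)
  | lam (C : RetractablePair)
  | rho (C : RetractablePair)
  | mu (C : RetractablePair)

open SemigroupCong in
/-- The relation with a given name. -/
def CongName.toRel : CongName n → PartitionMonoid n → PartitionMonoid n → Prop
  | .R q _ => reesRel (rankIdeal n q)
  | .RN q _ _ N _ _ => inRel (rankIdeal n (q - 1)) (groupBar n N)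
  | .lam C => lamRel (C.ideal n) (C.group n)
  | .rho C => rhoRel (C.ideal n) (C.group n)
  | .mu C => muRel (C.ideal n) (C.group n)

/-- The Klein four-group inside the symmetric group on four letters. -/
def klein : Subgroup (Equiv.Perm (Fin 4)) where
  carrier := {1, Equiv.swap 0 1 * Equiv.swap 2 3, Equiv.swap 0 2 * Equiv.swap 1 3,
    Equiv.swap 0 3 * Equiv.swap 1 2}
  mul_mem' := by
    simp only [Set.mem_insert_iff, Set.mem_singleton_iff]
    rintro a b (rfl | rfl | rfl | rfl) (rfl | rfl | rfl | rfl) <;> decide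
  one_mem' := Or.inl rfl
  inv_mem' := by
    simp only [Set.mem_insert_iff, Set.mem_singleton_iff]
    rintro a (rfl | rfl | rfl | rfl) <;> decide

/-- The edges of the Hasse diagram, directed upwards. First the prism (the product of a diamond
and a chain with three elements), with `R_0`, `R_1`, `R_{S_2}` at the tops of the diamonds, then
the wick `R_{S_2} < R_2 < R_{A_3} < R_{S_3} < R_3 < R_K < R_{A_4} < R_{S_4} < R_4 < R_{A_5} < …`. -/
inductive HasseEdge (n : ℕ) : CongName n → CongName n → Prop
  | mu_lam (C) : HasseEdge n (.mu C) (.lam C)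
  | mu_rho (C) : HasseEdge n (.mu C) (.rho C)
  | lam_R0 (h) : HasseEdge n (.lam .c0) (.R 0 h)
  | rho_R0 (h) : HasseEdge n (.rho .c0) (.R 0 h)
  | lam_R1 (h) : HasseEdge n (.lam .c1) (.R 1 h)
  | rho_R1 (h) : HasseEdge n (.rho .c1) (.R 1 h)
  | lam_RS2 (h2 h hN hne) : HasseEdge n (.lam .cS2) (.RN 2 h2 h ⊤ hN hne)
  | rho_RS2 (h2 h hN hne) : HasseEdge n (.rho .cS2) (.RN 2 h2 h ⊤ hN hne)
  | mu_01 : HasseEdge n (.mu .c0) (.mu .c1)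
  | mu_1S2 : HasseEdge n (.mu .c1) (.mu .cS2)
  | lam_01 : HasseEdge n (.lam .c0) (.lam .c1)
  | lam_1S2 : HasseEdge n (.lam .c1) (.lam .cS2)
  | rho_01 : HasseEdge n (.rho .c0) (.rho .c1)
  | rho_1S2 : HasseEdge n (.rho .c1) (.rho .cS2)
  | R_01 (h h') : HasseEdge n (.R 0 h) (.R 1 h')
  | R_1S2 (h h2 h' hN hne) : HasseEdge n (.R 1 h) (.RN 2 h2 h' ⊤ hN hne)
  | sym_R (q h2 h hN hne h') : HasseEdge n (.RN q h2 h ⊤ hN hne) (.R q h')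
  | alt_sym (q) (h3 : 3 ≤ q) (h2 h hN hne hN' hne') :
      HasseEdge n (.RN q h2 h (alternatingGroup (Fin q)) hN hne) (.RN q h2 h ⊤ hN' hne')
  | R_alt (q) (h3 : 2 ≤ q) (h4 : q ≠ 3) (h h2 h' hN hne) :
      HasseEdge n (.R q h) (.RN (q + 1) h2 h' (alternatingGroup (Fin (q + 1))) hN hne)
  | R_klein (h h2 h' hN hne) : HasseEdge n (.R 3 h) (.RN 4 h2 h' klein hN hne)
  | klein_alt (h2 h hN hne hN' hne') :
      HasseEdge n (.RN 4 h2 h klein hN hne) (.RN 4 h2 h (alternatingGroup (Fin 4)) hN' hne')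

end PartitionMonoid

/-!
In the partition monoid the rank determines the `J`-class (`greenJ_iff_rank`): cutting `x` down to
its transversals on both sides gives the idempotent `eps n q`, whose maximal subgroup consists of
the permutations `bar n σ` (`greenH_eps_iff`). The monoid is finite, so all its `J`-classes are
stable, and every ideal consists of the partitions of rank at most some `q` (`isIdeal_iff`).
Normal subgroups at two idempotents of one `J`-class correspond to each other with the same `ν_N`
(`IdemPair.nuRel_eq`), so the IN-pairs are those given by the normal subgroups of the symmetric
groups (`exists_of_isINPair`). On partitions of rank at most `1` a retraction onto the minimal
ideal splits the transversal (`hat`); from rank `2` on there is none, because on the minimal ideal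
it would make left multiplication by an idempotent of rank `2` constant on upper kernels
(`isRetractableIdeal_iff`).

The relations attached to these pairs are congruences by one gluing construction (`layerCon`):
`ν_N` in rank `q`, a suitable relation below, equality above. An element of the minimal ideal is
determined by its upper and lower kernel, and there the relations `L`, `R` and `H` compare the
lower, the upper and both kernels (`kerRel`).

Conversely, let `θ` be any congruence. Call a rank `q` dropped if a partition of rank `q` is related
to one of smaller rank. Dropped ranks propagate downwards to rank `1` (`DropsRank.pred`), and if
`q ≥ 2` is dropped, then all partitions of rank at most `q` are related (`DropsRank.rel`). A related
pair of equal rank that is not `H`-related can be separated by a multiplication that lowers the rank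
of just one member, so that the rank is dropped (`DropsRank.of_not_greenH`); a related pair of
distinct `H`-related partitions amounts to a non-trivial normal subgroup `conPerm` of the symmetric
group, and forces the next lower rank to be dropped (`DropsRank.of_conPerm`). Hence `θ` is
determined by its height `p`, the largest dropped rank, by the normal subgroup of the symmetric
group on `p + 1` letters, and by whether it identifies different upper or different lower kernels on
the minimal ideal (`HasHeight.cases_of_rel`, `HasHeight.rel_of_kerRel`); identifying two upper
kernels is as good as identifying them all (`rel_of_lker_eq`).

The normal subgroups of a symmetric group form a chain (`normal_cases`, `le_iff_code_le`). Inclusion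
of congruences is therefore the componentwise order on triples of numbers: two bits for the kernels
and four times the height plus the position of the group (`HasHeight.le_iff`,
`CongName.toCon_le_iff`). The classification and the covering relations follow by comparing these
triples with the values that actually occur (`CongName.toCon_surjective`, `HasseEdge.covBy`,
`CongName.exists_hasseEdge`).
-/

/-! ### Finite monoids: stability and coordinates in a `J`-class -/

namespace SemigroupCong

variable {S : Type*} [Monoid S]

theorem greenR_iff {a b : S} : GreenR a b ↔ (∃ s, a = b * s) ∧ ∃ s, b = a * s := by
  constructor
  · intro h
    exact ⟨(Set.ext_iff.1 h a).1 ⟨1, (mul_one a).symm⟩, (Set.ext_iff.1 h b).2 ⟨1, (mul_one b).symm⟩⟩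
  · rintro ⟨⟨s, hs⟩, t, ht⟩
    ext x
    constructor
    · rintro ⟨u, rfl⟩; exact ⟨s * u, by rw [← mul_assoc, ← hs]⟩
    · rintro ⟨u, rfl⟩; exact ⟨t * u, by rw [← mul_assoc, ← ht]⟩

theorem greenL_iff {a b : S} : GreenL a b ↔ (∃ s, a = s * b) ∧ ∃ s, b = s * a := by
  constructor
  · intro h
    exact ⟨(Set.ext_iff.1 h a).1 ⟨1, (one_mul a).symm⟩, (Set.ext_iff.1 h b).2 ⟨1, (one_mul b).symm⟩⟩
  · rintro ⟨⟨s, hs⟩, t, ht⟩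
    ext x
    constructor
    · rintro ⟨u, rfl⟩; exact ⟨u * s, by rw [mul_assoc, ← hs]⟩
    · rintro ⟨u, rfl⟩; exact ⟨u * t, by rw [mul_assoc, ← ht]⟩

theorem greenJ_iff {a b : S} :
    GreenJ a b ↔ (∃ s t, a = s * b * t) ∧ ∃ s t, b = s * a * t := by
  constructor
  · intro h
    exact ⟨(Set.ext_iff.1 h a).1 ⟨1, 1, by simp⟩, (Set.ext_iff.1 h b).2 ⟨1, 1, by simp⟩⟩
  · rintro ⟨⟨s, s', hs⟩, t, t', ht⟩
    ext x
    constructor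
    · rintro ⟨u, v, rfl⟩; exact ⟨u * s, s' * v, by rw [hs]; simp only [mul_assoc]⟩
    · rintro ⟨u, v, rfl⟩; exact ⟨u * t, t' * v, by rw [ht]; simp only [mul_assoc]⟩

theorem GreenJ.symm {a b : S} (h : GreenJ a b) : GreenJ b a := Eq.symm h

theorem GreenJ.trans {a b c : S} (h : GreenJ a b) (h' : GreenJ b c) : GreenJ a c := Eq.trans h h'

theorem GreenR.greenJ {a b : S} (h : GreenR a b) : GreenJ a b := by
  obtain ⟨⟨s, hs⟩, t, ht⟩ := greenR_iff.1 h
  exact greenJ_iff.2 ⟨⟨1, s, by simpa using hs⟩, 1, t, by simpa using ht⟩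

theorem GreenH.refl (a : S) : GreenH a a := ⟨rfl, rfl⟩

theorem GreenH.symm {a b : S} (h : GreenH a b) : GreenH b a := ⟨Eq.symm h.1, Eq.symm h.2⟩

/-- In a finite monoid a right multiple of `x` which is not strictly `J`-below `x` generates the
same right ideal: the right ideals of `x` and `x * a` are equinumerous. -/
theorem exists_eq_mul_of_le_right [Finite S] {x a s t : S} (h : x = s * (x * a) * t) :
    ∃ w, x = x * a * w := by
  have hsub : Set.range (fun y => x * a * y) ⊆ Set.range (fun y => x * y) := by
    rintro _ ⟨y, rfl⟩; exact ⟨a * y, by simp only [mul_assoc]⟩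
  have hsub' : Set.range (fun y => x * y) ⊆ (fun y => s * y) '' Set.range (fun y => x * a * y) := by
    rintro _ ⟨y, rfl⟩
    refine ⟨x * a * (t * y), ⟨t * y, rfl⟩, ?_⟩
    conv_rhs => simp only; rw [h]
    simp only [mul_assoc]
  have hcard : (Set.range fun y => x * y).ncard ≤ (Set.range fun y => x * a * y).ncard :=
    (Set.ncard_le_ncard hsub' (Set.toFinite _)).trans (Set.ncard_image_le (Set.toFinite _))
  have heq := Set.eq_of_subset_of_ncard_le hsub hcard (Set.toFinite _)
  have hx : x ∈ Set.range (fun y => x * y) := ⟨1, mul_one x⟩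
  rw [← heq] at hx
  obtain ⟨w, hw⟩ := hx
  exact ⟨w, hw.symm⟩

theorem exists_eq_mul_of_le_left [Finite S] {x a s t : S} (h : x = s * (a * x) * t) :
    ∃ w, x = w * (a * x) := by
  have hsub : Set.range (fun y => y * (a * x)) ⊆ Set.range (fun y => y * x) := by
    rintro _ ⟨y, rfl⟩; exact ⟨y * a, by simp only [mul_assoc]⟩
  have hsub' : Set.range (fun y => y * x) ⊆
      (fun y => y * t) '' Set.range (fun y => y * (a * x)) := by
    rintro _ ⟨y, rfl⟩
    refine ⟨y * s * (a * x), ⟨y * s, rfl⟩, ?_⟩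
    conv_rhs => simp only; rw [h]
    simp only [mul_assoc]
  have hcard : (Set.range fun y => y * x).ncard ≤ (Set.range fun y => y * (a * x)).ncard :=
    (Set.ncard_le_ncard hsub' (Set.toFinite _)).trans (Set.ncard_image_le (Set.toFinite _))
  have heq := Set.eq_of_subset_of_ncard_le hsub hcard (Set.toFinite _)
  have hx : x ∈ Set.range (fun y => y * x) := ⟨1, one_mul x⟩
  rw [← heq] at hx
  obtain ⟨w, hw⟩ := hx
  exact ⟨w, hw.symm⟩

theorem stableJClass [Finite S] (e : S) : StableJClass e := by
  intro x _ a
  constructor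
  · intro h
    obtain ⟨-, s, t, h⟩ := greenJ_iff.1 h
    obtain ⟨w, hw⟩ := exists_eq_mul_of_le_right h
    exact greenR_iff.2 ⟨⟨a, rfl⟩, w, hw⟩
  · intro h
    obtain ⟨-, s, t, h⟩ := greenJ_iff.1 h
    obtain ⟨w, hw⟩ := exists_eq_mul_of_le_left h
    exact greenL_iff.2 ⟨⟨a, rfl⟩, w, hw⟩

/-- Coordinates of an element `x` of the `J`-class of an idempotent `e`: it factors as
`x = s * t` through `e`, and `w` and `z` undo the factors. Multiplication by `s` on the left and `t`
on the right identifies the maximal subgroup at `e` with the `H`-class of `x`. -/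
structure Coords (e x s t w z : S) : Prop where
  eq : x = s * t
  s_e : s * e = s
  e_t : e * t = t
  w_s : w * s = e
  t_z : t * z = e
  e_w : e * w = w
  z_e : z * e = z

theorem exists_coords [Finite S] {e x : S} (he : e * e = e) (h : GreenJ x e) :
    ∃ s t w z, Coords e x s t w z := by
  obtain ⟨⟨s, t, hx⟩, p, q, hpq⟩ := greenJ_iff.1 h
  have h1 : e = p * (s * e) * (t * q) := by
    rw [hx] at hpq; simpa only [mul_assoc] using hpq
  have h2 : e = p * s * (e * t) * q := by
    rw [hx] at hpq; simpa only [mul_assoc] using hpq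
  obtain ⟨w, hw⟩ := exists_eq_mul_of_le_left h1
  obtain ⟨z, hz⟩ := exists_eq_mul_of_le_right h2
  refine ⟨s * e, e * t, e * w, z * e, ?_, ?_, ?_, ?_, ?_, ?_, ?_⟩
  · rw [hx, mul_assoc s e (e * t), ← mul_assoc e e, he, mul_assoc]
  · rw [mul_assoc, he]
  · rw [← mul_assoc, he]
  · rw [mul_assoc, ← hw, he]
  · rw [← mul_assoc, ← hz, he]
  · rw [← mul_assoc, he]
  · rw [mul_assoc, he]

/-- The `J`-class of an idempotent of a finite monoid is regular. -/
theorem regularJClass [Finite S] {e : S} (he : e * e = e) : RegularJClass e := by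
  intro x hx
  obtain ⟨s, t, w, z, hc⟩ := exists_coords he hx
  refine ⟨z * w, ?_⟩
  calc x = s * (e * e) * t := by rw [he, hc.s_e, hc.eq]
    _ = s * ((t * z) * (w * s)) * t := by rw [hc.w_s, hc.t_z]
    _ = x * (z * w) * x := by rw [hc.eq]; simp only [mul_assoc]

theorem Coords.greenJ {e x s t w z : S} (hc : Coords e x s t w z) (he : e * e = e) :
    GreenJ x e := by
  refine greenJ_iff.2 ⟨⟨s, t, ?_⟩, w, z, ?_⟩
  · rw [hc.s_e, hc.eq]
  · rw [hc.eq, ← mul_assoc, hc.w_s, mul_assoc, hc.t_z, he]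

theorem greenH_mul_left_cancel {e g : S} (he : e * e = e) (hg : GreenH g e) : e * g = g := by
  obtain ⟨⟨s, hs⟩, -⟩ := greenR_iff.1 hg.1
  rw [hs, ← mul_assoc, he]

theorem greenH_mul_right_cancel {e g : S} (he : e * e = e) (hg : GreenH g e) : g * e = g := by
  obtain ⟨⟨s, hs⟩, -⟩ := greenL_iff.1 hg.2
  rw [hs, mul_assoc, he]

/-- The `H`-class of `x` in coordinates. -/
theorem Coords.exists_of_greenH {e x y s t w z : S} (hc : Coords e x s t w z) (he : e * e = e)
    (hy : GreenH y x) : GreenH (w * y * z) e ∧ y = s * (w * y * z) * t := by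
  obtain ⟨⟨⟨a, ha⟩, b, hb⟩, ⟨c, hc'⟩, d, hd⟩ := And.imp greenR_iff.1 greenL_iff.1 hy
  have h1 : s * w * y = y := by
    rw [ha, hc.eq]
    calc s * w * (s * t * a) = s * (w * s) * t * a := by simp only [mul_assoc]
      _ = s * t * a := by rw [hc.w_s, hc.s_e]
  have h2 : y * z * t = y := by
    rw [hc', hc.eq]
    calc c * (s * t) * z * t = c * s * ((t * z) * t) := by simp only [mul_assoc]
      _ = c * (s * t) := by rw [hc.t_z, hc.e_t, mul_assoc]
  have hx : w * x * z = e := by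
    rw [hc.eq, ← mul_assoc, hc.w_s, mul_assoc, hc.t_z, he]
  refine ⟨⟨greenR_iff.2 ⟨⟨w * y * z, ?_⟩, t * b * z, ?_⟩,
    greenL_iff.2 ⟨⟨w * y * z, ?_⟩, w * d * s, ?_⟩⟩,
    ?_⟩
  · rw [← mul_assoc, ← mul_assoc, hc.e_w]
  · calc e = w * (y * z * t * b) * z := by rw [h2, ← hb, hx]
      _ = _ := by simp only [mul_assoc]
  · rw [mul_assoc _ z, hc.z_e]
  · calc e = w * (d * (s * w * y)) * z := by rw [h1, ← hd, hx]
      _ = _ := by simp only [mul_assoc]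
  · calc y = s * w * (y * z * t) := by rw [h2, h1]
      _ = _ := by simp only [mul_assoc]

theorem Coords.mul_greenH {e x s t w z g : S} (hc : Coords e x s t w z) (he : e * e = e)
    (hg : GreenH g e) : GreenH (s * g * t) x := by
  obtain ⟨⟨⟨a, ha⟩, b, hb⟩, ⟨c, hc'⟩, d, hd⟩ := And.imp greenR_iff.1 greenL_iff.1 hg
  have key1 : s * e * t = x := by rw [hc.s_e, hc.eq]
  have h1 : g = e * t * z * a := by rw [mul_assoc e, hc.t_z, he, ← ha]
  have h2 : g = c * (w * s * e) := by rw [hc.w_s, he, ← hc']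
  have hge := greenH_mul_right_cancel he hg
  have heg := greenH_mul_left_cancel he hg
  refine ⟨greenR_iff.2 ⟨⟨z * a * t, ?_⟩, z * b * t, ?_⟩,
    greenL_iff.2 ⟨⟨s * c * w, ?_⟩, s * d * w, ?_⟩⟩
  · calc s * g * t = s * (e * a) * t := by rw [← ha]
      _ = s * ((t * z) * a) * t := by rw [hc.t_z]
      _ = _ := by rw [hc.eq]; simp only [mul_assoc]
  · calc x = s * (g * b) * t := by rw [← hb, hc.s_e, hc.eq]
      _ = s * ((g * (t * z)) * b) * t := by rw [hc.t_z, hge]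
      _ = _ := by simp only [mul_assoc]
  · calc s * g * t = s * (c * e) * t := by rw [← hc']
      _ = s * (c * (w * s)) * t := by rw [hc.w_s]
      _ = _ := by rw [hc.eq]; simp only [mul_assoc]
  · calc x = s * (d * g) * t := by rw [← hd, hc.s_e, hc.eq]
      _ = s * (d * ((w * s) * g)) * t := by rw [hc.w_s, heg]
      _ = _ := by simp only [mul_assoc]

/-! ### The relation `ν_N` in a finite monoid -/

section Nu

variable {e : S} {N : Set S}

theorem IsNormalSubgroupAt.greenJ (hN : IsNormalSubgroupAt e N) {u : S} (hu : u ∈ N) :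
    GreenJ u e := (hN.1 u hu).1.greenJ

theorem nuRel.symm {x y : S} (h : nuRel N x y) : nuRel N y x := by
  obtain ⟨u, hu, v, hv, s, t, hx, hy, h1, h2⟩ := h
  exact ⟨v, hv, u, hu, s, t, hy, hx, h2, h1⟩

theorem nuRel.greenJ (hN : IsNormalSubgroupAt e N) {x y : S} (h : nuRel N x y) :
    GreenJ x e ∧ GreenJ y e := by
  obtain ⟨u, hu, v, hv, s, t, hx, hy, h1, h2⟩ := h
  exact ⟨h1.trans (hN.greenJ hu), h2.trans (hN.greenJ hv)⟩

/-- A normal form for `ν_N`: the first element can be put in coordinates. -/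
theorem nuRel_iff [Finite S] (he : e * e = e) (hN : IsNormalSubgroupAt e N) {x y s t w z : S}
    (hc : Coords e x s t w z) :
    nuRel N x y ↔ ∃ g ∈ N, y = s * g * t := by
  constructor
  · rintro ⟨u, hu, v, hv, p, q, hx, hy, h1, h2⟩
    -- `p * e = s * a` and `e * q = b * t` for units `a`, `b` with `a * u * b = e`
    have hue := greenH_mul_right_cancel he (hN.1 u hu)
    have heu := greenH_mul_left_cancel he (hN.1 u hu)
    have hve := greenH_mul_right_cancel he (hN.1 v hv)
    have hev := greenH_mul_left_cancel he (hN.1 v hv)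
    obtain ⟨u', hu', huu', hu'u⟩ := hN.2.2.2.1 u hu
    have heu' := greenH_mul_left_cancel he (hN.1 u' hu')
    have hu'e := greenH_mul_right_cancel he (hN.1 u' hu')
    have hst : s * t = p * u * q := by rw [← hc.eq, hx]
    have hwz : w * (p * u * q) * z = e := by
      rw [← hst, ← mul_assoc w, hc.w_s, mul_assoc, hc.t_z, he]
    -- stability: `p * u` is `R`-related to `x`, and `u * q` is `L`-related to `x`
    obtain ⟨a', b', hab'⟩ := (greenJ_iff.1 h1.symm).1
    have hL : ∃ k, p * u = p * u * q * k := by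
      apply exists_eq_mul_of_le_right (s := p * a') (t := b')
      rw [← hx]
      calc p * u = p * (a' * x * b') := by rw [← hab']
        _ = _ := by simp only [mul_assoc]
    have hR : ∃ k, u * q = k * (p * (u * q)) := by
      apply exists_eq_mul_of_le_left (s := a') (t := b' * q)
      rw [← mul_assoc p, ← hx]
      calc u * q = (a' * x * b') * q := by rw [← hab']
        _ = _ := by simp only [mul_assoc]
    obtain ⟨k, hk⟩ := hL
    obtain ⟨l, hl⟩ := hR
    have e1 : p * u = s * (t * k) := by rw [hk, ← hst, mul_assoc]
    have e2 : u * q = (l * s) * t := by rw [hl, ← mul_assoc p, ← hst, mul_assoc]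
    -- the units `g = w * p * u` and `h = u * q * z`
    have eg : s * (w * p * u) = p * u := by
      calc s * (w * p * u) = s * (w * (p * u)) := by simp only [mul_assoc]
        _ = s * (w * s) * (t * k) := by rw [e1]; simp only [mul_assoc]
        _ = p * u := by rw [hc.w_s, hc.s_e, ← e1]
    have eh : (u * q * z) * t = u * q := by
      calc (u * q * z) * t = l * s * ((t * z) * t) := by rw [e2]; simp only [mul_assoc]
        _ = u * q := by rw [hc.t_z, hc.e_t, ← e2]
    set g := w * p * u with hgdef
    set h := u * q * z with hhdef
    have hgh : g * u' * h = e := by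
      calc g * u' * h = w * p * (u * u') * u * q * z := by simp only [hgdef, hhdef, mul_assoc]
        _ = w * (p * (e * u) * q) * z := by rw [huu']; simp only [mul_assoc]
        _ = e := by rw [heu, hwz]
    have hge : g * e = g := by rw [hgdef, mul_assoc, hue]
    have heg : e * g = g := by rw [hgdef, ← mul_assoc, ← mul_assoc, hc.e_w]
    have hhe : h * e = h := by rw [hhdef, mul_assoc, hc.z_e]
    have heh : e * h = h := by rw [hhdef, ← mul_assoc, ← mul_assoc, heu]
    -- a one-sided unit of a finite local monoid is a unit
    obtain ⟨m, hm⟩ : ∃ m, e = m * (g * e) :=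
      exists_eq_mul_of_le_left (s := 1) (t := u' * h) (by
        rw [hge, one_mul, ← mul_assoc, hgh])
    have hgL : GreenH g e := ⟨greenR_iff.2 ⟨⟨g, heg.symm⟩, u' * h, by rw [← mul_assoc, hgh]⟩,
      greenL_iff.2 ⟨⟨g, hge.symm⟩, m, by rw [← hge]; exact hm⟩⟩
    have hinv : (u' * h) * g = e := by
      calc (u' * h) * g = (e * u') * h * g := by rw [heu']
        _ = m * (g * u' * h) * g := by rw [hm, hge]; simp only [mul_assoc]
        _ = e := by rw [hgh, mul_assoc, heg]; rw [hm, hge]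
    have hinvH : GreenH (u' * h) e := by
      refine ⟨greenR_iff.2 ⟨⟨u' * h, by rw [← mul_assoc e, heu']⟩, g, hinv.symm⟩,
        greenL_iff.2 ⟨⟨u' * h, by rw [mul_assoc, hhe]⟩, g, by rw [← mul_assoc, hgh]⟩⟩
    -- the element `g * (u' * v * u') * h` is a conjugate of `u' * v`
    refine ⟨g * (u' * v) * (u' * h), hN.2.2.2.2 g (u' * h) hgL hinvH (by rw [← mul_assoc, hgh]) hinv
      _ (hN.2.2.1 _ hu' _ hv), ?_⟩
    calc y = p * v * q := hy
      _ = p * ((u * u') * v * (u' * u)) * q := by rw [huu', hu'u, hev, hve]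
      _ = (p * u) * u' * v * u' * (u * q) := by simp only [mul_assoc]
      _ = _ := by rw [← eg, ← eh]; simp only [mul_assoc]
  · rintro ⟨g, hg, rfl⟩
    refine ⟨e, hN.2.1, g, hg, s, t, ?_, rfl, hc.greenJ he, ?_⟩
    · rw [hc.s_e, hc.eq]
    · exact ((hc.mul_greenH he (hN.1 g hg)).1.greenJ.trans (hc.greenJ he)).trans (hN.greenJ hg).symm

theorem nuRel.greenH [Finite S] (he : e * e = e) (hN : IsNormalSubgroupAt e N) {x y : S}
    (h : nuRel N x y) : GreenH x y := by
  obtain ⟨s, t, w, z, hc⟩ := exists_coords he (h.greenJ hN).1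
  obtain ⟨g, hg, rfl⟩ := (nuRel_iff he hN hc).1 h
  exact (hc.mul_greenH he (hN.1 g hg)).symm

theorem nuRel.trans [Finite S] (he : e * e = e) (hN : IsNormalSubgroupAt e N) {x y z : S}
    (h : nuRel N x y) (h' : nuRel N y z) : nuRel N x z := by
  obtain ⟨s, t, w, k, hc⟩ := exists_coords he (h.greenJ hN).2
  obtain ⟨g, hg, rfl⟩ := (nuRel_iff he hN hc).1 h.symm
  obtain ⟨g', hg', rfl⟩ := (nuRel_iff he hN hc).1 h'
  refine ⟨g, hg, g', hg', s, t, rfl, rfl, ?_, ?_⟩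
  · exact ((h.greenJ hN).1).trans (hN.greenJ hg).symm
  · exact ((h'.greenJ hN).2).trans (hN.greenJ hg').symm

theorem nuRel_idem_iff [Finite S] (he : e * e = e) (hN : IsNormalSubgroupAt e N) {g : S} :
    nuRel N e g ↔ g ∈ N := by
  have hc : Coords e e e e e e := ⟨he.symm, he, he, he, he, he, he⟩
  rw [nuRel_iff he hN hc]
  have key : ∀ g ∈ N, e * g * e = g := fun g hg => by
    rw [greenH_mul_left_cancel he (hN.1 g hg), greenH_mul_right_cancel he (hN.1 g hg)]
  constructor
  · rintro ⟨g, hg, rfl⟩; rwa [key g hg]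
  · intro hg; exact ⟨g, hg, (key g hg).symm⟩

/-- `ν_N` is compatible with left multiplication as long as the product stays in the
`J`-class. -/
theorem nuRel.mul_left (hN : IsNormalSubgroupAt e N) {x y : S}
    (h : nuRel N x y) (a : S) (hx : GreenJ (a * x) e) (hy : GreenJ (a * y) e) :
    nuRel N (a * x) (a * y) := by
  obtain ⟨u, hu, v, hv, s, t, rfl, rfl, h1, h2⟩ := h
  exact ⟨u, hu, v, hv, a * s, t, by simp only [mul_assoc], by simp only [mul_assoc],
    hx.trans (hN.greenJ hu).symm, hy.trans (hN.greenJ hv).symm⟩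

theorem nuRel.mul_right (hN : IsNormalSubgroupAt e N) {x y : S}
    (h : nuRel N x y) (a : S) (hx : GreenJ (x * a) e) (hy : GreenJ (y * a) e) :
    nuRel N (x * a) (y * a) := by
  obtain ⟨u, hu, v, hv, s, t, rfl, rfl, h1, h2⟩ := h
  exact ⟨u, hu, v, hv, s, t * a, by simp only [mul_assoc], by simp only [mul_assoc],
    hx.trans (hN.greenJ hu).symm, hy.trans (hN.greenJ hv).symm⟩

end Nu

end SemigroupCong

/-! ### Normal subgroups of maximal subgroups -/

namespace SemigroupCong

variable {S : Type*} [Monoid S]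

theorem exists_inv_of_greenH {e g : S} (he : e * e = e) (hg : GreenH g e) :
    ∃ h, GreenH h e ∧ g * h = e ∧ h * g = e := by
  have heg := greenH_mul_left_cancel he hg
  have hge := greenH_mul_right_cancel he hg
  obtain ⟨-, b, hb⟩ := greenR_iff.1 hg.1
  obtain ⟨-, d, hd⟩ := greenL_iff.1 hg.2
  have h1 : g * (e * b) = e := by rw [← mul_assoc, hge, ← hb]
  have h2 : e * b * g = e := by
    calc e * b * g = d * (g * b) * g := by rw [← mul_assoc d, ← hd]
      _ = e := by rw [← hb, mul_assoc, heg, ← hd]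
  have h3 : e * b * e = e * b := by
    calc e * b * e = (e * b * g) * b := by rw [mul_assoc _ g, ← hb]
      _ = e * b := by rw [h2]
  exact ⟨e * b, ⟨greenR_iff.2 ⟨⟨e * b, by rw [← mul_assoc, he]⟩, g, h2.symm⟩,
    greenL_iff.2 ⟨⟨e * b, h3.symm⟩, g, h1.symm⟩⟩, h1, h2⟩

theorem greenH_mul {e g h : S} (he : e * e = e) (hg : GreenH g e) (hh : GreenH h e) :
    GreenH (g * h) e := by
  obtain ⟨g', hg', h1, h2⟩ := exists_inv_of_greenH he hg
  obtain ⟨h', hh', h3, h4⟩ := exists_inv_of_greenH he hh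
  have heg := greenH_mul_left_cancel he hg
  have hge := greenH_mul_right_cancel he hg
  have hhe := greenH_mul_right_cancel he hh
  have heh := greenH_mul_left_cancel he hh
  refine ⟨greenR_iff.2 ⟨⟨g * h, by rw [← mul_assoc, heg]⟩, h' * g', ?_⟩,
    greenL_iff.2 ⟨⟨g * h, by rw [mul_assoc, hhe]⟩, h' * g', ?_⟩⟩
  · rw [mul_assoc g, ← mul_assoc h, h3, greenH_mul_left_cancel he hg', h1]
  · rw [mul_assoc h', ← mul_assoc g', h2, heh, h4]

/-- Two idempotents `e'` and `e` of the same `J`-class factor as `e' = s * t`, `e = t * s`. -/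
structure IdemPair (e' e s t : S) : Prop where
  st : s * t = e'
  ts : t * s = e
  s_e : s * e = s
  e_t : e * t = t

theorem exists_idemPair [Finite S] {e e' : S} (he : e * e = e) (he' : e' * e' = e')
    (h : GreenJ e' e) : ∃ s t, IdemPair e' e s t := by
  obtain ⟨s, t, w, z, hc⟩ := exists_coords he h
  refine ⟨s, t, hc.eq.symm, ?_, hc.s_e, hc.e_t⟩
  calc t * s = (e * t) * (s * e) := by rw [hc.e_t, hc.s_e]
    _ = w * ((s * t) * (s * t)) * z := by
      rw [← hc.w_s]; nth_rw 2 [hc.w_s]; rw [← hc.t_z]; simp only [mul_assoc]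
    _ = w * s * (t * z) := by rw [← hc.eq, he', hc.eq]; simp only [mul_assoc]
    _ = e := by rw [hc.w_s, hc.t_z, he]

theorem IdemPair.coords {e' e s t : S} (h : IdemPair e' e s t) : Coords e e' s t t s :=
  ⟨h.st.symm, h.s_e, h.e_t, h.ts, h.ts, h.e_t, h.s_e⟩

/-- Transport of a normal subgroup to another idempotent of the `J`-class. -/
theorem IdemPair.isNormalSubgroupAt {e' e s t : S} (h : IdemPair e' e s t) (he : e * e = e)
    (he' : e' * e' = e') {N : Set S} (hN : IsNormalSubgroupAt e' N) :
    IsNormalSubgroupAt e ((fun u => t * u * s) '' N) := by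
  have hc := h.coords
  have hte : t * e' = t := by rw [← h.st, ← mul_assoc, h.ts, h.e_t]
  have hes : e' * s = s := by rw [← h.st, mul_assoc, h.ts, h.s_e]
  have hmul : ∀ u v, u * e' = u → (t * u * s) * (t * v * s) = t * (u * v) * s := fun u v hu => by
    calc (t * u * s) * (t * v * s) = t * (u * (s * t)) * v * s := by simp only [mul_assoc]
      _ = _ := by rw [h.st, hu]; simp only [mul_assoc]
  have hE : t * e' * s = e := by rw [hte, h.ts]
  refine ⟨?_, ⟨e', hN.2.1, hE⟩, ?_, ?_, ?_⟩
  · rintro _ ⟨u, hu, rfl⟩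
    exact (hc.exists_of_greenH he (hN.1 u hu)).1
  · rintro _ ⟨u, hu, rfl⟩ _ ⟨v, hv, rfl⟩
    exact ⟨u * v, hN.2.2.1 u hu v hv, (hmul u v (greenH_mul_right_cancel he' (hN.1 u hu))).symm⟩
  · rintro _ ⟨u, hu, rfl⟩
    obtain ⟨v, hv, h1, h2⟩ := hN.2.2.2.1 u hu
    refine ⟨t * v * s, ⟨v, hv, rfl⟩, ?_, ?_⟩
    · simp only
      rw [hmul u v (greenH_mul_right_cancel he' (hN.1 u hu)), h1, hE]
    · simp only
      rw [hmul v u (greenH_mul_right_cancel he' (hN.1 v hv)), h2, hE]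
  · rintro g k hg hk hgk hkg _ ⟨u, hu, rfl⟩
    have hge := greenH_mul_right_cancel he hg
    have hke := greenH_mul_right_cancel he hk
    have heg := greenH_mul_left_cancel he hg
    have hek := greenH_mul_left_cancel he hk
    have hm : ∀ a b, a * e = a → (s * a * t) * (s * b * t) = s * (a * b) * t := fun a b ha => by
      calc (s * a * t) * (s * b * t) = s * (a * (t * s)) * b * t := by simp only [mul_assoc]
        _ = _ := by rw [h.ts, ha]; simp only [mul_assoc]
    have hE' : s * e * t = e' := by rw [h.s_e, h.st]
    refine ⟨(s * g * t) * u * (s * k * t), hN.2.2.2.2 _ _ (hc.mul_greenH he hg)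
      (hc.mul_greenH he hk) ?_ ?_ u hu, ?_⟩
    · rw [hm g k hge, hgk, hE']
    · rw [hm k g hke, hkg, hE']
    · calc t * ((s * g * t) * u * (s * k * t)) * s
          = ((t * s) * g) * (t * u * s) * (k * (t * s)) := by
            simp only [mul_assoc]
        _ = _ := by rw [h.ts, heg, hke]

theorem IdemPair.nuRel_eq {e' e s t : S} (h : IdemPair e' e s t) (he : e * e = e)
    (he' : e' * e' = e') {N : Set S} (hN : IsNormalSubgroupAt e' N) :
    nuRel ((fun u => t * u * s) '' N) = nuRel N := by
  have hN' := h.isNormalSubgroupAt he he' hN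
  have hJ : GreenJ e e' := (h.coords.greenJ he).symm
  have hJu : ∀ u ∈ N, GreenJ (t * u * s) u := fun u hu =>
    ((hN'.greenJ ⟨u, hu, rfl⟩).trans hJ).trans (hN.greenJ hu).symm
  funext x y
  refine propext ⟨?_, ?_⟩
  · rintro ⟨_, ⟨u, hu, rfl⟩, _, ⟨v, hv, rfl⟩, p, q, hx, hy, h1, h2⟩
    exact ⟨u, hu, v, hv, p * t, s * q, by rw [hx]; simp only [mul_assoc],
      by rw [hy]; simp only [mul_assoc], h1.trans (hJu u hu), h2.trans (hJu v hv)⟩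
  · rintro ⟨u, hu, v, hv, p, q, hx, hy, h1, h2⟩
    have key : ∀ u ∈ N, p * u * q = p * s * (t * u * s) * (t * q) := fun u hu => by
      calc p * u * q = p * ((s * t) * u * (s * t)) * q := by
            rw [h.st, greenH_mul_left_cancel he' (hN.1 u hu),
              greenH_mul_right_cancel he' (hN.1 u hu)]
        _ = _ := by simp only [mul_assoc]
    exact ⟨_, ⟨u, hu, rfl⟩, _, ⟨v, hv, rfl⟩, p * s, t * q, by rw [hx, key u hu],
      by rw [hy, key v hv], h1.trans (hJu u hu).symm, h2.trans (hJu v hv).symm⟩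

/-- The normal subgroup of the maximal subgroup at `e` that a congruence determines. -/
def conSubgroup (θ : Con S) (e : S) : Set S := {g | GreenH g e ∧ θ e g}

theorem conSubgroup_isNormal (θ : Con S) {e : S} (he : e * e = e) :
    IsNormalSubgroupAt e (conSubgroup θ e) := by
  refine ⟨fun x hx => hx.1, ⟨GreenH.refl e, θ.refl e⟩, ?_, ?_, ?_⟩
  · rintro x ⟨hx, hx'⟩ y ⟨hy, hy'⟩
    exact ⟨greenH_mul he hx hy, by simpa only [he] using θ.mul hx' hy'⟩
  · rintro x ⟨hx, hx'⟩
    obtain ⟨y, hy, h1, h2⟩ := exists_inv_of_greenH he hx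
    refine ⟨y, ⟨hy, ?_⟩, h1, h2⟩
    have := θ.mul hx' (θ.refl y)
    rw [h1, greenH_mul_left_cancel he hy] at this
    exact θ.symm this
  · rintro g h hg hh hgh - x ⟨hx, hx'⟩
    refine ⟨greenH_mul he (greenH_mul he hg hx) hh, ?_⟩
    have := θ.mul (θ.mul (θ.refl g) hx') (θ.refl h)
    rwa [greenH_mul_right_cancel he hg, hgh] at this

theorem rel_of_nuRel {θ : Con S} {e : S} {N : Set S} (hN : ∀ u ∈ N, θ e u) {x y : S}
    (h : nuRel N x y) : θ x y := by
  obtain ⟨u, hu, v, hv, s, t, rfl, rfl, -, -⟩ := h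
  exact θ.mul (θ.mul (θ.refl s) (θ.trans (θ.symm (hN u hu)) (hN v hv))) (θ.refl t)

/-- On `H`-related pairs of a `J`-class with an idempotent `e`, a congruence is `ν_N`. -/
theorem nuRel_conSubgroup [Finite S] {θ : Con S} {e x y : S} (he : e * e = e) (hx : GreenJ x e)
    (hxy : GreenH y x) (h : θ x y) : nuRel (conSubgroup θ e) x y := by
  obtain ⟨s, t, w, z, hc⟩ := exists_coords he hx
  obtain ⟨h1, h2⟩ := hc.exists_of_greenH he hxy
  refine (nuRel_iff he (conSubgroup_isNormal θ he) hc).2 ⟨w * y * z, ⟨h1, ?_⟩, h2⟩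
  have := θ.mul (θ.mul (θ.refl w) h) (θ.refl z)
  rwa [hc.eq, ← mul_assoc, hc.w_s, mul_assoc, hc.t_z, he] at this

end SemigroupCong

/-! ### Products, duality and rank of partitions -/

namespace PartitionMonoid

open SemigroupCong

variable {n : ℕ}

instance : Finite (PartitionMonoid n) :=
  Finite.of_injective (fun a : PartitionMonoid n => fun x y => a.rel x y) (by
    intro a b h
    apply PartitionMonoid.ext
    ext x y
    exact iff_of_eq (congrFun (congrFun h x) y))

theorem productGraph_top {a b : PartitionMonoid n} {x y : Fin n ⊕ Fin n} (h : a.rel x y) :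
    productGraph a b (top x) (top y) := le_sup_left_rel (map_rel h)

theorem productGraph_bot {a b : PartitionMonoid n} {x y : Fin n ⊕ Fin n} (h : b.rel x y) :
    productGraph a b (bot x) (bot y) := le_sup_right_rel (map_rel h)

theorem productGraph_le {a b : PartitionMonoid n} {q : Setoid (Vertex n)}
    (ha : ∀ x y, a.rel x y → q (top x) (top y)) (hb : ∀ x y, b.rel x y → q (bot x) (bot y)) :
    productGraph a b ≤ q := sup_le (map_le_iff.2 ha) (map_le_iff.2 hb)

theorem mul_rel_iff {a b : PartitionMonoid n} {x y : Fin n ⊕ Fin n} :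
    (a * b).rel x y ↔ productGraph a b (outer x) (outer y) := Iff.rfl

/-- A labelling of the product graph that is constant on the blocks of both factors is constant on
the blocks of the product. -/
theorem eq_of_mul_rel {P : Type*} {a b : PartitionMonoid n} (φ : Vertex n → P)
    (ha : ∀ x y, a.rel x y → φ (top x) = φ (top y)) (hb : ∀ x y, b.rel x y → φ (bot x) = φ (bot y))
    {x y : Fin n ⊕ Fin n} (h : (a * b).rel x y) : φ (outer x) = φ (outer y) :=
  productGraph_le (q := Setoid.ker φ) ha hb h

theorem ext_iff' {a b : PartitionMonoid n} : a = b ↔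
    (∀ i j, a.rel (Sum.inl i) (Sum.inl j) ↔ b.rel (Sum.inl i) (Sum.inl j)) ∧
    (∀ i j, a.rel (Sum.inl i) (Sum.inr j) ↔ b.rel (Sum.inl i) (Sum.inr j)) ∧
    (∀ i j, a.rel (Sum.inr i) (Sum.inr j) ↔ b.rel (Sum.inr i) (Sum.inr j)) := by
  constructor
  · rintro rfl; simp
  · rintro ⟨h1, h2, h3⟩
    apply PartitionMonoid.ext
    ext x y
    rcases x with i | i <;> rcases y with j | j
    · exact h1 i j
    · exact h2 i j
    · rw [a.rel.comm', b.rel.comm']; exact h2 j i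
    · exact h3 i j

/-! #### Duality -/

/-- The reflection of a partition, exchanging the two rows. -/
def flip (a : PartitionMonoid n) : PartitionMonoid n := ⟨a.rel.comap Sum.swap⟩

theorem flip_rel {a : PartitionMonoid n} {x y} : (flip a).rel x y ↔ a.rel x.swap y.swap := Iff.rfl

@[simp] theorem flip_flip (a : PartitionMonoid n) : flip (flip a) = a := by
  apply PartitionMonoid.ext
  ext x y
  simp [flip_rel]

/-- The reflection of the product graph in its middle row. -/
def Vertex.flip : Vertex n → Vertex n
  | .upper i => .lower i
  | .middle i => .middle i
  | .lower i => .upper i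

theorem productGraph_flip_le (a b : PartitionMonoid n) :
    productGraph (flip b) (flip a) ≤ (productGraph a b).comap Vertex.flip := by
  refine productGraph_le (fun x y h => ?_) (fun x y h => ?_)
  · have := productGraph_bot (a := a) (b := b) (flip_rel.1 h)
    rcases x with i | i <;> rcases y with j | j <;> exact this
  · have := productGraph_top (a := a) (b := b) (flip_rel.1 h)
    rcases x with i | i <;> rcases y with j | j <;> exact this

theorem flip_mul (a b : PartitionMonoid n) : flip (a * b) = flip b * flip a := by
  apply PartitionMonoid.ext
  apply le_antisymm
  · intro x y h
    have h' : productGraph a b (outer x.swap) (outer y.swap) := h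
    have := productGraph_flip_le (flip b) (flip a) (x := outer x.swap) (y := outer y.swap)
      (by rw [flip_flip, flip_flip]; exact h')
    rcases x with i | i <;> rcases y with j | j <;> exact this
  · intro x y h
    have := productGraph_flip_le a b h
    rcases x with i | i <;> rcases y with j | j <;> exact this

/-! #### Rank -/

/-- `x` and `y` are systems of representatives, in the upper and the lower row, of distinct
transversals of `a`. -/
def IsTransversalSystem (a : PartitionMonoid n) {q : ℕ} (x y : Fin q → Fin n) : Prop :=
  ∀ i j, a.rel (Sum.inl (x i)) (Sum.inr (y j)) ↔ i = j

theorem le_rank_iff {a : PartitionMonoid n} {q : ℕ} :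
    q ≤ a.rank ↔ ∃ x y : Fin q → Fin n, IsTransversalSystem a x y := by
  classical
  set T := {B : Set (Fin n ⊕ Fin n) |
    B ∈ a.rel.classes ∧ (∃ i, Sum.inl i ∈ B) ∧ ∃ j, Sum.inr j ∈ B} with hT
  have hr : a.rank = Nat.card T := rfl
  constructor
  · intro h
    have : Fintype T := Fintype.ofFinite T
    rw [hr, Nat.card_eq_fintype_card] at h
    obtain ⟨f⟩ := Function.Embedding.nonempty_of_card_le (α := Fin q) (β := T) (by simpa using h)
    have hx : ∀ i, ∃ k, Sum.inl k ∈ (f i).1 := fun i => (f i).2.2.1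
    have hy : ∀ i, ∃ k, Sum.inr k ∈ (f i).1 := fun i => (f i).2.2.2
    choose x hx using hx
    choose y hy using hy
    refine ⟨x, y, fun i j => ⟨fun hij => ?_, ?_⟩⟩
    · apply f.injective
      apply Subtype.ext
      obtain ⟨c, hc⟩ := (f i).2.1
      obtain ⟨d, hd⟩ := (f j).2.1
      have h1 : a.rel (Sum.inl (x i)) c := by have := hx i; rw [hc] at this; exact this
      have h2 : a.rel (Sum.inr (y j)) d := by have := hy j; rw [hd] at this; exact this
      have h3 : a.rel c d := a.rel.trans' (a.rel.symm' h1) (a.rel.trans' hij h2)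
      rw [hc, hd]
      ext z
      exact ⟨fun hz => a.rel.trans' hz h3, fun hz => a.rel.trans' hz (a.rel.symm' h3)⟩
    · rintro rfl
      obtain ⟨c, hc⟩ := (f i).2.1
      have h1 : a.rel (Sum.inl (x i)) c := by have := hx i; rw [hc] at this; exact this
      have h2 : a.rel (Sum.inr (y i)) c := by have := hy i; rw [hc] at this; exact this
      exact a.rel.trans' h1 (a.rel.symm' h2)
  · rintro ⟨x, y, hxy⟩
    have hxx : ∀ i, a.rel (Sum.inl (x i)) (Sum.inr (y i)) := fun i => (hxy i i).2 rfl
    let f : Fin q → T := fun i => ⟨{z | a.rel z (Sum.inl (x i))}, ⟨_, rfl⟩, ⟨x i, a.rel.refl' _⟩,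
      ⟨y i, a.rel.symm' (hxx i)⟩⟩
    have hf : Function.Injective f := by
      intro i j hij
      have h1 : Sum.inl (x i) ∈ (f j).1 := by rw [← hij]; exact a.rel.refl' _
      exact (hxy i j).1 (a.rel.trans' h1 (hxx j))
    have := Nat.card_le_card_of_injective f hf
    rwa [Nat.card_fin, ← hr] at this

theorem IsTransversalSystem.symm {a : PartitionMonoid n} {q : ℕ} {x y : Fin q → Fin n}
    (h : IsTransversalSystem a x y) : IsTransversalSystem (flip a) y x := fun i j => by
  rw [flip_rel, (PartitionMonoid.rel a).comm', eq_comm]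
  exact h j i

theorem IsTransversalSystem.left_injective {a : PartitionMonoid n} {q : ℕ} {x y : Fin q → Fin n}
    (h : IsTransversalSystem a x y) : Function.Injective x := fun i j hij =>
  (h i j).1 (by rw [hij]; exact (h j j).2 rfl)

theorem IsTransversalSystem.right_injective {a : PartitionMonoid n} {q : ℕ} {x y : Fin q → Fin n}
    (h : IsTransversalSystem a x y) : Function.Injective y := h.symm.left_injective

theorem IsTransversalSystem.left_rel {a : PartitionMonoid n} {q : ℕ} {x y : Fin q → Fin n}
    (h : IsTransversalSystem a x y) {i j : Fin q} (hij : a.rel (Sum.inl (x i)) (Sum.inl (x j))) :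
    i = j := (h i j).1 (a.rel.trans' hij ((h j j).2 rfl))

theorem rank_flip (a : PartitionMonoid n) : (flip a).rank = a.rank := by
  have key : ∀ b : PartitionMonoid n, b.rank ≤ (flip b).rank := fun b => by
    obtain ⟨x, y, h⟩ := le_rank_iff.1 (le_refl b.rank)
    exact le_rank_iff.2 ⟨y, x, h.symm⟩
  exact le_antisymm (by simpa using key (flip a)) (key a)

theorem rank_le (a : PartitionMonoid n) : a.rank ≤ n := by
  obtain ⟨x, y, h⟩ := le_rank_iff.1 (le_refl a.rank)
  simpa using Fintype.card_le_of_injective x h.left_injective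

/-- An upper vertex belongs to the domain if it lies on a transversal. -/
def dom (a : PartitionMonoid n) (i : Fin n) : Prop := ∃ k, a.rel (Sum.inl i) (Sum.inr k)

/-- The equivalence relation induced on the upper row. -/
def uker (a : PartitionMonoid n) : Setoid (Fin n) := a.rel.comap Sum.inl

/-- The equivalence relation induced on the lower row. -/
def lker (a : PartitionMonoid n) : Setoid (Fin n) := a.rel.comap Sum.inr

theorem uker_flip (a : PartitionMonoid n) : uker (flip a) = lker a := rfl

/-- A block of a product leaves the upper row of the first factor through transversals of that
factor only. -/
theorem mul_rel_inl_inr {a b : PartitionMonoid n} {i j}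
    (h : (a * b).rel (Sum.inl i) (Sum.inr j)) : dom a i := by
  classical
  let φ : Vertex n → Prop
    | .upper i => dom a i
    | .middle _ => True
    | .lower _ => True
  have := eq_of_mul_rel φ ?_ ?_ h
  · exact cast (id this : dom a i = True).symm trivial
  · rintro (i | i) (j | j) h
    · exact propext ⟨fun ⟨k, hk⟩ => ⟨k, a.rel.trans' (a.rel.symm' h) hk⟩,
        fun ⟨k, hk⟩ => ⟨k, a.rel.trans' h hk⟩⟩
    · exact propext ⟨fun _ => trivial, fun _ => ⟨j, h⟩⟩
    · exact propext ⟨fun _ => ⟨i, a.rel.symm' h⟩, fun _ => trivial⟩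
    · rfl
  · rintro (i | i) (j | j) h <;> rfl

theorem uker_le_uker_mul (a b : PartitionMonoid n) : uker a ≤ uker (a * b) :=
  fun _ _ h => productGraph_top (b := b) h

theorem uker_mul_rel {a b : PartitionMonoid n} {i j : Fin n} (h : uker (a * b) i j) :
    uker a i j ∨ (dom a i ∧ dom a j) := by
  classical
  by_cases hi : dom a i
  · by_cases hj : dom a j
    · exact Or.inr ⟨hi, hj⟩
    · left
      let φ : Vertex n → Prop
        | .upper k => uker a k j
        | .middle _ => False
        | .lower _ => False
      have := eq_of_mul_rel (a := a) (b := b) φ ?_ ?_ h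
      · exact cast (id this : uker a i j = uker a j j).symm ((uker a).refl' j)
      · rintro (k | k) (l | l) h
        · exact propext ⟨fun hk => a.rel.trans' (a.rel.symm' h) hk, fun hk => a.rel.trans' h hk⟩
        · exact propext ⟨fun hk => hj ⟨l, a.rel.trans' (a.rel.symm' hk) h⟩, False.elim⟩
        · exact propext ⟨False.elim,
            fun hk => hj ⟨k, a.rel.trans' (a.rel.symm' hk) (a.rel.symm' h)⟩⟩
        · rfl
      · rintro (k | k) (l | l) h <;> rfl
  · left
    let φ : Vertex n → Prop
      | .upper k => uker a i k
      | .middle _ => False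
      | .lower _ => False
    have := eq_of_mul_rel (a := a) (b := b) φ ?_ ?_ h
    · exact cast (id this : uker a i i = uker a i j) ((uker a).refl' i)
    · rintro (k | k) (l | l) h
      · exact propext ⟨fun hk => a.rel.trans' hk h, fun hk => a.rel.trans' hk (a.rel.symm' h)⟩
      · exact propext ⟨fun hk => hi ⟨l, a.rel.trans' hk h⟩, False.elim⟩
      · exact propext ⟨False.elim, fun hk => hi ⟨k, a.rel.trans' hk (a.rel.symm' h)⟩⟩
      · rfl
    · rintro (k | k) (l | l) h <;> rfl

theorem rank_mul_le_left (a b : PartitionMonoid n) : (a * b).rank ≤ a.rank := by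
  obtain ⟨x, y, h⟩ := le_rank_iff.1 (le_refl (a * b).rank)
  have hd : ∀ i, dom a (x i) := fun i => mul_rel_inl_inr ((h i i).2 rfl)
  choose z hz using hd
  refine le_rank_iff.2 ⟨x, z, fun i j => ⟨fun hij => ?_, ?_⟩⟩
  · apply h.left_rel
    exact uker_le_uker_mul a b (show uker a _ _ from a.rel.trans' hij (a.rel.symm' (hz j)))
  · rintro rfl; exact hz i

theorem rank_mul_le_right (a b : PartitionMonoid n) : (a * b).rank ≤ b.rank := by
  rw [← rank_flip, flip_mul, ← rank_flip b]
  exact rank_mul_le_left _ _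

theorem rank_mul_mul_le (s a t : PartitionMonoid n) : (s * a * t).rank ≤ a.rank :=
  (rank_mul_le_left _ _).trans (rank_mul_le_right _ _)

theorem IsTransversalSystem.exists_of_dom {a : PartitionMonoid n} {q : ℕ} {x y : Fin q → Fin n}
    (h : IsTransversalSystem a x y) (hq : a.rank = q) {i : Fin n} (hi : dom a i) :
    ∃ m, a.rel (Sum.inl i) (Sum.inl (x m)) := by
  by_contra hno
  push Not at hno
  obtain ⟨k, hk⟩ := hi
  have : q + 1 ≤ a.rank := by
    refine le_rank_iff.2 ⟨Fin.cons i x, Fin.cons k y, fun u v => ?_⟩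
    refine Fin.cases ?_ (fun u => ?_) u <;> refine Fin.cases ?_ (fun v => ?_) v
    · simpa using hk
    · simp only [Fin.cons_zero, Fin.cons_succ]
      refine iff_of_false (fun hh => hno v ?_) (Fin.succ_ne_zero v).symm
      exact a.rel.trans' hh (a.rel.symm' ((h v v).2 rfl))
    · simp only [Fin.cons_zero, Fin.cons_succ]
      refine iff_of_false (fun hh => hno u ?_) (Fin.succ_ne_zero u)
      exact a.rel.trans' hk (a.rel.symm' hh)
    · simpa using h u v
  omega

/-! #### Multiplication by partial functions -/

/-- The partition with trivial lower kernel in which `i` is joined to `(f i)'` if `f i` is defined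
and forms a singleton block otherwise. -/
def pull (f : Fin n → Option (Fin n)) : PartitionMonoid n :=
  ⟨Setoid.ker (Sum.elim (fun i => (f i).elim (Sum.inr i) Sum.inl) Sum.inl :
    Fin n ⊕ Fin n → Fin n ⊕ Fin n)⟩

section pull

variable (f : Fin n → Option (Fin n))

theorem pull_rel_inl_inl {i j} : (pull f).rel (Sum.inl i) (Sum.inl j) ↔
    i = j ∨ ∃ c, f i = some c ∧ f j = some c := by
  change (f i).elim (Sum.inr i) Sum.inl = (f j).elim (Sum.inr j) Sum.inl ↔ _
  rcases hi : f i with _ | c <;> rcases hj : f j with _ | d <;> simp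
  · rintro rfl; simp [hi] at hj
  · rintro rfl; simp [hi] at hj
  · constructor
    · intro h; exact Or.inr h.symm
    · rintro (rfl | h)
      · rw [hi] at hj; exact Option.some_injective _ hj
      · exact h.symm

theorem pull_rel_inl_inr {i k} : (pull f).rel (Sum.inl i) (Sum.inr k) ↔ f i = some k := by
  change (f i).elim (Sum.inr i) Sum.inl = Sum.inl k ↔ _
  rcases f i with _ | c <;> simp

theorem pull_rel_inr_inr {k l} : (pull f).rel (Sum.inr k) (Sum.inr l) ↔ k = l := by
  change Sum.inl k = Sum.inl l ↔ _
  simp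

variable (a : PartitionMonoid n)

/-- The labelling of the product graph of `pull f` and `a` by the blocks of the product. -/
def pullLabel : Vertex n → Quotient a.rel ⊕ Fin n
  | .upper i => (f i).elim (Sum.inr i) (fun c => Sum.inl (Quotient.mk _ (Sum.inl c)))
  | .middle c => Sum.inl (Quotient.mk _ (Sum.inl c))
  | .lower k => Sum.inl (Quotient.mk _ (Sum.inr k))

theorem pullLabel_eq {x y : Fin n ⊕ Fin n} (h : (pull f * a).rel x y) :
    pullLabel f a (outer x) = pullLabel f a (outer y) := by
  refine eq_of_mul_rel (pullLabel f a) ?_ ?_ h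
  · rintro (i | i) (j | j) h
    · rcases (pull_rel_inl_inl f).1 h with rfl | ⟨c, hi, hj⟩
      · rfl
      · simp [pullLabel, top, hi, hj]
    · have := (pull_rel_inl_inr f).1 h
      simp [pullLabel, top, this]
    · have := (pull_rel_inl_inr f).1 ((pull f).rel.symm' h)
      simp [pullLabel, top, this]
    · have := (pull_rel_inr_inr f).1 h
      rw [this]
  · rintro (i | i) (j | j) h <;> exact congrArg Sum.inl (Quotient.sound h)

theorem productGraph_pull {i c : Fin n} (h : f i = some c) :
    productGraph (pull f) a (.upper i) (.middle c) :=
  productGraph_top (x := Sum.inl i) (y := Sum.inr c) ((pull_rel_inl_inr f).2 h)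

theorem pull_mul_rel_inl_inl {i j} : (pull f * a).rel (Sum.inl i) (Sum.inl j) ↔
    i = j ∨ ∃ c d, f i = some c ∧ f j = some d ∧ a.rel (Sum.inl c) (Sum.inl d) := by
  constructor
  · intro h
    have := pullLabel_eq f a h
    rcases hi : f i with _ | c <;> rcases hj : f j with _ | d <;>
      simp [pullLabel, outer, hi, hj] at this
    · exact Or.inl this
    · exact Or.inr ⟨c, d, rfl, rfl, Quotient.exact this⟩
  · rintro (rfl | ⟨c, d, hi, hj, h⟩)
    · exact Setoid.refl' _ _
    · exact mul_rel_iff.2 (Setoid.trans' (productGraph _ _) (productGraph_pull f a hi)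
        (Setoid.trans' (productGraph _ _) (productGraph_bot h)
          (Setoid.symm' (productGraph _ _) (productGraph_pull f a hj))))

theorem pull_mul_rel_inl_inr {i k} : (pull f * a).rel (Sum.inl i) (Sum.inr k) ↔
    ∃ c, f i = some c ∧ a.rel (Sum.inl c) (Sum.inr k) := by
  constructor
  · intro h
    have := pullLabel_eq f a h
    rcases hi : f i with _ | c <;> simp [pullLabel, outer, hi] at this
    exact ⟨c, rfl, Quotient.exact this⟩
  · rintro ⟨c, hi, h⟩
    exact mul_rel_iff.2 (Setoid.trans' (productGraph _ _) (productGraph_pull f a hi)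
      (productGraph_bot h))

theorem pull_mul_rel_inr_inr {k l} : (pull f * a).rel (Sum.inr k) (Sum.inr l) ↔
    a.rel (Sum.inr k) (Sum.inr l) := by
  constructor
  · intro h
    have := pullLabel_eq f a h
    simp [pullLabel, outer] at this
    exact Quotient.exact this
  · intro h; exact productGraph_bot h

theorem mul_flip_pull_rel_inl_inl {k l} : (a * flip (pull f)).rel (Sum.inl k) (Sum.inl l) ↔
    a.rel (Sum.inl k) (Sum.inl l) := by
  rw [← flip_flip (a * flip (pull f)), flip_mul, flip_flip]
  exact pull_mul_rel_inr_inr f (flip a)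

theorem mul_flip_pull_rel_inl_inr {k i} : (a * flip (pull f)).rel (Sum.inl k) (Sum.inr i) ↔
    ∃ c, f i = some c ∧ a.rel (Sum.inl k) (Sum.inr c) := by
  rw [← flip_flip (a * flip (pull f)), flip_mul, flip_flip, flip_rel, Setoid.comm']
  refine (pull_mul_rel_inl_inr f (flip a)).trans ?_
  refine exists_congr fun c => and_congr_right fun _ => ?_
  exact (PartitionMonoid.rel a).comm'

theorem mul_flip_pull_rel_inr_inr {i j} : (a * flip (pull f)).rel (Sum.inr i) (Sum.inr j) ↔
    i = j ∨ ∃ c d, f i = some c ∧ f j = some d ∧ a.rel (Sum.inr c) (Sum.inr d) := by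
  rw [← flip_flip (a * flip (pull f)), flip_mul, flip_flip]
  exact pull_mul_rel_inl_inl f (flip a)

end pull

end PartitionMonoid

/-! ### The `J`-classes, the ideals and the maximal subgroups of the partition monoid -/

namespace PartitionMonoid

open SemigroupCong

variable {n : ℕ}

/-- The partition in which `i` is joined to `(x i)'` for `i` one of the first `q` vertices. -/
def sel {q : ℕ} (x : Fin q → Fin n) : PartitionMonoid n :=
  pull fun i => if h : i.val < q then some (x ⟨i, h⟩) else none

theorem sel_fun_eq_some {q : ℕ} {x : Fin q → Fin n} {i c : Fin n} :
    (if h : i.val < q then some (x ⟨i, h⟩) else none) = some c ↔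
      ∃ m : Fin q, i.val = m.val ∧ x m = c := by
  constructor
  · intro h
    split_ifs at h with hi
    exact ⟨⟨i, hi⟩, rfl, Option.some_injective _ h⟩
  · rintro ⟨m, hm, rfl⟩
    have hi : i.val < q := hm ▸ m.2
    rw [dif_pos hi]
    exact congrArg some (congrArg x (Fin.ext hm))

section sel

variable {q : ℕ} (x : Fin q → Fin n) (a : PartitionMonoid n)

theorem sel_rel_inl_inl {i j} : (sel x).rel (Sum.inl i) (Sum.inl j) ↔
    i = j ∨ ∃ m k : Fin q, i.val = m ∧ j.val = k ∧ x m = x k := by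
  refine (pull_rel_inl_inl _).trans (or_congr_right ?_)
  simp only [sel_fun_eq_some]
  constructor
  · rintro ⟨_, ⟨m, hm, rfl⟩, ⟨k, hk, h⟩⟩; exact ⟨m, k, hm, hk, h.symm⟩
  · rintro ⟨m, k, hm, hk, h⟩; exact ⟨_, ⟨m, hm, rfl⟩, ⟨k, hk, h.symm⟩⟩

theorem sel_rel_inl_inr {i k} : (sel x).rel (Sum.inl i) (Sum.inr k) ↔
    ∃ m : Fin q, i.val = m ∧ x m = k := (pull_rel_inl_inr _).trans sel_fun_eq_some

theorem sel_rel_inr_inr {k l} : (sel x).rel (Sum.inr k) (Sum.inr l) ↔ k = l := pull_rel_inr_inr _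

theorem sel_mul_rel_inl_inl {i j} : (sel x * a).rel (Sum.inl i) (Sum.inl j) ↔
    i = j ∨ ∃ m k : Fin q, i.val = m ∧ j.val = k ∧ a.rel (Sum.inl (x m)) (Sum.inl (x k)) := by
  refine (pull_mul_rel_inl_inl _ a).trans (or_congr_right ?_)
  simp only [sel_fun_eq_some]
  constructor
  · rintro ⟨_, _, ⟨m, hm, rfl⟩, ⟨k, hk, rfl⟩, h⟩; exact ⟨m, k, hm, hk, h⟩
  · rintro ⟨m, k, hm, hk, h⟩; exact ⟨_, _, ⟨m, hm, rfl⟩, ⟨k, hk, rfl⟩, h⟩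

theorem sel_mul_rel_inl_inr {i k} : (sel x * a).rel (Sum.inl i) (Sum.inr k) ↔
    ∃ m : Fin q, i.val = m ∧ a.rel (Sum.inl (x m)) (Sum.inr k) := by
  refine (pull_mul_rel_inl_inr _ a).trans ?_
  simp only [sel_fun_eq_some]
  constructor
  · rintro ⟨_, ⟨m, hm, rfl⟩, h⟩; exact ⟨m, hm, h⟩
  · rintro ⟨m, hm, h⟩; exact ⟨_, ⟨m, hm, rfl⟩, h⟩

theorem sel_mul_rel_inr_inr {k l} : (sel x * a).rel (Sum.inr k) (Sum.inr l) ↔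
    a.rel (Sum.inr k) (Sum.inr l) := pull_mul_rel_inr_inr _ a

theorem mul_flip_sel_rel_inl_inl {k l} : (a * flip (sel x)).rel (Sum.inl k) (Sum.inl l) ↔
    a.rel (Sum.inl k) (Sum.inl l) := mul_flip_pull_rel_inl_inl _ a

theorem mul_flip_sel_rel_inl_inr {k i} : (a * flip (sel x)).rel (Sum.inl k) (Sum.inr i) ↔
    ∃ m : Fin q, i.val = m ∧ a.rel (Sum.inl k) (Sum.inr (x m)) := by
  refine (mul_flip_pull_rel_inl_inr _ a).trans ?_
  simp only [sel_fun_eq_some]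
  constructor
  · rintro ⟨_, ⟨m, hm, rfl⟩, h⟩; exact ⟨m, hm, h⟩
  · rintro ⟨m, hm, h⟩; exact ⟨_, ⟨m, hm, rfl⟩, h⟩

theorem mul_flip_sel_rel_inr_inr {i j} : (a * flip (sel x)).rel (Sum.inr i) (Sum.inr j) ↔
    i = j ∨ ∃ m k : Fin q, i.val = m ∧ j.val = k ∧ a.rel (Sum.inr (x m)) (Sum.inr (x k)) := by
  refine (mul_flip_pull_rel_inr_inr _ a).trans (or_congr_right ?_)
  simp only [sel_fun_eq_some]
  constructor
  · rintro ⟨_, _, ⟨m, hm, rfl⟩, ⟨k, hk, rfl⟩, h⟩; exact ⟨m, k, hm, hk, h⟩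
  · rintro ⟨m, k, hm, hk, h⟩; exact ⟨_, _, ⟨m, hm, rfl⟩, ⟨k, hk, rfl⟩, h⟩

end sel

theorem bar_rel_inl_inl {q : ℕ} {σ : Equiv.Perm (Fin q)} {i j} :
    (bar n σ).rel (Sum.inl i) (Sum.inl j) ↔ i = j := by
  constructor
  · rintro (h | ⟨_, _, _, _, _, ⟨_, h⟩ | ⟨h, _⟩⟩)
    · exact Sum.inl_injective h
    · cases h
    · cases h
  · rintro rfl; exact Setoid.refl' _ _

theorem bar_rel_inr_inr {q : ℕ} {σ : Equiv.Perm (Fin q)} {i j} :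
    (bar n σ).rel (Sum.inr i) (Sum.inr j) ↔ i = j := by
  constructor
  · rintro (h | ⟨_, _, _, _, _, ⟨h, _⟩ | ⟨_, h⟩⟩)
    · exact Sum.inr_injective h
    · cases h
    · cases h
  · rintro rfl; exact Setoid.refl' _ _

theorem bar_rel_inl_inr {q : ℕ} {σ : Equiv.Perm (Fin q)} {i j} :
    (bar n σ).rel (Sum.inl i) (Sum.inr j) ↔ ∃ m : Fin q, i.val = m ∧ j.val = σ m := by
  constructor
  · rintro (h | ⟨m, a, b, ha, hb, ⟨h1, h2⟩ | ⟨h, _⟩⟩)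
    · cases h
    · cases h1; cases h2; exact ⟨m, ha, hb⟩
    · cases h
  · rintro ⟨m, h1, h2⟩; exact Or.inr ⟨m, i, j, h1, h2, Or.inl ⟨rfl, rfl⟩⟩

theorem bar_eq_sel {q : ℕ} (hq : q ≤ n) (σ : Equiv.Perm (Fin q)) :
    bar n σ = sel fun i => Fin.castLE hq (σ i) := by
  refine ext_iff'.2 ⟨fun i j => ?_, fun i j => ?_, fun i j => ?_⟩
  · rw [bar_rel_inl_inl, sel_rel_inl_inl]
    refine ⟨Or.inl, ?_⟩
    rintro (h | ⟨m, k, hm, hk, h⟩)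
    · exact h
    · have : m = k := σ.injective (Fin.castLE_injective hq h)
      exact Fin.ext (by rw [hm, hk, this])
  · rw [bar_rel_inl_inr, sel_rel_inl_inr]
    refine exists_congr fun m => and_congr_right fun _ => ?_
    rw [Fin.ext_iff, eq_comm]; rfl
  · rw [bar_rel_inr_inr, sel_rel_inr_inr]

/-- The idempotent with transversals `{i, i'}` for `i` one of the first `q` vertices. -/
abbrev eps (n q : ℕ) : PartitionMonoid n := bar n (1 : Equiv.Perm (Fin q))

theorem bar_mul_bar {q : ℕ} (hq : q ≤ n) (σ τ : Equiv.Perm (Fin q)) :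
    bar n σ * bar n τ = bar n (τ * σ) := by
  rw [bar_eq_sel hq σ]
  refine ext_iff'.2 ⟨fun i j => ?_, fun i j => ?_, fun i j => ?_⟩
  · rw [sel_mul_rel_inl_inl, bar_rel_inl_inl]
    refine ⟨?_, Or.inl⟩
    rintro (h | ⟨m, k, hm, hk, h⟩)
    · exact h
    · have : m = k := σ.injective (Fin.castLE_injective hq (bar_rel_inl_inl.1 h))
      exact Fin.ext (by rw [hm, hk, this])
  · rw [sel_mul_rel_inl_inr, bar_rel_inl_inr]
    refine exists_congr fun m => and_congr_right fun _ => ?_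
    rw [bar_rel_inl_inr]
    constructor
    · rintro ⟨k, hk, hj⟩
      have : k = σ m := Fin.ext hk.symm
      rw [hj, this]; rfl
    · intro h; exact ⟨σ m, rfl, h⟩
  · rw [sel_mul_rel_inr_inr, bar_rel_inr_inr, bar_rel_inr_inr]

theorem flip_bar {q : ℕ} (σ : Equiv.Perm (Fin q)) : flip (bar n σ) = bar n σ⁻¹ := by
  refine ext_iff'.2 ⟨fun i j => ?_, fun i j => ?_, fun i j => ?_⟩
  · rw [flip_rel, bar_rel_inl_inl]; exact bar_rel_inr_inr
  · rw [flip_rel, Setoid.comm', bar_rel_inl_inr]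
    refine bar_rel_inl_inr.trans ⟨?_, ?_⟩
    · rintro ⟨m, h1, h2⟩; exact ⟨σ m, h2, by simpa using h1⟩
    · rintro ⟨m, h1, h2⟩; exact ⟨σ⁻¹ m, h2, by simpa using h1⟩
  · rw [flip_rel, bar_rel_inr_inr]; exact bar_rel_inl_inl

theorem eps_mul_eps {q : ℕ} (hq : q ≤ n) : eps n q * eps n q = eps n q := by
  rw [bar_mul_bar hq, one_mul]

theorem flip_eps (q : ℕ) : flip (eps n q) = eps n q := by rw [flip_bar, inv_one]

theorem bar_injective {q : ℕ} (hq : q ≤ n) : Function.Injective (bar n (q := q)) := by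
  intro σ τ h
  ext i
  have h1 : (bar n σ).rel (Sum.inl (Fin.castLE hq i)) (Sum.inr (Fin.castLE hq (σ i))) :=
    bar_rel_inl_inr.2 ⟨i, rfl, rfl⟩
  rw [h] at h1
  obtain ⟨m, hm, hk⟩ := bar_rel_inl_inr.1 h1
  have : i = m := Fin.ext hm
  subst this
  exact hk

theorem eps_rel_inl_inr {q : ℕ} {i j : Fin n} :
    (eps n q).rel (Sum.inl i) (Sum.inr j) ↔ i = j ∧ i.val < q := by
  rw [bar_rel_inl_inr]
  constructor
  · rintro ⟨m, h1, h2⟩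
    exact ⟨Fin.ext (by rw [h1, h2]; rfl), h1 ▸ m.2⟩
  · rintro ⟨rfl, h⟩; exact ⟨⟨i, h⟩, rfl, rfl⟩

theorem eps_mul_rel_inl_inr {q : ℕ} (hq : q ≤ n) {a : PartitionMonoid n} {i k} :
    (eps n q * a).rel (Sum.inl i) (Sum.inr k) ↔ i.val < q ∧ a.rel (Sum.inl i) (Sum.inr k) := by
  rw [eps, bar_eq_sel hq, sel_mul_rel_inl_inr]
  constructor
  · rintro ⟨m, hm, h⟩
    have : Fin.castLE hq ((1 : Equiv.Perm (Fin q)) m) = i := Fin.ext hm.symm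
    rw [this] at h
    exact ⟨hm ▸ m.2, h⟩
  · rintro ⟨hi, h⟩; exact ⟨⟨i, hi⟩, rfl, h⟩

theorem eps_mul_rel_inl_inl {q : ℕ} (hq : q ≤ n) {a : PartitionMonoid n} {i j} :
    (eps n q * a).rel (Sum.inl i) (Sum.inl j) ↔
      i = j ∨ (i.val < q ∧ j.val < q ∧ a.rel (Sum.inl i) (Sum.inl j)) := by
  rw [eps, bar_eq_sel hq, sel_mul_rel_inl_inl]
  refine or_congr_right ⟨?_, ?_⟩
  · rintro ⟨m, k, hm, hk, h⟩
    have h1 : Fin.castLE hq ((1 : Equiv.Perm (Fin q)) m) = i := Fin.ext hm.symm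
    have h2 : Fin.castLE hq ((1 : Equiv.Perm (Fin q)) k) = j := Fin.ext hk.symm
    rw [h1, h2] at h
    exact ⟨hm ▸ m.2, hk ▸ k.2, h⟩
  · rintro ⟨hi, hj, h⟩; exact ⟨⟨i, hi⟩, ⟨j, hj⟩, rfl, rfl, h⟩

theorem eps_mul_rel_inr_inr {q : ℕ} (hq : q ≤ n) {a : PartitionMonoid n} {i j} :
    (eps n q * a).rel (Sum.inr i) (Sum.inr j) ↔ a.rel (Sum.inr i) (Sum.inr j) := by
  rw [eps, bar_eq_sel hq, sel_mul_rel_inr_inr]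

theorem eps_mul_eps_of_le {p q : ℕ} (hpq : p ≤ q) (hq : q ≤ n) :
    eps n p * eps n q = eps n p := by
  refine ext_iff'.2 ⟨fun i j => ?_, fun i j => ?_, fun i j => ?_⟩
  · rw [eps_mul_rel_inl_inl (hpq.trans hq), bar_rel_inl_inl, bar_rel_inl_inl]; tauto
  · rw [eps_mul_rel_inl_inr (hpq.trans hq), eps_rel_inl_inr, eps_rel_inl_inr]
    constructor
    · rintro ⟨h1, h2, -⟩; exact ⟨h2, h1⟩
    · rintro ⟨h1, h2⟩; exact ⟨h2, h1, h2.trans_le hpq⟩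
  · rw [eps_mul_rel_inr_inr (hpq.trans hq), bar_rel_inr_inr, bar_rel_inr_inr]

theorem bar_isTransversalSystem {q : ℕ} (hq : q ≤ n) (σ : Equiv.Perm (Fin q)) :
    IsTransversalSystem (bar n σ) (fun i => Fin.castLE hq i) (fun i => Fin.castLE hq (σ i)) := by
  intro i j
  rw [bar_rel_inl_inr]
  constructor
  · rintro ⟨m, h1, h2⟩
    have h1' : i = m := Fin.ext h1
    have h2' : σ j = σ m := Fin.ext h2
    rw [h1', σ.injective h2']
  · rintro rfl; exact ⟨i, rfl, rfl⟩

theorem rank_le_of_dom {a : PartitionMonoid n} (A : Finset (Fin n)) (h : ∀ i, dom a i → i ∈ A) :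
    a.rank ≤ A.card := by
  obtain ⟨x, y, hxy⟩ := le_rank_iff.1 (le_refl a.rank)
  have := Finset.card_le_card_of_injOn (s := Finset.univ) (t := A) x
    (fun i _ => h _ ⟨y i, (hxy i i).2 rfl⟩) hxy.left_injective.injOn
  simpa using this

theorem rank_bar {q : ℕ} (hq : q ≤ n) (σ : Equiv.Perm (Fin q)) : (bar n σ).rank = q := by
  apply le_antisymm
  · refine (rank_le_of_dom (Finset.univ.map (Fin.castLEEmb hq)) ?_).trans (by simp)
    rintro i ⟨k, hk⟩
    obtain ⟨m, hm, -⟩ := bar_rel_inl_inr.1 hk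
    exact Finset.mem_map.2 ⟨m, Finset.mem_univ _, Fin.ext hm.symm⟩
  · exact le_rank_iff.2 ⟨_, _, bar_isTransversalSystem hq σ⟩

theorem IsTransversalSystem.sel_mul_mul {a : PartitionMonoid n} {q : ℕ} {x y : Fin q → Fin n}
    (h : IsTransversalSystem a x y) : sel x * a * flip (sel y) = eps n q := by
  refine ext_iff'.2 ⟨fun i j => ?_, fun i j => ?_, fun i j => ?_⟩
  · rw [mul_flip_sel_rel_inl_inl, sel_mul_rel_inl_inl, bar_rel_inl_inl]
    refine ⟨?_, Or.inl⟩
    rintro (h' | ⟨m, k, hm, hk, h'⟩)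
    · exact h'
    · exact Fin.ext (by rw [hm, hk, h.left_rel h'])
  · rw [mul_flip_sel_rel_inl_inr, bar_rel_inl_inr]
    constructor
    · rintro ⟨k, hk, h'⟩
      obtain ⟨m, hm, h'⟩ := (sel_mul_rel_inl_inr x a).1 h'
      have := (h m k).1 h'
      subst this
      exact ⟨m, hm, hk⟩
    · rintro ⟨m, hm, hk⟩
      exact ⟨m, hk, (sel_mul_rel_inl_inr x a).2 ⟨m, hm, (h m m).2 rfl⟩⟩
  · rw [mul_flip_sel_rel_inr_inr, bar_rel_inr_inr]
    refine ⟨?_, Or.inl⟩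
    rintro (h' | ⟨m, k, hm, hk, h'⟩)
    · exact h'
    · rw [sel_mul_rel_inr_inr] at h'
      have := h.symm.left_rel (i := m) (j := k) h'
      exact Fin.ext (by rw [hm, hk, this])

/-- A partition is recovered from its upper pattern and its lower pattern, glued along a full system
of representatives of its transversals. -/
theorem IsTransversalSystem.mul_mul_eq {a : PartitionMonoid n} {q : ℕ} {x y : Fin q → Fin n}
    (h : IsTransversalSystem a x y) (hq : a.rank = q) :
    (a * flip (sel y)) * (sel x * a) = a := by
  have hqn : q ≤ n := hq ▸ rank_le a
  let φ : Vertex n → Quotient a.rel ⊕ Fin n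
    | .upper i => Sum.inl (Quotient.mk _ (Sum.inl i))
    | .middle k => if hk : k.val < q then Sum.inl (Quotient.mk _ (Sum.inl (x ⟨k, hk⟩)))
        else Sum.inr k
    | .lower i => Sum.inl (Quotient.mk _ (Sum.inr i))
  have hmid : ∀ m : Fin q, ∀ k : Fin n, k.val = m →
      φ (.middle k) = Sum.inl (Quotient.mk _ (Sum.inl (x m))) := by
    intro m k hk
    have hk' : k.val < q := hk ▸ m.2
    have : (⟨k, hk'⟩ : Fin q) = m := Fin.ext hk
    change (if hk : k.val < q then _ else _) = _
    rw [dif_pos hk', this]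
  have hsound : ∀ u v, ((a * flip (sel y)) * (sel x * a)).rel u v →
      φ (outer u) = φ (outer v) := by
    intro u v huv
    refine eq_of_mul_rel φ ?_ ?_ huv
    · have hlr : ∀ i k, (a * flip (sel y)).rel (Sum.inl i) (Sum.inr k) →
          φ (top (Sum.inl i)) = φ (top (Sum.inr k)) := by
        intro i k h'
        obtain ⟨m, hm, h'⟩ := (mul_flip_sel_rel_inl_inr y a).1 h'
        refine Eq.trans ?_ (hmid m k hm).symm
        exact congrArg Sum.inl (Quotient.sound (a.rel.trans' h' (a.rel.symm' ((h m m).2 rfl))))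
      rintro (i | i) (j | j) h'
      · exact congrArg Sum.inl (Quotient.sound ((mul_flip_sel_rel_inl_inl y a).1 h'))
      · exact hlr _ _ h'
      · exact (hlr _ _ (Setoid.symm' _ h')).symm
      · rcases (mul_flip_sel_rel_inr_inr y a).1 h' with rfl | ⟨m, k, hm, hk, h'⟩
        · rfl
        · refine (hmid m i hm).trans (Eq.trans ?_ (hmid k j hk).symm)
          rw [h.symm.left_rel (i := m) (j := k) h']
    · have hlr : ∀ i k, (sel x * a).rel (Sum.inl i) (Sum.inr k) →
          φ (bot (Sum.inl i)) = φ (bot (Sum.inr k)) := by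
        intro i k h'
        obtain ⟨m, hm, h'⟩ := (sel_mul_rel_inl_inr x a).1 h'
        refine (hmid m i hm).trans ?_
        exact congrArg Sum.inl (Quotient.sound h')
      rintro (i | i) (j | j) h'
      · rcases (sel_mul_rel_inl_inl x a).1 h' with rfl | ⟨m, k, hm, hk, h'⟩
        · rfl
        · refine (hmid m i hm).trans (Eq.trans ?_ (hmid k j hk).symm)
          exact congrArg Sum.inl (Quotient.sound h')
      · exact hlr _ _ h'
      · exact (hlr _ _ (Setoid.symm' _ h')).symm
      · exact congrArg Sum.inl (Quotient.sound ((sel_mul_rel_inr_inr x a).1 h'))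
  refine ext_iff'.2 ⟨fun i j => ⟨fun h' => ?_, fun h' => ?_⟩,
    fun i j => ⟨fun h' => ?_, fun h' => ?_⟩,
    fun i j => ⟨fun h' => ?_, fun h' => ?_⟩⟩
  · exact Quotient.exact (Sum.inl_injective (hsound _ _ h'))
  · exact productGraph_top ((mul_flip_sel_rel_inl_inl y a).2 h')
  · exact Quotient.exact (Sum.inl_injective (hsound _ _ h'))
  · obtain ⟨m, hm⟩ := h.exists_of_dom hq ⟨j, h'⟩
    have h1 : (a * flip (sel y)).rel (Sum.inl i) (Sum.inr (Fin.castLE hqn m)) :=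
      (mul_flip_sel_rel_inl_inr y a).2 ⟨m, rfl, a.rel.trans' hm ((h m m).2 rfl)⟩
    have h2 : (sel x * a).rel (Sum.inl (Fin.castLE hqn m)) (Sum.inr j) :=
      (sel_mul_rel_inl_inr x a).2 ⟨m, rfl, a.rel.trans' (a.rel.symm' hm) h'⟩
    exact mul_rel_iff.2 (Setoid.trans' (productGraph _ _) (productGraph_top h1)
      (productGraph_bot h2))
  · exact Quotient.exact (Sum.inl_injective (hsound _ _ h'))
  · exact productGraph_bot ((sel_mul_rel_inr_inr x a).2 h')

theorem exists_eps_eq {a : PartitionMonoid n} {q : ℕ} (hq : a.rank = q) :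
    ∃ s t, eps n q = s * a * t ∧ a = (a * t) * eps n q * (s * a) := by
  obtain ⟨x, y, h⟩ := le_rank_iff.1 hq.ge
  refine ⟨sel x, flip (sel y), h.sel_mul_mul.symm, ?_⟩
  have h1 := h.mul_mul_eq hq
  rw [← h.sel_mul_mul]
  calc a = (a * flip (sel y)) * (sel x * a) := h1.symm
    _ = (a * flip (sel y)) * (sel x * ((a * flip (sel y)) * (sel x * a))) := by rw [h1, h1]
    _ = (a * flip (sel y)) * (sel x * a * flip (sel y)) * (sel x * a) := by simp only [mul_assoc]

theorem rank_le_iff {a b : PartitionMonoid n} : a.rank ≤ b.rank ↔ ∃ s t, a = s * b * t := by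
  constructor
  · intro h
    obtain ⟨s, t, -, h1⟩ := exists_eps_eq (a := a) rfl
    obtain ⟨s', t', h2, -⟩ := exists_eps_eq (a := b) rfl
    refine ⟨a * t * eps n a.rank * s', t' * (s * a), ?_⟩
    calc a = (a * t) * (eps n a.rank * eps n b.rank) * (s * a) := by
          rw [eps_mul_eps_of_le h (rank_le b), ← h1]
      _ = _ := by rw [h2]; simp only [mul_assoc]
  · rintro ⟨s, t, rfl⟩; exact rank_mul_mul_le _ _ _

theorem greenJ_iff_rank {a b : PartitionMonoid n} : GreenJ a b ↔ a.rank = b.rank := by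
  rw [greenJ_iff, ← rank_le_iff, ← rank_le_iff]
  exact ⟨fun h => le_antisymm h.1 h.2, fun h => ⟨h.le, h.ge⟩⟩

theorem greenJ_eps {a : PartitionMonoid n} {q : ℕ} (hq : q ≤ n) :
    GreenJ a (eps n q) ↔ a.rank = q := by
  rw [greenJ_iff_rank, rank_bar hq]

/-- The ideals are the sets of partitions of bounded rank. -/
theorem isIdeal_iff {I : Set (PartitionMonoid n)} : IsIdeal I ↔ ∃ q ≤ n, I = rankIdeal n q := by
  constructor
  · rintro ⟨hne, hI⟩
    obtain ⟨a, ha, hmax⟩ := Set.exists_max_image I rank (Set.toFinite I) hne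
    refine ⟨a.rank, rank_le a, Set.Subset.antisymm hmax fun b hb => ?_⟩
    obtain ⟨s, t, rfl⟩ := rank_le_iff.1 (show b.rank ≤ a.rank from hb)
    exact (hI _ (hI a ha s).1 t).2
  · rintro ⟨q, hq, rfl⟩
    refine ⟨⟨eps n q, (rank_bar hq _).le⟩, fun x hx a => ⟨?_, ?_⟩⟩
    · exact (rank_mul_le_right a x).trans hx
    · exact (rank_mul_le_left x a).trans hx

/-- The maximal subgroup at `eps n q` consists of the images of the permutations. -/
theorem greenH_eps_iff {q : ℕ} (hq : q ≤ n) {g : PartitionMonoid n} :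
    GreenH g (eps n q) ↔ ∃ σ : Equiv.Perm (Fin q), g = bar n σ := by
  have he := eps_mul_eps hq
  constructor
  · intro hg
    have h1 := greenH_mul_left_cancel he hg
    have h2 : eps n q * flip g = flip g := by
      rw [← flip_eps, ← flip_mul, greenH_mul_right_cancel he hg]
    have hr : g.rank = q := (greenJ_eps hq).1 hg.1.greenJ
    obtain ⟨x, y, hxy⟩ := le_rank_iff.1 hr.ge
    have hx : ∀ i k, g.rel (Sum.inl i) (Sum.inr k) → i.val < q := fun i k h => by
      rw [← h1] at h; exact ((eps_mul_rel_inl_inr hq).1 h).1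
    have hy : ∀ i k, g.rel (Sum.inl i) (Sum.inr k) → k.val < q := fun i k h => by
      have h : (flip g).rel (Sum.inl k) (Sum.inr i) := g.rel.symm' h
      rw [← h2] at h; exact ((eps_mul_rel_inl_inr hq).1 h).1
    have hll : ∀ i j, g.rel (Sum.inl i) (Sum.inl j) → i = j ∨ (i.val < q ∧ j.val < q) :=
      fun i j h => by
        rw [← h1] at h
        exact ((eps_mul_rel_inl_inl hq).1 h).imp_right fun h => ⟨h.1, h.2.1⟩
    have hrr : ∀ i j, g.rel (Sum.inr i) (Sum.inr j) → i = j ∨ (i.val < q ∧ j.val < q) :=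
      fun i j h => by
        have h : (flip g).rel (Sum.inl i) (Sum.inl j) := h
        rw [← h2] at h
        exact ((eps_mul_rel_inl_inl hq).1 h).imp_right fun h => ⟨h.1, h.2.1⟩
    let x' : Fin q → Fin q := fun i => ⟨x i, hx _ _ ((hxy i i).2 rfl)⟩
    let y' : Fin q → Fin q := fun i => ⟨y i, hy _ _ ((hxy i i).2 rfl)⟩
    have hx' : Function.Bijective x' := Finite.injective_iff_bijective.1 fun i j hij =>
      hxy.left_injective (Fin.ext (Fin.mk.inj_iff.1 hij))
    have hy' : Function.Bijective y' := Finite.injective_iff_bijective.1 fun i j hij =>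
      hxy.right_injective (Fin.ext (Fin.mk.inj_iff.1 hij))
    have ex : ∀ i : Fin n, i.val < q → ∃ m, i = x m := fun i hi => by
      obtain ⟨m, hm⟩ := hx'.2 ⟨i, hi⟩
      exact ⟨m, Fin.ext (Fin.ext_iff.1 hm).symm⟩
    have ey : ∀ i : Fin n, i.val < q → ∃ m, i = y m := fun i hi => by
      obtain ⟨m, hm⟩ := hy'.2 ⟨i, hi⟩
      exact ⟨m, Fin.ext (Fin.ext_iff.1 hm).symm⟩
    let σ := (Equiv.ofBijective x' hx').symm.trans (Equiv.ofBijective y' hy')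
    have hσ : ∀ m, σ (x' m) = y' m := fun m => by
      simp only [σ, Equiv.trans_apply, Equiv.ofBijective_apply]
      exact congrArg y' ((Equiv.ofBijective x' hx').symm_apply_apply m)
    refine ⟨σ, ext_iff'.2 ⟨fun i j => ?_, fun i j => ?_, fun i j => ?_⟩⟩
    · rw [bar_rel_inl_inl]
      refine ⟨fun h => ?_, by rintro rfl; exact Setoid.refl' _ _⟩
      rcases hll _ _ h with h' | ⟨hi, hj⟩
      · exact h'
      · obtain ⟨m, rfl⟩ := ex i hi
        obtain ⟨k, rfl⟩ := ex j hj
        rw [hxy.left_rel h]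
    · rw [bar_rel_inl_inr]
      constructor
      · intro h
        obtain ⟨m, rfl⟩ := ex i (hx _ _ h)
        obtain ⟨k, rfl⟩ := ey j (hy _ _ h)
        obtain rfl := (hxy m k).1 h
        exact ⟨x' m, rfl, by rw [hσ]⟩
      · rintro ⟨m, hi, hj⟩
        obtain ⟨k, rfl⟩ := hx'.2 m
        rw [hσ] at hj
        have e1 : i = x k := Fin.ext hi
        have e2 : j = y k := Fin.ext hj
        rw [e1, e2]
        exact (hxy k k).2 rfl
    · rw [bar_rel_inr_inr]
      refine ⟨fun h => ?_, by rintro rfl; exact Setoid.refl' _ _⟩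
      rcases hrr _ _ h with h' | ⟨hi, hj⟩
      · exact h'
      · obtain ⟨m, rfl⟩ := ey i hi
        obtain ⟨k, rfl⟩ := ey j hj
        rw [hxy.symm.left_rel (i := m) (j := k) h]
  · rintro ⟨σ, rfl⟩
    refine ⟨greenR_iff.2 ⟨⟨bar n σ, ?_⟩, bar n σ⁻¹, ?_⟩,
      greenL_iff.2 ⟨⟨bar n σ, ?_⟩, bar n σ⁻¹, ?_⟩⟩ <;>
      rw [bar_mul_bar hq] <;> simp

end PartitionMonoid

/-! ### Kernels, the minimal ideal and retractions -/

namespace PartitionMonoid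

open SemigroupCong

variable {n : ℕ}

/-- The upper kernel of a product depends on the second factor through its upper kernel only. -/
theorem uker_mul (a b : PartitionMonoid n) :
    uker (a * b) = (a.rel ⊔ (uker b).map Sum.inr).comap Sum.inl := by
  have h1 : (productGraph a b).comap top = a.rel ⊔ (uker b).map Sum.inr := by
    rw [productGraph, sup_comm, comap_sup_map, sup_comm]
    congr 1
    refine comap_map_eq_map_comap top_injective bot_injective Sum.inr_injective (fun _ => rfl) ?_ _
    rintro (i | i) (j | j) h <;> cases h
    exact ⟨i, rfl, rfl⟩
  rw [← h1]
  rfl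

theorem uker_mul_congr (a : PartitionMonoid n) {b c : PartitionMonoid n} (h : uker b = uker c) :
    uker (a * b) = uker (a * c) := by rw [uker_mul, uker_mul, h]

theorem lker_mul_congr {a b : PartitionMonoid n} (c : PartitionMonoid n) (h : lker a = lker b) :
    lker (a * c) = lker (b * c) := by
  rw [← uker_flip, ← uker_flip (b * c), flip_mul, flip_mul]
  exact uker_mul_congr _ h

theorem lker_le_lker_mul (a b : PartitionMonoid n) : lker b ≤ lker (a * b) :=
  fun _ _ h => productGraph_bot (a := a) h

theorem one_le_rank {a : PartitionMonoid n} {i k} (h : a.rel (Sum.inl i) (Sum.inr k)) :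
    1 ≤ a.rank :=
  le_rank_iff.2 ⟨fun _ => i, fun _ => k, fun u v => iff_of_true h (Subsingleton.elim u v)⟩

theorem rank_eq_zero_iff {a : PartitionMonoid n} :
    a.rank = 0 ↔ ∀ i k, ¬ a.rel (Sum.inl i) (Sum.inr k) := by
  constructor
  · intro h i k hik
    have := one_le_rank hik
    omega
  · intro h
    by_contra hne
    obtain ⟨x, y, hxy⟩ := le_rank_iff.1 (Nat.one_le_iff_ne_zero.2 hne)
    exact h _ _ ((hxy 0 0).2 rfl)

/-- All transversals of a partition of rank at most one coincide. -/
theorem rel_of_dom {a : PartitionMonoid n} (ha : a.rank ≤ 1) {i j} (hi : dom a i) (hj : dom a j) :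
    a.rel (Sum.inl i) (Sum.inl j) := by
  by_contra hno
  obtain ⟨k, hk⟩ := hi
  obtain ⟨l, hl⟩ := hj
  have h1 : ¬ a.rel (Sum.inl i) (Sum.inr l) := fun h => hno (a.rel.trans' h (a.rel.symm' hl))
  have h2 : ¬ a.rel (Sum.inl j) (Sum.inr k) := fun h =>
    hno (a.rel.trans' hk (a.rel.symm' h))
  have : 2 ≤ a.rank := by
    refine le_rank_iff.2 ⟨![i, j], ![k, l], fun u v => ?_⟩
    fin_cases u <;> fin_cases v <;> simp [hk, hl, h1, h2]
  omega

theorem uker_mul_of_rank_le_one {a : PartitionMonoid n} (ha : a.rank ≤ 1)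
    (b : PartitionMonoid n) : uker (a * b) = uker a := by
  refine le_antisymm (fun i j h => ?_) (uker_le_uker_mul a b)
  rcases uker_mul_rel h with h | ⟨hi, hj⟩
  · exact h
  · exact rel_of_dom ha hi hj

theorem lker_mul_of_rank_le_one {b : PartitionMonoid n} (hb : b.rank ≤ 1)
    (a : PartitionMonoid n) : lker (a * b) = lker b := by
  rw [← uker_flip, flip_mul, uker_mul_of_rank_le_one (by rwa [rank_flip]), uker_flip]

/-- The partition of rank `0` with given upper and lower kernels. -/
def ofKer (u l : Setoid (Fin n)) : PartitionMonoid n :=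
  ⟨Setoid.ker (Sum.map (Quotient.mk u) (Quotient.mk l))⟩

@[simp] theorem rank_ofKer (u l : Setoid (Fin n)) : (ofKer u l).rank = 0 :=
  rank_eq_zero_iff.2 fun i k h => by
    have : Sum.inl (Quotient.mk u i) = Sum.inr (Quotient.mk l k) := h
    cases this

@[simp] theorem uker_ofKer (u l : Setoid (Fin n)) : uker (ofKer u l) = u := by
  ext i j
  constructor
  · intro h
    have : Sum.inl (Quotient.mk u i) = (Sum.inl (Quotient.mk u j) : Quotient u ⊕ Quotient l) := h
    exact Quotient.exact (Sum.inl_injective this)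
  · intro h
    exact congrArg Sum.inl (Quotient.sound h)

@[simp] theorem lker_ofKer (u l : Setoid (Fin n)) : lker (ofKer u l) = l := by
  ext i j
  constructor
  · intro h
    have : Sum.inr (Quotient.mk l i) = (Sum.inr (Quotient.mk l j) : Quotient u ⊕ Quotient l) := h
    exact Quotient.exact (Sum.inr_injective this)
  · intro h
    exact congrArg Sum.inr (Quotient.sound h)

theorem eq_of_rank_zero {a b : PartitionMonoid n} (ha : a.rank = 0) (hb : b.rank = 0)
    (hu : uker a = uker b) (hl : lker a = lker b) : a = b := by
  refine ext_iff'.2 ⟨fun i j => Setoid.ext_iff.1 hu i j, fun i j => ?_,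
    fun i j => Setoid.ext_iff.1 hl i j⟩
  exact iff_of_false (rank_eq_zero_iff.1 ha i j) (rank_eq_zero_iff.1 hb i j)

/-- The partition of rank `0` obtained by splitting all transversals. -/
def hat (a : PartitionMonoid n) : PartitionMonoid n := ofKer (uker a) (lker a)

@[simp] theorem rank_hat (a : PartitionMonoid n) : (hat a).rank = 0 := rank_ofKer _ _

@[simp] theorem uker_hat (a : PartitionMonoid n) : uker (hat a) = uker a := uker_ofKer _ _

@[simp] theorem lker_hat (a : PartitionMonoid n) : lker (hat a) = lker a := lker_ofKer _ _

theorem hat_eq_self {a : PartitionMonoid n} (ha : a.rank = 0) : hat a = a :=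
  eq_of_rank_zero (rank_hat a) ha (uker_hat a) (lker_hat a)

theorem rank_mul_eq_zero_left {a : PartitionMonoid n} (ha : a.rank = 0) (b : PartitionMonoid n) :
    (a * b).rank = 0 := Nat.le_zero.1 (ha ▸ rank_mul_le_left a b)

theorem rank_mul_eq_zero_right {b : PartitionMonoid n} (hb : b.rank = 0) (a : PartitionMonoid n) :
    (a * b).rank = 0 := Nat.le_zero.1 (hb ▸ rank_mul_le_right a b)

theorem hat_mul {a b : PartitionMonoid n} (ha : a.rank ≤ 1) (hb : b.rank ≤ 1) :
    hat (a * b) = hat a * hat b := by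
  refine eq_of_rank_zero (rank_hat _) (rank_mul_eq_zero_left (rank_hat a) _) ?_ ?_
  · rw [uker_hat, uker_mul_of_rank_le_one ha, uker_mul_of_rank_le_one (by simp), uker_hat]
  · rw [lker_hat, lker_mul_of_rank_le_one hb, lker_mul_of_rank_le_one (by simp), lker_hat]

theorem GreenR.uker_eq {a b : PartitionMonoid n} (h : GreenR a b) : uker a = uker b := by
  obtain ⟨⟨s, hs⟩, t, ht⟩ := greenR_iff.1 h
  apply le_antisymm
  · conv_rhs => rw [ht]
    exact uker_le_uker_mul a t
  · conv_rhs => rw [hs]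
    exact uker_le_uker_mul b s

theorem GreenL.lker_eq {a b : PartitionMonoid n} (h : GreenL a b) : lker a = lker b := by
  obtain ⟨⟨s, hs⟩, t, ht⟩ := greenL_iff.1 h
  apply le_antisymm
  · conv_rhs => rw [ht]
    exact lker_le_lker_mul t a
  · conv_rhs => rw [hs]
    exact lker_le_lker_mul s b

theorem mul_eq_of_rank_zero {a b : PartitionMonoid n} (ha : a.rank = 0) (hb : b.rank = 0) :
    a * b = ofKer (uker a) (lker b) :=
  eq_of_rank_zero (rank_mul_eq_zero_left ha b) (by simp)
    (by rw [uker_mul_of_rank_le_one (by omega), uker_ofKer])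
    (by rw [lker_mul_of_rank_le_one (by omega), lker_ofKer])

theorem greenR_iff_of_rank_zero {a b : PartitionMonoid n} (ha : a.rank = 0) (hb : b.rank = 0) :
    GreenR a b ↔ uker a = uker b := by
  refine ⟨GreenR.uker_eq, fun h => greenR_iff.2 ⟨⟨a, ?_⟩, b, ?_⟩⟩
  · rw [mul_eq_of_rank_zero hb ha, ← h]; exact (hat_eq_self ha).symm
  · rw [mul_eq_of_rank_zero ha hb, h]; exact (hat_eq_self hb).symm

theorem greenL_iff_of_rank_zero {a b : PartitionMonoid n} (ha : a.rank = 0) (hb : b.rank = 0) :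
    GreenL a b ↔ lker a = lker b := by
  refine ⟨GreenL.lker_eq, fun h => greenL_iff.2 ⟨⟨a, ?_⟩, b, ?_⟩⟩
  · rw [mul_eq_of_rank_zero ha hb, ← h]; exact (hat_eq_self ha).symm
  · rw [mul_eq_of_rank_zero hb ha, h]; exact (hat_eq_self hb).symm

theorem isMinimalIdeal_iff {M : Set (PartitionMonoid n)} :
    IsMinimalIdeal M ↔ M = rankIdeal n 0 := by
  have h0 : IsIdeal (rankIdeal n 0) := isIdeal_iff.2 ⟨0, Nat.zero_le n, rfl⟩
  have hsub : ∀ I : Set (PartitionMonoid n), IsIdeal I → rankIdeal n 0 ⊆ I := by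
    intro I hI
    obtain ⟨q, -, rfl⟩ := isIdeal_iff.1 hI
    exact fun x (hx : x.rank ≤ 0) => hx.trans (Nat.zero_le q)
  constructor
  · rintro ⟨hM, hmin⟩
    exact (hmin _ h0 (hsub M hM)).symm
  · rintro rfl
    exact ⟨h0, fun I hI hIM => Set.Subset.antisymm hIM (hsub I hI)⟩

theorem isRetraction_iff {I : Set (PartitionMonoid n)} {f : PartitionMonoid n → PartitionMonoid n} :
    IsRetraction I f ↔ (∀ x ∈ I, (f x).rank = 0) ∧
      (∀ x ∈ I, ∀ y ∈ I, f (x * y) = f x * f y) ∧ ∀ x, x.rank = 0 → f x = x := by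
  constructor
  · rintro ⟨M, hM, h1, h2, h3⟩
    rw [isMinimalIdeal_iff] at hM
    subst hM
    exact ⟨fun x hx => Nat.le_zero.1 (h1 x hx), h2, fun x hx => h3 x (Nat.le_zero.2 hx)⟩
  · rintro ⟨h1, h2, h3⟩
    exact ⟨_, isMinimalIdeal_iff.2 rfl, fun x hx => Nat.le_zero.2 (h1 x hx), h2,
      fun x hx => h3 x (Nat.le_zero.1 hx)⟩

theorem isRetraction_hat {q : ℕ} (hq : q ≤ 1) : IsRetraction (rankIdeal n q) hat :=
  isRetraction_iff.2 ⟨fun x _ => rank_hat x,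
    fun _ hx _ hy => hat_mul (le_trans hx hq) (le_trans hy hq), fun _ hx => hat_eq_self hx⟩

theorem retraction_eq_hat {q : ℕ} (hq : q ≤ 1) {f : PartitionMonoid n → PartitionMonoid n}
    (hf : IsRetraction (rankIdeal n q) f) {x : PartitionMonoid n} (hx : x.rank ≤ q) :
    f x = hat x := by
  obtain ⟨h1, h2, h3⟩ := isRetraction_iff.1 hf
  have hz : (hat x).rank ≤ q := by simp
  have hfx := h1 x hx
  refine eq_of_rank_zero hfx (rank_hat x) ?_ ?_
  · have := h2 x hx _ hz
    rw [h3 _ (rank_hat x), h3 _ (rank_mul_eq_zero_right (rank_hat x) x)] at this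
    rw [← uker_mul_of_rank_le_one (hfx.le.trans zero_le_one) (hat x), ← this,
      uker_mul_of_rank_le_one (hx.trans hq), uker_hat]
  · have := h2 _ hz x hx
    rw [h3 _ (rank_hat x), h3 _ (rank_mul_eq_zero_left (rank_hat x) x)] at this
    rw [← lker_mul_of_rank_le_one (hfx.le.trans zero_le_one) (hat x), ← this,
      lker_mul_of_rank_le_one (hx.trans hq), lker_hat]

theorem uker_eps_mul_rel {q : ℕ} (hq : q ≤ n) {a : PartitionMonoid n} {i j : Fin n}
    (hi : i.val < q) (hj : j.val < q) (h : uker a i j) : uker (eps n q * a) i j :=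
  (eps_mul_rel_inl_inl hq).2 (Or.inr ⟨hi, hj, h⟩)

/-- No partition of rank `0` acts on the minimal ideal like `eps n q` for `2 ≤ q`: the action of
`eps n q` remembers whether two vertices are joined. -/
theorem exists_uker_eps_mul_ne {q : ℕ} (hq2 : 2 ≤ q) (hq : q ≤ n) :
    ∃ z w : PartitionMonoid n, z.rank = 0 ∧ w.rank = 0 ∧
      uker (eps n q * z) ≠ uker (eps n q * w) := by
  refine ⟨ofKer ⊥ ⊥, ofKer ⊤ ⊥, rank_ofKer _ _, rank_ofKer _ _, fun h => ?_⟩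
  have h1 : uker (eps n q * ofKer ⊤ ⊥) ⟨0, by omega⟩ ⟨1, by omega⟩ :=
    uker_eps_mul_rel hq (by simp only; omega) (by simp only; omega) (by rw [uker_ofKer]; trivial)
  rw [← h] at h1
  rcases (eps_mul_rel_inl_inl hq).1 h1 with h2 | ⟨-, -, h2⟩
  · simp at h2
  · have h3 : uker (ofKer ⊥ ⊥) (⟨0, by omega⟩ : Fin n) ⟨1, by omega⟩ := h2
    rw [uker_ofKer] at h3
    have h4 : (⟨0, by omega⟩ : Fin n) = ⟨1, by omega⟩ := h3
    simp at h4

theorem isRetractableIdeal_iff {q : ℕ} (hq : q ≤ n) :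
    IsRetractableIdeal (rankIdeal n q) ↔ q ≤ 1 := by
  constructor
  · rintro ⟨-, f, hf⟩
    obtain ⟨h1, h2, h3⟩ := isRetraction_iff.1 hf
    by_contra hq1
    have hq2 : 2 ≤ q := by omega
    have he : eps n q ∈ rankIdeal n q := (rank_bar hq _).le
    obtain ⟨z, w, hz, hw, hne⟩ := exists_uker_eps_mul_ne hq2 hq
    have key : ∀ z : PartitionMonoid n, z.rank = 0 → uker (eps n q * z) = uker (f (eps n q)) := by
      intro z hz
      have := h2 _ he z (show z.rank ≤ q by omega)
      rw [h3 z hz, h3 _ (rank_mul_eq_zero_right hz _)] at this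
      rw [this, uker_mul_of_rank_le_one ((h1 _ he).le.trans zero_le_one)]
    exact hne ((key z hz).trans (key w hw).symm)
  · intro h
    exact ⟨isIdeal_iff.2 ⟨q, hq, rfl⟩, hat, isRetraction_hat h⟩

/-- Permutations of two letters do not change which of the two letters are joined. -/
theorem bar_mul_eq_of_perm_two (hn : 2 ≤ n) (σ : Equiv.Perm (Fin 2)) {z : PartitionMonoid n}
    (hz : z.rank = 0) : bar n σ * z = eps n 2 * z := by
  refine eq_of_rank_zero (rank_mul_eq_zero_right hz _) (rank_mul_eq_zero_right hz _) ?_ ?_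
  · have key : ∀ τ : Equiv.Perm (Fin 2), ∀ i j : Fin n,
        (bar n τ * z).rel (Sum.inl i) (Sum.inl j) ↔ i = j ∨ (i.val < 2 ∧ j.val < 2 ∧
          z.rel (Sum.inl (Fin.castLE hn 0)) (Sum.inl (Fin.castLE hn 1))) := by
      intro τ i j
      rw [bar_eq_sel hn, sel_mul_rel_inl_inl]
      have hτ : ∀ τ : Equiv.Perm (Fin 2), ∀ m k : Fin 2,
        m = k ∨ (τ m = 0 ∧ τ k = 1) ∨ (τ m = 1 ∧ τ k = 0) := by decide
      constructor
      · rintro (h | ⟨m, k, hm, hk, h⟩)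
        · exact Or.inl h
        · rcases hτ τ m k with hmk | ⟨h0, h1⟩ | ⟨h1, h0⟩
          · exact Or.inl (Fin.ext (by rw [hm, hk, hmk]))
          · rw [h0, h1] at h
            exact Or.inr ⟨hm ▸ m.2, hk ▸ k.2, h⟩
          · rw [h0, h1] at h
            exact Or.inr ⟨hm ▸ m.2, hk ▸ k.2, z.rel.symm' h⟩
      · rintro (h | ⟨hi, hj, h⟩)
        · exact Or.inl h
        · rcases hτ τ ⟨i, hi⟩ ⟨j, hj⟩ with hmk | ⟨h0, h1⟩ | ⟨h1, h0⟩
          · exact Or.inl (Fin.ext (Fin.mk.inj_iff.1 hmk))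
          · exact Or.inr ⟨⟨i, hi⟩, ⟨j, hj⟩, rfl, rfl, by rw [h0, h1]; exact h⟩
          · exact Or.inr ⟨⟨i, hi⟩, ⟨j, hj⟩, rfl, rfl, by rw [h0, h1]; exact z.rel.symm' h⟩
    ext i j
    exact (key σ i j).trans (key 1 i j).symm
  · rw [lker_mul_of_rank_le_one (by omega), lker_mul_of_rank_le_one (by omega)]

theorem mul_bar_eq_of_perm_two (hn : 2 ≤ n) (σ : Equiv.Perm (Fin 2)) {z : PartitionMonoid n}
    (hz : z.rank = 0) : z * bar n σ = z * eps n 2 := by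
  have := bar_mul_eq_of_perm_two hn σ⁻¹ (z := flip z) (by rwa [rank_flip])
  rw [← flip_bar, ← flip_mul, ← flip_eps, ← flip_mul] at this
  rw [← flip_flip (z * bar n σ), this, flip_flip]

end PartitionMonoid

/-! ### IN-pairs and the congruences they define -/

namespace PartitionMonoid

open SemigroupCong

variable {n : ℕ}

theorem bar_mem_groupBar {q : ℕ} (hq : q ≤ n) {N : Subgroup (Equiv.Perm (Fin q))}
    {σ : Equiv.Perm (Fin q)} : bar n σ ∈ groupBar n N ↔ σ ∈ N :=
  ⟨fun ⟨_, h, e⟩ => bar_injective hq e ▸ h, fun h => ⟨σ, h, rfl⟩⟩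

theorem groupBar_isNormal {q : ℕ} (hq : q ≤ n) {N : Subgroup (Equiv.Perm (Fin q))}
    (hN : N.Normal) : IsNormalSubgroupAt (eps n q) (groupBar n N) := by
  refine ⟨?_, ⟨1, N.one_mem, rfl⟩, ?_, ?_, ?_⟩
  · rintro _ ⟨σ, -, rfl⟩
    exact (greenH_eps_iff hq).2 ⟨σ, rfl⟩
  · rintro _ ⟨σ, hσ, rfl⟩ _ ⟨τ, hτ, rfl⟩
    exact ⟨τ * σ, N.mul_mem hτ hσ, (bar_mul_bar hq σ τ).symm⟩
  · rintro _ ⟨σ, hσ, rfl⟩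
    refine ⟨bar n σ⁻¹, ⟨σ⁻¹, N.inv_mem hσ, rfl⟩, ?_, ?_⟩ <;> rw [bar_mul_bar hq] <;> simp
  · rintro g h hg hh hgh - _ ⟨σ, hσ, rfl⟩
    obtain ⟨τ, rfl⟩ := (greenH_eps_iff hq).1 hg
    obtain ⟨ρ, rfl⟩ := (greenH_eps_iff hq).1 hh
    rw [bar_mul_bar hq] at hgh
    have hρ : ρ = τ⁻¹ := eq_inv_of_mul_eq_one_left (bar_injective hq hgh)
    rw [bar_mul_bar hq, bar_mul_bar hq, bar_mem_groupBar hq, hρ]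
    have := hN.conj_mem σ hσ τ⁻¹
    rwa [inv_inv, mul_assoc] at this

/-- The normal subgroups of the maximal subgroup at `eps n q` come from permutations. -/
theorem exists_groupBar_eq {q : ℕ} (hq : q ≤ n) {N' : Set (PartitionMonoid n)}
    (hN' : IsNormalSubgroupAt (eps n q) N') :
    ∃ N : Subgroup (Equiv.Perm (Fin q)), N.Normal ∧ N' = groupBar n N := by
  let N : Subgroup (Equiv.Perm (Fin q)) :=
    { carrier := {σ | bar n σ ∈ N'}
      mul_mem' := fun {a b} ha hb => by
        have := hN'.2.2.1 _ hb _ ha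
        rwa [bar_mul_bar hq] at this
      one_mem' := hN'.2.1
      inv_mem' := fun {a} ha => by
        obtain ⟨y, hy, h1, -⟩ := hN'.2.2.2.1 _ ha
        obtain ⟨τ, rfl⟩ := (greenH_eps_iff hq).1 (hN'.1 y hy)
        rw [bar_mul_bar hq] at h1
        have := eq_inv_of_mul_eq_one_left (bar_injective hq h1)
        change bar n a⁻¹ ∈ N'
        rwa [← this] }
  refine ⟨N, ⟨fun σ hσ τ => ?_⟩, ?_⟩
  · have := hN'.2.2.2.2 (bar n τ⁻¹) (bar n τ) ((greenH_eps_iff hq).2 ⟨_, rfl⟩)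
      ((greenH_eps_iff hq).2 ⟨_, rfl⟩) (by rw [bar_mul_bar hq]; simp)
      (by rw [bar_mul_bar hq]; simp) _ hσ
    rwa [bar_mul_bar hq, bar_mul_bar hq, ← mul_assoc] at this
  · ext a
    constructor
    · intro ha
      obtain ⟨σ, rfl⟩ := (greenH_eps_iff hq).1 (hN'.1 a ha)
      exact ⟨σ, ha, rfl⟩
    · rintro ⟨σ, hσ, rfl⟩; exact hσ

theorem minimalJClassOutside_iff {p : ℕ} {e : PartitionMonoid n} :
    MinimalJClassOutside (rankIdeal n p) e ↔ e.rank = p + 1 := by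
  have hout : ∀ y : PartitionMonoid n, (∀ z, GreenJ z y → z ∉ rankIdeal n p) ↔ p < y.rank := by
    intro y
    constructor
    · intro h
      exact not_le.1 (h y rfl)
    · intro h z hz hz'
      have : z.rank ≤ p := hz'
      rw [greenJ_iff_rank.1 hz] at this
      omega
  constructor
  · rintro ⟨h1, h2⟩
    have hlt := (hout e).1 h1
    have hpn : p + 1 ≤ n := hlt.trans_le (rank_le e)
    have := h2 (eps n (p + 1)) ((hout _).2 (by rw [rank_bar hpn]; omega))
      (rank_le_iff.1 (by rw [rank_bar hpn]; exact hlt))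
    rw [← greenJ_iff_rank.1 this, rank_bar hpn]
  · intro h
    refine ⟨(hout e).2 (by omega), fun y hy hye => greenJ_iff_rank.2 ?_⟩
    have h1 := (hout y).1 hy
    have h2 := rank_le_iff.2 hye
    omega

theorem isINPair_groupBar {p : ℕ} (hp : p + 1 ≤ n) {N : Subgroup (Equiv.Perm (Fin (p + 1)))}
    (hN : N.Normal) : IsINPair (rankIdeal n p) (groupBar n N) :=
  ⟨isIdeal_iff.2 ⟨p, by omega, rfl⟩, eps n (p + 1), eps_mul_eps hp, groupBar_isNormal hp hN,
    stableJClass _, regularJClass (eps_mul_eps hp), minimalJClassOutside_iff.2 (rank_bar hp _)⟩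

/-- Up to the choice of the maximal subgroup in its `J`-class, every IN-pair is given by an ideal
`I_p` and a normal subgroup of the symmetric group on `p + 1` letters. -/
theorem exists_of_isINPair {I N' : Set (PartitionMonoid n)} (h : IsINPair I N') :
    ∃ (p : ℕ) (N : Subgroup (Equiv.Perm (Fin (p + 1)))), p + 1 ≤ n ∧ N.Normal ∧
      I = rankIdeal n p ∧ nuRel N' = nuRel (groupBar n N) ∧ (N'.Nontrivial → N ≠ ⊥) ∧
      (N' ⊆ groupBar n (⊤ : Subgroup (Equiv.Perm (Fin (p + 1)))) → N' = groupBar n N) := by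
  obtain ⟨hI, e, he, hN', -, -, hmin⟩ := h
  obtain ⟨p, hp, rfl⟩ := isIdeal_iff.1 hI
  have hr := minimalJClassOutside_iff.1 hmin
  have hpn : p + 1 ≤ n := hr ▸ rank_le e
  have hbot : ∀ N : Subgroup (Equiv.Perm (Fin (p + 1))), (groupBar n N).Nontrivial → N ≠ ⊥ := by
    rintro N ⟨_, ⟨σ, hσ, rfl⟩, _, ⟨τ, hτ, rfl⟩, hne⟩ rfl
    rw [SetLike.mem_coe, Subgroup.mem_bot] at hσ hτ
    exact hne (by rw [hσ, hτ])
  by_cases hee : e = eps n (p + 1)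
  · subst hee
    obtain ⟨N, hN, rfl⟩ := exists_groupBar_eq hpn hN'
    exact ⟨p, N, hpn, hN, rfl, rfl, hbot N, fun _ => rfl⟩
  · obtain ⟨s, t, hst⟩ := exists_idemPair (eps_mul_eps hpn) he ((greenJ_eps hpn).2 hr)
    obtain ⟨N, hN, hNe⟩ := exists_groupBar_eq hpn
      (hst.isNormalSubgroupAt (eps_mul_eps hpn) he hN')
    refine ⟨p, N, hpn, hN, rfl, ?_, fun hnt => hbot N ?_, fun hsub => ?_⟩
    · rw [← hNe, hst.nuRel_eq (eps_mul_eps hpn) he hN']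
    · rw [← hNe]
      refine hnt.image_of_injOn fun u hu v hv huv => ?_
      have key : ∀ u ∈ N', s * (t * u * s) * t = u := fun u hu => by
        calc s * (t * u * s) * t = (s * t) * u * (s * t) := by simp only [mul_assoc]
          _ = u := by rw [hst.st, greenH_mul_left_cancel he (hN'.1 u hu),
            greenH_mul_right_cancel he (hN'.1 u hu)]
      rw [← key u hu, ← key v hv]
      exact congrArg (fun x => s * x * t) huv
    · exfalso
      obtain ⟨σ, -, hσ⟩ := hsub hN'.2.1
      apply hee
      rw [← hσ, bar_mul_bar hpn] at he
      have := bar_injective hpn he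
      rw [← hσ, mul_eq_left.1 this]

/-! #### Retractable pairs -/

theorem subgroup_perm_two (N : Subgroup (Equiv.Perm (Fin 2))) : N = ⊥ ∨ N = ⊤ := by
  have h : ∀ σ : Equiv.Perm (Fin 2), σ = 1 ∨ σ = Equiv.swap 0 1 := by decide
  by_cases hs : Equiv.swap 0 1 ∈ N
  · right
    rw [eq_top_iff]
    intro σ _
    rcases h σ with rfl | rfl
    · exact N.one_mem
    · exact hs
  · left
    rw [eq_bot_iff]
    intro σ hσ
    rcases h σ with rfl | rfl
    · exact Subgroup.mem_bot.2 rfl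
    · exact absurd hσ hs

theorem RetractablePair.subgroup_normal (C : RetractablePair) : C.subgroup.Normal := by
  cases C <;> simp only [RetractablePair.subgroup] <;> infer_instance

theorem RetractablePair.idealRank_le (C : RetractablePair) : C.idealRank ≤ 1 := by
  cases C <;> simp [RetractablePair.idealRank]

/-- All elements of the group of a retractable pair act in the same way on the minimal ideal. -/
theorem RetractablePair.act_eq (hn : 2 ≤ n) (C : RetractablePair) {z u v : PartitionMonoid n}
    (hz : z.rank = 0) (hu : u ∈ C.group n) (hv : v ∈ C.group n) :
    z * u = z * v ∧ u * z = v * z := by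
  obtain ⟨σ, hσ, rfl⟩ := hu
  obtain ⟨τ, hτ, rfl⟩ := hv
  cases C with
  | c0 =>
    have h1 : σ = 1 := hσ
    have h2 : τ = 1 := hτ
    rw [h1, h2]; exact ⟨rfl, rfl⟩
  | c1 =>
    have h1 : σ = 1 := hσ
    have h2 : τ = 1 := hτ
    rw [h1, h2]; exact ⟨rfl, rfl⟩
  | cS2 =>
    exact ⟨(mul_bar_eq_of_perm_two hn σ hz).trans (mul_bar_eq_of_perm_two hn τ hz).symm,
      (bar_mul_eq_of_perm_two hn σ hz).trans (bar_mul_eq_of_perm_two hn τ hz).symm⟩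

theorem RetractablePair.isRetractableINPair (hn : 2 ≤ n) (C : RetractablePair) :
    IsRetractableINPair (C.ideal n) (C.group n) := by
  have h1 := C.idealRank_le
  refine ⟨isINPair_groupBar (by omega) C.subgroup_normal,
    (isRetractableIdeal_iff (by omega)).2 h1, ?_⟩
  intro M hM x hx u hu v hv
  rw [isMinimalIdeal_iff] at hM
  subst hM
  exact C.act_eq hn (Nat.le_zero.1 hx) hu hv

theorem exists_of_isRetractableINPair {I N' : Set (PartitionMonoid n)}
    (h : IsRetractableINPair I N') :
    ∃ C : RetractablePair, I = C.ideal n ∧ nuRel N' = nuRel (C.group n) ∧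
      (N' ⊆ groupBar n (⊤ : Subgroup (Equiv.Perm (Fin (C.idealRank + 1)))) →
        N' = C.group n) := by
  obtain ⟨hp, hret, -⟩ := h
  obtain ⟨p, N, hpn, -, rfl, h1, -, h2⟩ := exists_of_isINPair hp
  have hp1 := (isRetractableIdeal_iff (by omega)).1 hret
  obtain rfl | rfl : p = 0 ∨ p = 1 := by omega
  · have hN : N = ⊥ := by
      rw [eq_bot_iff]
      intro σ _
      exact Subgroup.mem_bot.2 (Equiv.ext fun i => Subsingleton.elim (α := Fin 1) _ _)
    subst hN
    exact ⟨.c0, rfl, h1, h2⟩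
  · rcases subgroup_perm_two N with rfl | rfl
    · exact ⟨.c1, rfl, h1, h2⟩
    · exact ⟨.cS2, rfl, h1, h2⟩

/-! #### The congruences -/

/-- A congruence that is `ν_N` on the partitions of rank `q`, the relation `ζ` below rank `q`, and
trivial above. -/
def layerCon {q : ℕ} (hq : q ≤ n) {N : Subgroup (Equiv.Perm (Fin q))} (hN : N.Normal)
    (ζ : PartitionMonoid n → PartitionMonoid n → Prop) (hζ : Equivalence ζ)
    (hmul : ∀ a b x y : PartitionMonoid n, x.rank < q → y.rank < q → ζ x y →
      ζ (a * x * b) (a * y * b))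
    (hnu : ∀ a b x y : PartitionMonoid n, nuRel (groupBar n N) x y → ζ (a * x * b) (a * y * b)) :
    Con (PartitionMonoid n) :=
  have he := eps_mul_eps (n := n) hq
  have hNe := groupBar_isNormal hq hN
  have hrank : ∀ {x y : PartitionMonoid n}, nuRel (groupBar n N) x y → x.rank = q ∧ y.rank = q :=
    fun h => ⟨(greenJ_eps hq).1 (h.greenJ hNe).1, (greenJ_eps hq).1 (h.greenJ hNe).2⟩
  have hcompat : ∀ a b x y : PartitionMonoid n,
      (x = y ∨ nuRel (groupBar n N) x y ∨ (x.rank < q ∧ y.rank < q ∧ ζ x y)) →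
      (a * x * b = a * y * b ∨ nuRel (groupBar n N) (a * x * b) (a * y * b) ∨
        ((a * x * b).rank < q ∧ (a * y * b).rank < q ∧ ζ (a * x * b) (a * y * b))) := by
    rintro a b x y (rfl | h | ⟨h1, h2, h3⟩)
    · exact Or.inl rfl
    · right
      have hr := hrank h
      have key : ∀ x y : PartitionMonoid n, nuRel (groupBar n N) x y → (a * x * b).rank = q →
          nuRel (groupBar n N) (a * x * b) (a * y * b) := by
        intro x y h hx
        have hr := hrank h
        have hH := h.greenH he hNe
        have h1 : (a * x).rank = q := le_antisymm ((rank_mul_le_right _ _).trans hr.1.le)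
          (hx ▸ rank_mul_le_left _ _)
        -- `x` and `y` are `R`-related, so `a * x` and `a * y` generate the same right ideal
        have h2 : (a * y).rank = q := by
          obtain ⟨⟨s, hs⟩, -⟩ := greenR_iff.1 hH.1
          refine le_antisymm ((rank_mul_le_right _ _).trans hr.2.le) ?_
          rw [← h1, hs, ← mul_assoc]
          exact rank_mul_le_left _ _
        have h3 := h.mul_left hNe a ((greenJ_eps hq).2 h1) ((greenJ_eps hq).2 h2)
        have hH' := h3.greenH he hNe
        have h4 : (a * y * b).rank = q := by
          obtain ⟨⟨s, hs⟩, -⟩ := greenL_iff.1 hH'.2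
          refine le_antisymm ((rank_mul_le_left _ _).trans h2.le) ?_
          rw [← hx, hs, mul_assoc]
          exact rank_mul_le_right _ _
        exact h3.mul_right hNe b ((greenJ_eps hq).2 hx) ((greenJ_eps hq).2 h4)
      by_cases hx : (a * x * b).rank = q
      · exact Or.inl (key x y h hx)
      · by_cases hy : (a * y * b).rank = q
        · exact Or.inl (key y x h.symm hy).symm
        · refine Or.inr ⟨lt_of_le_of_ne ?_ hx, lt_of_le_of_ne ?_ hy, hnu a b x y h⟩
          · exact hr.1 ▸ rank_mul_mul_le a x b
          · exact hr.2 ▸ rank_mul_mul_le a y b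
    · exact Or.inr (Or.inr ⟨(rank_mul_mul_le a x b).trans_lt h1,
        (rank_mul_mul_le a y b).trans_lt h2, hmul a b x y h1 h2 h3⟩)
  have htrans : ∀ x y z : PartitionMonoid n,
      (x = y ∨ nuRel (groupBar n N) x y ∨ (x.rank < q ∧ y.rank < q ∧ ζ x y)) →
      (y = z ∨ nuRel (groupBar n N) y z ∨ (y.rank < q ∧ z.rank < q ∧ ζ y z)) →
      (x = z ∨ nuRel (groupBar n N) x z ∨ (x.rank < q ∧ z.rank < q ∧ ζ x z)) := by
    rintro x y z (rfl | h | ⟨h1, h2, h3⟩) (rfl | h' | ⟨h1', h2', h3'⟩)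
    · exact Or.inl rfl
    · exact Or.inr (Or.inl h')
    · exact Or.inr (Or.inr ⟨h1', h2', h3'⟩)
    · exact Or.inr (Or.inl h)
    · exact Or.inr (Or.inl (h.trans he hNe h'))
    · have := (hrank h).2; omega
    · exact Or.inr (Or.inr ⟨h1, h2, h3⟩)
    · have := (hrank h').1; omega
    · exact Or.inr (Or.inr ⟨h1, h2', hζ.trans h3 h3'⟩)
  { r := fun x y => x = y ∨ nuRel (groupBar n N) x y ∨ (x.rank < q ∧ y.rank < q ∧ ζ x y)
    iseqv :=
      { refl := fun x => Or.inl rfl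
        symm := by
          rintro x y (rfl | h | ⟨h1, h2, h3⟩)
          · exact Or.inl rfl
          · exact Or.inr (Or.inl h.symm)
          · exact Or.inr (Or.inr ⟨h2, h1, hζ.symm h3⟩)
        trans := htrans _ _ _ }
    mul' := by
      intro w x y z h h'
      refine htrans (w * y) (x * y) (x * z) ?_ ?_
      · simpa only [one_mul] using hcompat 1 y w x h
      · simpa only [mul_one] using hcompat x 1 y z h' }

theorem layerCon_rel {q : ℕ} (hq : q ≤ n) {N : Subgroup (Equiv.Perm (Fin q))} (hN : N.Normal)
    {ζ : PartitionMonoid n → PartitionMonoid n → Prop} (hζ hmul hnu) {x y : PartitionMonoid n} :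
    layerCon hq hN ζ hζ hmul hnu x y ↔
      x = y ∨ nuRel (groupBar n N) x y ∨ (x.rank < q ∧ y.rank < q ∧ ζ x y) := Iff.rfl

/-- The Rees congruence of the ideal of partitions of rank at most `q`. -/
def reesCon (n q : ℕ) : Con (PartitionMonoid n) where
  r := reesRel (rankIdeal n q)
  iseqv :=
    { refl := fun x => Or.inl rfl
      symm := by
        rintro x y (rfl | ⟨h1, h2⟩)
        · exact Or.inl rfl
        · exact Or.inr ⟨h2, h1⟩
      trans := by
        rintro x y z (rfl | ⟨h1, h2⟩) (rfl | ⟨h1', h2'⟩)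
        · exact Or.inl rfl
        · exact Or.inr ⟨h1', h2'⟩
        · exact Or.inr ⟨h1, h2⟩
        · exact Or.inr ⟨h1, h2'⟩ }
  mul' := by
    rintro w x y z (rfl | ⟨h1, h2⟩) (rfl | ⟨h1', h2'⟩)
    · exact Or.inl rfl
    · exact Or.inr ⟨(rank_mul_le_right _ _).trans h1', (rank_mul_le_right _ _).trans h2'⟩
    · exact Or.inr ⟨(rank_mul_le_left _ _).trans h1, (rank_mul_le_left _ _).trans h2⟩
    · exact Or.inr ⟨(rank_mul_le_left _ _).trans h1, (rank_mul_le_left _ _).trans h2⟩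

/-- The congruence `R_N`. -/
def inCon {q : ℕ} (hq : q ≤ n) {N : Subgroup (Equiv.Perm (Fin q))} (hN : N.Normal) :
    Con (PartitionMonoid n) :=
  layerCon hq hN (fun _ _ => True) ⟨fun _ => trivial, fun _ => trivial, fun _ _ => trivial⟩
    (fun _ _ _ _ _ _ _ => trivial) (fun _ _ _ _ _ => trivial)

theorem inCon_rel {q : ℕ} (hq : q ≤ n) (hq1 : 1 ≤ q) {N : Subgroup (Equiv.Perm (Fin q))}
    (hN : N.Normal) {x y : PartitionMonoid n} :
    inCon hq hN x y ↔ inRel (rankIdeal n (q - 1)) (groupBar n N) x y := by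
  have h : ∀ x : PartitionMonoid n, x ∈ rankIdeal n (q - 1) ↔ x.rank < q := fun x =>
    (Nat.le_sub_one_iff_lt hq1)
  refine (layerCon_rel hq hN _ _ _).trans ?_
  simp only [inRel, reesRel, h, and_true]
  tauto

/-- The relations used on the ideal of a retractable pair: a pair of kernels to be preserved. -/
def kerRel (u l : Prop) (x y : PartitionMonoid n) : Prop :=
  (u → uker x = uker y) ∧ (l → lker x = lker y)

/-- Multiplication by the elements of the group of a retractable pair gives partitions which are
equal below the `J`-class of the group, up to splitting the transversals. -/
theorem RetractablePair.ker_eq_of_nuRel (hn : 2 ≤ n) (C : RetractablePair)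
    {x y : PartitionMonoid n} (h : nuRel (C.group n) x y) (a b : PartitionMonoid n) :
    uker (a * x * b) = uker (a * y * b) ∧ lker (a * x * b) = lker (a * y * b) := by
  obtain ⟨u, hu, v, hv, s, t, rfl, rfl, -, -⟩ := h
  constructor
  · have h1 : uker (u * (t * b)) = uker (v * (t * b)) := by
      rw [← uker_mul_congr u (uker_hat (t * b)), ← uker_mul_congr v (uker_hat (t * b)),
        (C.act_eq hn (rank_hat (t * b)) hu hv).2]
    have := uker_mul_congr (a * s) h1
    simpa only [mul_assoc] using this
  · have h1 : lker ((a * s) * u) = lker ((a * s) * v) := by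
      rw [← lker_mul_congr u (lker_hat (a * s)), ← lker_mul_congr v (lker_hat (a * s)),
        (C.act_eq hn (rank_hat (a * s)) hu hv).1]
    have := lker_mul_congr (t * b) h1
    simpa only [mul_assoc] using this

/-- The congruences `λ_C`, `ρ_C`, `μ_C` of a retractable pair: `u` and `l` tell which of the
kernels is preserved on the ideal. -/
def retractCon (hn : 2 ≤ n) (C : RetractablePair) (u l : Prop) : Con (PartitionMonoid n) :=
  have h1 := C.idealRank_le
  layerCon (q := C.idealRank + 1) (by omega) C.subgroup_normal (kerRel u l)
    ⟨fun _ => ⟨fun _ => rfl, fun _ => rfl⟩,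
      fun h => ⟨fun hu => (h.1 hu).symm, fun hl => (h.2 hl).symm⟩,
      fun h h' => ⟨fun hu => (h.1 hu).trans (h'.1 hu), fun hl => (h.2 hl).trans (h'.2 hl)⟩⟩
    (fun a b x y hx hy h => by
      have hax : (a * x).rank ≤ 1 := (rank_mul_le_right a x).trans (by omega)
      have hay : (a * y).rank ≤ 1 := (rank_mul_le_right a y).trans (by omega)
      refine ⟨fun hu => ?_, fun hl => ?_⟩
      · rw [uker_mul_of_rank_le_one hax, uker_mul_of_rank_le_one hay]
        exact uker_mul_congr a (h.1 hu)
      · apply lker_mul_congr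
        rw [lker_mul_of_rank_le_one (by omega), lker_mul_of_rank_le_one (by omega)]
        exact h.2 hl)
    (fun a b x y h => ⟨fun _ => (C.ker_eq_of_nuRel hn h a b).1,
      fun _ => (C.ker_eq_of_nuRel hn h a b).2⟩)

theorem retractCon_rel_iff (hn : 2 ≤ n) (C : RetractablePair) (u l : Prop)
    {x y : PartitionMonoid n} : retractCon hn C u l x y ↔
      x = y ∨ nuRel (C.group n) x y ∨
        (x.rank ≤ C.idealRank ∧ y.rank ≤ C.idealRank ∧ kerRel u l x y) := by
  refine Iff.trans (b := x = y ∨ nuRel (C.group n) x y ∨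
    (x.rank < C.idealRank + 1 ∧ y.rank < C.idealRank + 1 ∧ kerRel u l x y)) Iff.rfl ?_
  simp only [Nat.lt_succ_iff]

theorem zetaRel_iff (C : RetractablePair) {N : Set (PartitionMonoid n)}
    {ξ : PartitionMonoid n → PartitionMonoid n → Prop} {x y : PartitionMonoid n} :
    zetaRel (C.ideal n) N ξ x y ↔
      x = y ∨ nuRel N x y ∨
        (x.rank ≤ C.idealRank ∧ y.rank ≤ C.idealRank ∧ ξ (hat x) (hat y)) := by
  refine or_congr_right (or_congr_right ?_)
  constructor
  · rintro ⟨hx, hy, f, hf, h⟩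
    rw [retraction_eq_hat C.idealRank_le hf hx, retraction_eq_hat C.idealRank_le hf hy] at h
    exact ⟨hx, hy, h⟩
  · rintro ⟨hx, hy, h⟩
    exact ⟨hx, hy, hat, isRetraction_hat C.idealRank_le, h⟩

theorem lamRel_iff (hn : 2 ≤ n) (C : RetractablePair) {x y : PartitionMonoid n} :
    lamRel (C.ideal n) (C.group n) x y ↔ retractCon hn C False True x y := by
  rw [lamRel, zetaRel_iff, retractCon_rel_iff, kerRel,
    greenL_iff_of_rank_zero (rank_hat x) (rank_hat y)]
  simp

theorem rhoRel_iff (hn : 2 ≤ n) (C : RetractablePair) {x y : PartitionMonoid n} :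
    rhoRel (C.ideal n) (C.group n) x y ↔ retractCon hn C True False x y := by
  rw [rhoRel, zetaRel_iff, retractCon_rel_iff, kerRel,
    greenR_iff_of_rank_zero (rank_hat x) (rank_hat y)]
  simp

theorem muRel_iff (hn : 2 ≤ n) (C : RetractablePair) {x y : PartitionMonoid n} :
    muRel (C.ideal n) (C.group n) x y ↔ retractCon hn C True True x y := by
  rw [muRel, zetaRel_iff, retractCon_rel_iff, kerRel, GreenH,
    greenR_iff_of_rank_zero (rank_hat x) (rank_hat y),
    greenL_iff_of_rank_zero (rank_hat x) (rank_hat y)]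
  simp

/-- The congruence with a given name. -/
def CongName.toCon (hn : 2 ≤ n) : CongName n → Con (PartitionMonoid n)
  | .R q _ => reesCon n q
  | .RN _ _ hq _ hN _ => inCon hq hN
  | .lam C => retractCon hn C False True
  | .rho C => retractCon hn C True False
  | .mu C => retractCon hn C True True

theorem CongName.toCon_rel (hn : 2 ≤ n) (c : CongName n) {x y : PartitionMonoid n} :
    c.toCon hn x y ↔ c.toRel x y := by
  cases c with
  | R q hq => exact Iff.rfl
  | RN q h2 hq N hN hne => exact inCon_rel hq (by omega) hN
  | lam C => exact (lamRel_iff hn C).symm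
  | rho C => exact (rhoRel_iff hn C).symm
  | mu C => exact (muRel_iff hn C).symm

end PartitionMonoid

/-! ### What a single pair forces into a congruence -/

namespace PartitionMonoid

open SemigroupCong

variable {n : ℕ}

/-- The reflection of a congruence. -/
def conFlip (θ : Con (PartitionMonoid n)) : Con (PartitionMonoid n) where
  r x y := θ (flip x) (flip y)
  iseqv := ⟨fun _ => θ.refl _, fun h => θ.symm h, fun h h' => θ.trans h h'⟩
  mul' h h' := by
    rw [flip_mul, flip_mul]
    exact θ.mul h' h

theorem conFlip_rel {θ : Con (PartitionMonoid n)} {x y} :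
    conFlip θ x y ↔ θ (flip x) (flip y) := Iff.rfl

theorem rel_mul_mul {θ : Con (PartitionMonoid n)} {x y : PartitionMonoid n} (h : θ x y)
    (s t : PartitionMonoid n) : θ (s * x * t) (s * y * t) :=
  θ.mul (θ.mul (θ.refl s) h) (θ.refl t)

theorem rel_mul_left {θ : Con (PartitionMonoid n)} {x y : PartitionMonoid n} (h : θ x y)
    (s : PartitionMonoid n) : θ (s * x) (s * y) := θ.mul (θ.refl s) h

theorem rel_mul_right {θ : Con (PartitionMonoid n)} {x y : PartitionMonoid n} (h : θ x y)
    (t : PartitionMonoid n) : θ (x * t) (y * t) := θ.mul h (θ.refl t)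

/-! #### Pairs in the minimal ideal -/

/-- The congruence `θ` relates two elements of the minimal ideal with different upper kernels. -/
def SeparatesUker (θ : Con (PartitionMonoid n)) : Prop :=
  ∃ x y, θ x y ∧ x.rank = 0 ∧ y.rank = 0 ∧ uker x ≠ uker y

/-- The congruence `θ` relates two elements of the minimal ideal with different lower kernels. -/
def SeparatesLker (θ : Con (PartitionMonoid n)) : Prop :=
  ∃ x y, θ x y ∧ x.rank = 0 ∧ y.rank = 0 ∧ lker x ≠ lker y

theorem separatesUker_conFlip {θ : Con (PartitionMonoid n)} :
    SeparatesUker (conFlip θ) ↔ SeparatesLker θ := by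
  constructor
  · rintro ⟨x, y, h, hx, hy, hne⟩
    exact ⟨flip x, flip y, h, by rwa [rank_flip], by rwa [rank_flip], hne⟩
  · rintro ⟨x, y, h, hx, hy, hne⟩
    refine ⟨flip x, flip y, ?_, by rwa [rank_flip], by rwa [rank_flip], hne⟩
    rw [conFlip_rel, flip_flip, flip_flip]
    exact h

/-- A congruence that relates some two partitions of rank `0` with different upper kernels does not
see the upper kernel on the minimal ideal: every upper kernel other than the universal one is
related to a strictly coarser one, hence, repeating this, to the universal one. -/
theorem rel_of_lker_eq {θ : Con (PartitionMonoid n)} (hθ : SeparatesUker θ)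
    {a b : PartitionMonoid n} (ha : a.rank = 0) (hb : b.rank = 0) (hab : lker a = lker b) :
    θ a b := by
  classical
  obtain ⟨v, w, hvw, i, j, hv, hw⟩ : ∃ v w : Setoid (Fin n),
      (∀ l, θ (ofKer v l) (ofKer w l)) ∧ ∃ i j, v i j ∧ ¬ w i j := by
    obtain ⟨x, y, h, hx, hy, hne⟩ := hθ
    have h1 : ∀ l, θ (ofKer (uker x) l) (ofKer (uker y) l) := fun l => by
      have := rel_mul_right h (ofKer ⊥ l)
      rwa [mul_eq_of_rank_zero hx (rank_ofKer _ _), mul_eq_of_rank_zero hy (rank_ofKer _ _),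
        lker_ofKer] at this
    by_contra hno
    push Not at hno
    apply hne
    apply le_antisymm
    · intro i j hij; exact hno _ _ h1 i j hij
    · intro i j hij; exact hno _ _ (fun l => θ.symm (h1 l)) i j hij
  have key : ∀ p : Setoid (Fin n), p ≠ ⊤ → ∃ p' > p, ∀ l, θ (ofKer p l) (ofKer p' l) := by
    intro p hp
    obtain ⟨c, d, hcd⟩ : ∃ c d, ¬ p c d := by
      by_contra hno
      push Not at hno
      exact hp (top_le_iff.1 fun c d _ => hno c d)
    -- attach the `w`-class of `i` to the class of `c` and all other vertices to that of `d`
    let g : Fin n → Quotient p := fun k => if w i k then Quotient.mk p c else Quotient.mk p d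
    let s : PartitionMonoid n := ⟨Setoid.ker (Sum.elim (Quotient.mk p) g)⟩
    have hsl : ∀ a b, s.rel (Sum.inl a) (Sum.inl b) ↔ p a b := fun a b =>
      ⟨fun h => Quotient.exact (s := p) h, fun h => Quotient.sound (s := p) h⟩
    have hus : uker s = p := Setoid.ext fun a b => hsl a b
    have hslr : ∀ a k, g k = Quotient.mk p a → s.rel (Sum.inl a) (Sum.inr k) :=
      fun a k h => h.symm
    have hsw : ∀ l, s * ofKer w l = ofKer p l := by
      intro l
      refine eq_of_rank_zero (rank_mul_eq_zero_right (rank_ofKer _ _) _) (rank_ofKer _ _) ?_ ?_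
      · rw [uker_ofKer, uker_mul, uker_ofKer]
        have hle : w.map Sum.inr ≤ s.rel := map_le_iff.2 fun k k' hkk' => by
          change g k = g k'
          have : w i k ↔ w i k' := ⟨fun h => w.trans' h hkk', fun h => w.trans' h (w.symm' hkk')⟩
          simp only [g, this]
        rw [sup_eq_left.2 hle]
        exact hus
      · rw [lker_mul_of_rank_le_one (by simp), lker_ofKer, lker_ofKer]
    have hsv : ∀ l, s * ofKer v l = ofKer (uker (s * ofKer v ⊥)) l := by
      intro l
      refine eq_of_rank_zero (rank_mul_eq_zero_right (rank_ofKer _ _) _) (rank_ofKer _ _) ?_ ?_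
      · rw [uker_ofKer]; exact uker_mul_congr s (by simp)
      · rw [lker_mul_of_rank_le_one (by simp), lker_ofKer, lker_ofKer]
    refine ⟨uker (s * ofKer v ⊥), lt_of_le_of_ne ?_ ?_, fun l => ?_⟩
    · rw [← hus]
      conv_lhs => rw [hus]
      exact hus ▸ uker_le_uker_mul s _
    · intro heq
      apply hcd
      rw [heq]
      have h1 : productGraph s (ofKer v ⊥) (.upper c) (.middle i) :=
        productGraph_top (x := Sum.inl c) (y := Sum.inr i) (hslr c i (if_pos (w.refl' i)))
      have h2 : productGraph s (ofKer v ⊥) (.upper d) (.middle j) :=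
        productGraph_top (x := Sum.inl d) (y := Sum.inr j) (hslr d j (if_neg hw))
      have h3 : productGraph s (ofKer v ⊥) (.middle i) (.middle j) :=
        productGraph_bot (x := Sum.inl i) (y := Sum.inl j)
          (show uker (ofKer v ⊥) i j by rwa [uker_ofKer])
      exact Setoid.trans' (productGraph _ _) h1
        (Setoid.trans' (productGraph _ _) h3 (Setoid.symm' (productGraph _ _) h2))
    · rw [← hsw, ← hsv]
      exact rel_mul_left (θ.symm (hvw l)) s
  have : Finite (Setoid (Fin n)) :=
    Finite.of_injective (fun p : Setoid (Fin n) => fun x y => p x y)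
      fun p q h => Setoid.ext fun x y => iff_of_eq (congrFun (congrFun h x) y)
  have htop : ∀ p : Setoid (Fin n), ∀ l, θ (ofKer p l) (ofKer ⊤ l) := by
    intro p
    induction p using WellFoundedGT.induction with
    | ind p ih =>
      intro l
      by_cases hp : p = ⊤
      · rw [hp]; exact θ.refl _
      · obtain ⟨p', hp', h⟩ := key p hp
        exact θ.trans (h l) (ih p' hp' l)
  rw [← hat_eq_self ha, ← hat_eq_self hb, hat, hat, hab]
  exact θ.trans (htop _ _) (θ.symm (htop _ _))

theorem rel_of_uker_eq {θ : Con (PartitionMonoid n)} (hθ : SeparatesLker θ)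
    {a b : PartitionMonoid n} (ha : a.rank = 0) (hb : b.rank = 0) (hab : uker a = uker b) :
    θ a b := by
  have := rel_of_lker_eq (separatesUker_conFlip.2 hθ) (a := flip a) (b := flip b)
    (by rwa [rank_flip]) (by rwa [rank_flip]) hab
  rwa [conFlip_rel, flip_flip, flip_flip] at this

/-! #### Pairs of different rank -/

/-- The congruence `θ` relates a partition of rank `q` to one of smaller rank. -/
def DropsRank (θ : Con (PartitionMonoid n)) (q : ℕ) : Prop :=
  ∃ x y, θ x y ∧ x.rank = q ∧ y.rank < q

theorem DropsRank.le {θ : Con (PartitionMonoid n)} {q : ℕ} (h : DropsRank θ q) : q ≤ n := by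
  obtain ⟨x, -, -, rfl, -⟩ := h
  exact rank_le x

theorem DropsRank.exists_eps {θ : Con (PartitionMonoid n)} {q : ℕ} (h : DropsRank θ q) :
    ∃ b, θ (eps n q) b ∧ b.rank < q := by
  obtain ⟨x, y, hxy, hx, hy⟩ := h
  obtain ⟨s, t, h1, -⟩ := exists_eps_eq hx
  exact ⟨s * y * t, h1 ▸ rel_mul_mul hxy s t, (rank_mul_mul_le s y t).trans_lt hy⟩

theorem uker_eps (n q : ℕ) : uker (eps n q) = ⊥ :=
  Setoid.ext fun _ _ => bar_rel_inl_inl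

theorem lker_eps (n q : ℕ) : lker (eps n q) = ⊥ :=
  Setoid.ext fun _ _ => bar_rel_inr_inr

theorem uker_eps_one_mul (hn : 1 ≤ n) (a : PartitionMonoid n) : uker (eps n 1 * a) = ⊥ := by
  refine Setoid.ext fun i j => (eps_mul_rel_inl_inl hn).trans ⟨?_, Or.inl⟩
  rintro (h | ⟨hi, hj, -⟩)
  · exact h
  · exact Fin.ext (by omega)

theorem lker_mul_eps_one (hn : 1 ≤ n) (a : PartitionMonoid n) : lker (a * eps n 1) = ⊥ := by
  rw [← uker_flip, flip_mul, flip_eps]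
  exact uker_eps_one_mul hn _

/-- If a partition of rank `1` is related to one of rank `0`, then all transversals of partitions
of rank `1` can be split. -/
theorem DropsRank.rel_hat {θ : Con (PartitionMonoid n)} (h : DropsRank θ 1)
    {z : PartitionMonoid n} (hz : z.rank ≤ 1) : θ z (hat z) := by
  rcases Nat.le_one_iff_eq_zero_or_eq_one.1 hz with hz | hz'
  · rw [hat_eq_self hz]; exact θ.refl z
  have hn := h.le
  obtain ⟨b, hb, hb0⟩ := h.exists_eps
  obtain ⟨O, hO⟩ : ∃ O, O = eps n 1 * b * eps n 1 := ⟨_, rfl⟩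
  have h1 : θ (eps n 1) O := by
    have := rel_mul_mul hb (eps n 1) (eps n 1)
    rwa [eps_mul_eps hn, eps_mul_eps hn, ← hO] at this
  have hO0 : O.rank = 0 := by
    have := rank_mul_mul_le (eps n 1) b (eps n 1)
    rw [← hO] at this
    omega
  have hOu : uker O = ⊥ := by rw [hO, mul_assoc]; exact uker_eps_one_mul hn _
  have hOl : lker O = ⊥ := by rw [hO]; exact lker_mul_eps_one hn _
  obtain ⟨s, t, -, h2⟩ := exists_eps_eq hz'
  set p := z * t
  set r := s * z
  have h3 : θ z (p * O * r) := by
    have := rel_mul_mul h1 p r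
    rwa [← h2] at this
  have hpe : (p * eps n 1).rank ≤ 1 := (rank_mul_le_right _ _).trans (rank_bar hn _).le
  have her : (eps n 1 * r).rank ≤ 1 := (rank_mul_le_left _ _).trans (rank_bar hn _).le
  have h4 : p * O * r = hat z := by
    refine eq_of_rank_zero (rank_mul_eq_zero_left (rank_mul_eq_zero_right hO0 p) r) (rank_hat z)
      ?_ ?_
    · rw [uker_mul_of_rank_le_one ((rank_mul_eq_zero_right hO0 p).le.trans zero_le_one), uker_hat,
        h2, uker_mul_of_rank_le_one hpe]
      exact uker_mul_congr p (by rw [hOu, uker_eps])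
    · rw [mul_assoc p O r,
        lker_mul_of_rank_le_one ((rank_mul_eq_zero_left hO0 r).le.trans zero_le_one),
        lker_hat, h2, mul_assoc p, lker_mul_of_rank_le_one her]
      exact lker_mul_congr r (by rw [hOl, lker_eps])
  rwa [h4] at h3

/-- The partial identity on a set of vertices. -/
def restr (A : Finset (Fin n)) : PartitionMonoid n := pull fun i => if i ∈ A then some i else none

section restr

variable (A : Finset (Fin n))

theorem restr_fun_eq_some {A : Finset (Fin n)} {i c : Fin n} :
    (if i ∈ A then some i else none) = some c ↔ i ∈ A ∧ i = c := by
  split_ifs with h <;> simp [h]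

theorem restr_rel_inl_inl {i j} : (restr A).rel (Sum.inl i) (Sum.inl j) ↔ i = j := by
  refine (pull_rel_inl_inl _).trans ?_
  simp only [restr_fun_eq_some]
  exact ⟨by rintro (h | ⟨c, ⟨_, h⟩, _, h'⟩); exacts [h, h.trans h'.symm], Or.inl⟩

theorem restr_rel_inl_inr {i k} : (restr A).rel (Sum.inl i) (Sum.inr k) ↔ i ∈ A ∧ i = k :=
  (pull_rel_inl_inr _).trans restr_fun_eq_some

theorem restr_rel_inr_inr {k l} : (restr A).rel (Sum.inr k) (Sum.inr l) ↔ k = l :=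
  pull_rel_inr_inr _

theorem restr_mul_rel_inl_inl {a : PartitionMonoid n} {i j} :
    (restr A * a).rel (Sum.inl i) (Sum.inl j) ↔
      i = j ∨ (i ∈ A ∧ j ∈ A ∧ a.rel (Sum.inl i) (Sum.inl j)) := by
  refine (pull_mul_rel_inl_inl _ a).trans (or_congr_right ?_)
  simp only [restr_fun_eq_some]
  constructor
  · rintro ⟨_, _, ⟨hi, rfl⟩, ⟨hj, rfl⟩, h⟩; exact ⟨hi, hj, h⟩
  · rintro ⟨hi, hj, h⟩; exact ⟨_, _, ⟨hi, rfl⟩, ⟨hj, rfl⟩, h⟩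

theorem restr_mul_rel_inl_inr {a : PartitionMonoid n} {i k} :
    (restr A * a).rel (Sum.inl i) (Sum.inr k) ↔ i ∈ A ∧ a.rel (Sum.inl i) (Sum.inr k) := by
  refine (pull_mul_rel_inl_inr _ a).trans ?_
  simp only [restr_fun_eq_some]
  constructor
  · rintro ⟨_, ⟨hi, rfl⟩, h⟩; exact ⟨hi, h⟩
  · rintro ⟨hi, h⟩; exact ⟨_, ⟨hi, rfl⟩, h⟩

theorem restr_mul_rel_inr_inr {a : PartitionMonoid n} {k l} :
    (restr A * a).rel (Sum.inr k) (Sum.inr l) ↔ a.rel (Sum.inr k) (Sum.inr l) :=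
  pull_mul_rel_inr_inr _ a

theorem flip_restr : flip (restr A) = restr A := by
  refine ext_iff'.2 ⟨fun i j => ?_, fun i j => ?_, fun i j => ?_⟩
  · rw [restr_rel_inl_inl]; exact restr_rel_inr_inr A
  · rw [flip_rel, Setoid.comm', restr_rel_inl_inr]
    refine (restr_rel_inl_inr A).trans ⟨?_, ?_⟩ <;> (rintro ⟨h, rfl⟩; exact ⟨h, rfl⟩)
  · rw [restr_rel_inr_inr]; exact restr_rel_inl_inl A

theorem mul_restr_rel_inl_inr {a : PartitionMonoid n} {i k}
    (h : (a * restr A).rel (Sum.inl i) (Sum.inr k)) : k ∈ A ∧ a.rel (Sum.inl i) (Sum.inr k) := by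
  rw [← flip_flip (a * restr A), flip_mul, flip_restr, flip_rel, Setoid.comm'] at h
  have := (restr_mul_rel_inl_inr A).1 h
  exact ⟨this.1, a.rel.symm' this.2⟩

theorem restr_mul_restr (B : Finset (Fin n)) : restr A * restr B = restr (A ∩ B) := by
  refine ext_iff'.2 ⟨fun i j => ?_, fun i j => ?_, fun i j => ?_⟩
  · rw [restr_mul_rel_inl_inl, restr_rel_inl_inl, restr_rel_inl_inl]; tauto
  · rw [restr_mul_rel_inl_inr, restr_rel_inl_inr, restr_rel_inl_inr, Finset.mem_inter, and_assoc]
  · rw [restr_mul_rel_inr_inr, restr_rel_inr_inr, restr_rel_inr_inr]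

theorem rank_restr : (restr A).rank = A.card := by
  apply le_antisymm
  · refine rank_le_of_dom A ?_
    rintro i ⟨k, hk⟩
    exact ((restr_rel_inl_inr A).1 hk).1
  · refine le_rank_iff.2 ⟨fun i => A.equivFin.symm i, fun i => A.equivFin.symm i, fun i j => ?_⟩
    rw [restr_rel_inl_inr]
    constructor
    · rintro ⟨-, h⟩
      exact A.equivFin.symm.injective (Subtype.ext h)
    · rintro rfl
      exact ⟨(A.equivFin.symm i).2, rfl⟩

end restr

/-- The first `q` vertices. -/
def initial (n q : ℕ) : Finset (Fin n) := Finset.univ.filter fun i => i.val < q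

theorem mem_initial {q : ℕ} {i : Fin n} : i ∈ initial n q ↔ i.val < q := by simp [initial]

theorem eps_eq_restr (q : ℕ) : eps n q = restr (initial n q) := by
  refine ext_iff'.2 ⟨fun i j => ?_, fun i j => ?_, fun i j => ?_⟩
  · rw [bar_rel_inl_inl, restr_rel_inl_inl]
  · rw [eps_rel_inl_inr, restr_rel_inl_inr, mem_initial, and_comm]
  · rw [bar_rel_inr_inr, restr_rel_inr_inr]

theorem card_initial {q : ℕ} (hq : q ≤ n) : (initial n q).card = q := by
  rw [← rank_restr, ← eps_eq_restr, rank_bar hq]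

theorem restr_mul_eps {A : Finset (Fin n)} {q : ℕ} (h : A ⊆ initial n q) :
    restr A * eps n q = restr A := by
  rw [eps_eq_restr, restr_mul_restr, Finset.inter_eq_left.2 h]

theorem eps_mul_restr {A : Finset (Fin n)} {q : ℕ} (h : A ⊆ initial n q) :
    eps n q * restr A = restr A := by
  rw [eps_eq_restr, restr_mul_restr, Finset.inter_eq_right.2 h]

/-- A rank drop propagates downwards. Let `eps n (q + 1)` be related to `b` of smaller rank, and
restrict it to two different `q`-element sets. If neither restriction drops the rank, then
restricting `b` to one set on the left and to the other on the right keeps its rank `q`, whereas the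
product of the two restrictions has smaller rank. -/
theorem DropsRank.pred {θ : Con (PartitionMonoid n)} {q : ℕ} (hq : 1 ≤ q)
    (h : DropsRank θ (q + 1)) : DropsRank θ q := by
  have hn := h.le
  obtain ⟨b, hb, hbr⟩ := h.exists_eps
  set A := (initial n (q + 1)).erase ⟨0, by omega⟩ with hA
  set B := (initial n (q + 1)).erase ⟨1, by omega⟩ with hB
  have h0 : (⟨0, by omega⟩ : Fin n) ∈ initial n (q + 1) := mem_initial.2 (Nat.succ_pos q)
  have h1 : (⟨1, by omega⟩ : Fin n) ∈ initial n (q + 1) := mem_initial.2 (by simp only; omega)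
  have hAc : A.card = q := by rw [hA, Finset.card_erase_of_mem h0, card_initial hn]; rfl
  have hBc : B.card = q := by rw [hB, Finset.card_erase_of_mem h1, card_initial hn]; rfl
  have hABc : (A ∩ B).card < q := by
    rw [← hAc]
    refine Finset.card_lt_card (Finset.ssubset_iff_subset_ne.2 ⟨Finset.inter_subset_left, ?_⟩)
    intro heq
    have : (⟨1, by omega⟩ : Fin n) ∈ A ∩ B := by
      rw [heq, hA]; exact Finset.mem_erase.2 ⟨by simp, h1⟩
    simp [hB] at this
  have hAθ : θ (restr A) (restr A * b) := by
    have := rel_mul_left hb (restr A)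
    rwa [restr_mul_eps (Finset.erase_subset _ _)] at this
  have hBθ : θ (restr B) (b * restr B) := by
    have := rel_mul_right hb (restr B)
    rwa [eps_mul_restr (Finset.erase_subset _ _)] at this
  by_cases hAb : (restr A * b).rank < q
  · exact ⟨_, _, hAθ, by rw [rank_restr, hAc], hAb⟩
  by_cases hbB : (b * restr B).rank < q
  · exact ⟨_, _, hBθ, by rw [rank_restr, hBc], hbB⟩
  have hle := rank_mul_le_right (restr A) b
  have hle' := rank_mul_le_left b (restr B)
  -- by stability `restr A * b` generates the same left ideal as `b`
  have hJ : GreenJ (restr A * b) b := greenJ_iff_rank.2 (by omega)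
  have hL := ((stableJClass b) b rfl (restr A)).2 hJ
  obtain ⟨-, w, hw⟩ := greenL_iff.1 hL
  refine ⟨restr A * b * restr B, restr A * restr B, ?_, ?_, by rwa [restr_mul_restr, rank_restr]⟩
  · exact θ.symm (rel_mul_right hAθ (restr B))
  · apply le_antisymm
    · have := rank_mul_le_left (restr A * b) (restr B)
      omega
    · have : b * restr B = w * (restr A * b * restr B) := by
        rw [← mul_assoc, ← hw]
      have := this ▸ rank_mul_le_right w (restr A * b * restr B)
      omega

theorem rel_of_rank_le_one {θ : Con (PartitionMonoid n)} (h1 : DropsRank θ 1)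
    (hu : SeparatesUker θ) (hl : SeparatesLker θ) {a b : PartitionMonoid n} (ha : a.rank ≤ 1)
    (hb : b.rank ≤ 1) : θ a b := by
  refine θ.trans (h1.rel_hat ha) (θ.trans ?_ (θ.symm (h1.rel_hat hb)))
  exact θ.trans (rel_of_lker_eq hu (rank_hat a) (rank_ofKer (uker b) (lker a)) (by simp))
    (rel_of_uker_eq hl (rank_ofKer _ _) (rank_hat b) (by simp))

/-- The idempotent of rank `2` is related to some `hat b` of rank `0`. Left multiplication by
`hat b` gives a fixed upper kernel on the minimal ideal, but left multiplication by the idempotent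
does not. -/
theorem DropsRank.separatesUker {θ : Con (PartitionMonoid n)} (h : DropsRank θ 2) :
    SeparatesUker θ := by
  have hn := h.le
  obtain ⟨b, hb, hbr⟩ := h.exists_eps
  have h1 : DropsRank θ 1 := h.pred le_rfl
  have hc := θ.trans hb (h1.rel_hat (show b.rank ≤ 1 by omega))
  obtain ⟨z, w, hz, hw, hne⟩ := exists_uker_eps_mul_ne le_rfl hn
  by_contra hno
  have key : ∀ z : PartitionMonoid n, z.rank = 0 → uker (eps n 2 * z) = uker (hat b) := by
    intro z hz
    by_contra hne
    refine hno ⟨_, _, rel_mul_right hc z, rank_mul_eq_zero_right hz _,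
      rank_mul_eq_zero_right hz _, ?_⟩
    rwa [uker_mul_of_rank_le_one (a := hat b) (by simp)]
  exact hne ((key z hz).trans (key w hw).symm)

theorem DropsRank.reflect {θ : Con (PartitionMonoid n)} {q : ℕ} (h : DropsRank θ q) :
    DropsRank (conFlip θ) q := by
  obtain ⟨x, y, hxy, hx, hy⟩ := h
  refine ⟨flip x, flip y, ?_, by rwa [rank_flip], by rwa [rank_flip]⟩
  rw [conFlip_rel, flip_flip, flip_flip]
  exact hxy

theorem DropsRank.separatesLker {θ : Con (PartitionMonoid n)} (h : DropsRank θ 2) :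
    SeparatesLker θ := separatesUker_conFlip.1 h.reflect.separatesUker

/-- If a partition of rank `q ≥ 2` is related to one of smaller rank, then all partitions of rank at
most `q` are related. -/
theorem DropsRank.rel {θ : Con (PartitionMonoid n)} {q : ℕ} (hq : 2 ≤ q) (h : DropsRank θ q)
    {a b : PartitionMonoid n} (ha : a.rank ≤ q) (hb : b.rank ≤ q) : θ a b := by
  induction q, hq using Nat.le_induction generalizing a b with
  | base =>
    have h1 : DropsRank θ 1 := h.pred le_rfl
    obtain ⟨c, hc, hcr⟩ := h.exists_eps
    have key : ∀ a : PartitionMonoid n, a.rank ≤ 2 → ∃ a', θ a a' ∧ a'.rank ≤ 1 := by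
      intro a ha
      rcases Nat.lt_or_ge a.rank 2 with ha' | ha'
      · exact ⟨a, θ.refl a, by omega⟩
      · obtain ⟨s, t, -, h2⟩ := exists_eps_eq (le_antisymm ha ha')
        refine ⟨a * t * c * (s * a), ?_, by have := rank_mul_mul_le (a * t) c (s * a); omega⟩
        have := rel_mul_mul hc (a * t) (s * a)
        rwa [← h2] at this
    obtain ⟨a', h2, h3⟩ := key a ha
    obtain ⟨b', h4, h5⟩ := key b hb
    exact θ.trans h2 (θ.trans (rel_of_rank_le_one h1 h.separatesUker h.separatesLker h3 h5)
      (θ.symm h4))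
  | succ q hq ih =>
    obtain ⟨c, hc, hcr⟩ := h.exists_eps
    have key : ∀ a : PartitionMonoid n, a.rank ≤ q + 1 → ∃ a', θ a a' ∧ a'.rank ≤ q := by
      intro a ha
      rcases Nat.lt_or_ge a.rank (q + 1) with ha' | ha'
      · exact ⟨a, θ.refl a, by omega⟩
      · obtain ⟨s, t, -, h2⟩ := exists_eps_eq (le_antisymm ha ha')
        refine ⟨a * t * c * (s * a), ?_, by have := rank_mul_mul_le (a * t) c (s * a); omega⟩
        have := rel_mul_mul hc (a * t) (s * a)
        rwa [← h2] at this
    obtain ⟨a', h2, h3⟩ := key a ha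
    obtain ⟨b', h4, h5⟩ := key b hb
    exact θ.trans h2 (θ.trans (ih (h.pred (by omega)) h3 h5) (θ.symm h4))

end PartitionMonoid

/-! ### Separating partitions of equal rank -/

namespace PartitionMonoid

open SemigroupCong

variable {n : ℕ}

/-- Systems of representatives of the transversals are detected by a rank. -/
theorem exists_isTransversalSystem_iff {a : PartitionMonoid n} {q : ℕ} (u : Fin q → Fin n) :
    (∃ v, IsTransversalSystem a u v) ↔ q ≤ (sel u * a).rank := by
  constructor
  · rintro ⟨v, h⟩
    have hq : q ≤ n := (le_rank_iff.2 ⟨u, v, h⟩).trans (rank_le a)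
    have h1 := rank_mul_le_left (sel u * a) (flip (sel v))
    rwa [h.sel_mul_mul, rank_bar hq] at h1
  · intro h
    obtain ⟨u', v', h'⟩ := le_rank_iff.1 h
    have h1 : ∀ i, ∃ m : Fin q, (u' i).val = m := fun i => by
      obtain ⟨m, hm, -⟩ := (sel_mul_rel_inl_inr u a).1 ((h' i i).2 rfl)
      exact ⟨m, hm⟩
    choose m hm using h1
    have hrel : ∀ i j, a.rel (Sum.inl (u (m i))) (Sum.inr (v' j)) ↔ i = j := fun i j => by
      rw [← h' i j, sel_mul_rel_inl_inr]
      constructor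
      · intro h; exact ⟨m i, hm i, h⟩
      · rintro ⟨k, hk, h⟩
        have : m i = k := Fin.ext ((hm i).symm.trans hk)
        rwa [this]
    have hinj : Function.Injective m := fun i j hij =>
      (hrel i j).1 (hij ▸ (hrel j j).2 rfl)
    have hbij := Finite.injective_iff_bijective.1 hinj
    let e := Equiv.ofBijective m hbij
    refine ⟨fun j => v' (e.symm j), fun i j => ?_⟩
    have hi : i = m (e.symm i) := (e.apply_symm_apply i).symm
    have := hrel (e.symm i) (e.symm j)
    rw [← hi] at this
    rw [this, e.symm.injective.eq_iff]

theorem IsTransversalSystem.update {a : PartitionMonoid n} {q : ℕ} {u v : Fin q → Fin n}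
    (h : IsTransversalSystem a u v) {m : Fin q} {i : Fin n}
    (hi : a.rel (Sum.inl i) (Sum.inl (u m))) :
    IsTransversalSystem a (Function.update u m i) v := by
  intro k l
  by_cases hk : k = m
  · subst hk
    rw [Function.update_self, ← h k l]
    exact ⟨fun h' => a.rel.trans' (a.rel.symm' hi) h', fun h' => a.rel.trans' hi h'⟩
  · rw [Function.update_of_ne hk]
    exact h k l

/-- The partition that merges the blocks of the vertices `j` and `k` when multiplied on the left. -/
def merge (j k : Fin n) : PartitionMonoid n :=
  ⟨Setoid.ker (Sum.elim (Function.update id k j) (Function.update id k j))⟩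

section merge

variable (j k : Fin n) (a : PartitionMonoid n)

theorem productGraph_merge (x : Fin n ⊕ Fin n) :
    productGraph (merge j k) a (outer x) (bot x) := by
  rcases x with i | i
  · exact productGraph_top (x := Sum.inl i) (y := Sum.inr i) rfl
  · exact Setoid.refl' _ _

theorem rel_merge_mul_of_rel {x y : Fin n ⊕ Fin n} (h : a.rel x y) :
    (merge j k * a).rel x y :=
  mul_rel_iff.2 (Setoid.trans' (productGraph _ _) (productGraph_merge j k a x)
    (Setoid.trans' (productGraph _ _) (productGraph_bot h)
      (Setoid.symm' (productGraph _ _) (productGraph_merge j k a y))))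

theorem rel_merge_mul_self : (merge j k * a).rel (Sum.inl j) (Sum.inl k) := by
  refine productGraph_top (x := Sum.inl j) (y := Sum.inl k) ?_
  change Function.update id k j j = Function.update id k j k
  rw [Function.update_self]
  by_cases h : j = k
  · rw [h, Function.update_self]
  · rw [Function.update_of_ne h, id]

theorem rel_or_of_rel_merge_mul {x y : Fin n ⊕ Fin n} (h : (merge j k * a).rel x y) :
    a.rel x y ∨ ((a.rel x (Sum.inl j) ∨ a.rel x (Sum.inl k)) ∧
      (a.rel y (Sum.inl j) ∨ a.rel y (Sum.inl k))) := by
  classical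
  let c : Fin n ⊕ Fin n → Quotient a.rel := Quotient.mk _
  let ψ : Quotient a.rel → Quotient a.rel := fun z => if z = c (Sum.inl k) then c (Sum.inl j) else z
  let φ : Vertex n → Quotient a.rel
    | .upper i => ψ (c (Sum.inl i))
    | .middle i => ψ (c (Sum.inl i))
    | .lower i => ψ (c (Sum.inr i))
  have hψ : ∀ i i' : Fin n, Function.update id k j i = Function.update id k j i' →
      ψ (c (Sum.inl i)) = ψ (c (Sum.inl i')) := by
    have h1 : ∀ i, ψ (c (Sum.inl (Function.update id k j i))) = ψ (c (Sum.inl i)) := by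
      intro i
      by_cases hi : i = k
      · rw [hi, Function.update_self]
        simp only [ψ, if_true]
        split_ifs <;> rfl
      · rw [Function.update_of_ne hi, id]
    intro i i' hii
    rw [← h1 i, ← h1 i', hii]
  have hφ : ∀ x, φ (outer x) = ψ (c x) := by rintro (i | i) <;> rfl
  have := eq_of_mul_rel φ (a := merge j k) (b := a) ?_ ?_ h
  · rw [hφ, hφ] at this
    simp only [ψ] at this
    split_ifs at this with h1 h2 h2
    · exact Or.inl (Quotient.exact (h1.trans h2.symm))
    · exact Or.inr ⟨Or.inr (Quotient.exact h1), Or.inl (Quotient.exact this.symm)⟩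
    · exact Or.inr ⟨Or.inl (Quotient.exact this), Or.inr (Quotient.exact h2)⟩
    · exact Or.inl (Quotient.exact this)
  · rintro (i | i) (i' | i') h <;> exact hψ i i' h
  · rintro (i | i) (i' | i') h <;> exact congrArg ψ (Quotient.sound h)

end merge

/-- If every left multiplication that keeps the rank `q` of `x` gives rank at least `q` on `y`, then
the transversals of `y` cover all upper vertices in transversals of `x`, and `y` joins two of these
vertices only if `x` does. -/
theorem dom_iff_of_rank_mul_iff {x y : PartitionMonoid n} {q : ℕ} (hx : x.rank = q)
    (H : ∀ g : PartitionMonoid n, q ≤ (g * x).rank → q ≤ (g * y).rank) :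
    (∀ i, dom x i → dom y i) ∧ ∀ i j, dom x i → dom x j →
      y.rel (Sum.inl i) (Sum.inl j) → x.rel (Sum.inl i) (Sum.inl j) := by
  have hsys : ∀ u : Fin q → Fin n, (∃ v, IsTransversalSystem x u v) →
      ∃ v, IsTransversalSystem y u v := fun u hu =>
    (exists_isTransversalSystem_iff u).2 (H _ ((exists_isTransversalSystem_iff u).1 hu))
  have hthrough : ∀ i, dom x i → ∃ (u v : Fin q → Fin n) (m : Fin q),
      IsTransversalSystem x u v ∧ u m = i := fun i hi => by
    obtain ⟨u, v, h⟩ := le_rank_iff.1 hx.ge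
    obtain ⟨m, hm⟩ := h.exists_of_dom hx hi
    exact ⟨_, v, m, h.update hm, Function.update_self _ _ _⟩
  constructor
  · intro i hi
    obtain ⟨u, v, m, h, rfl⟩ := hthrough i hi
    obtain ⟨v', h'⟩ := hsys u ⟨v, h⟩
    exact ⟨v' m, (h' m m).2 rfl⟩
  · intro i j hi hj hy
    by_contra hno
    obtain ⟨u, v, m, h, rfl⟩ := hthrough i hi
    obtain ⟨k, hk⟩ := h.exists_of_dom hx hj
    have hkm : m ≠ k := by
      rintro rfl
      exact hno (x.rel.symm' hk)
    obtain ⟨v', h'⟩ := hsys _ ⟨v, h.update hk⟩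
    apply hkm
    apply h'.left_rel
    rwa [Function.update_self, Function.update_of_ne hkm]

/-- Partitions of equal rank with the same upper kernel are `R`-related if the systems of upper
representatives of the transversals of one also serve for the other: with the lower row cut down to
representatives, the two partitions agree. -/
theorem greenR_of_pattern {x y : PartitionMonoid n} {q : ℕ} (hx : x.rank = q) (hy : y.rank = q)
    (hker : ∀ i j, x.rel (Sum.inl i) (Sum.inl j) ↔ y.rel (Sum.inl i) (Sum.inl j))
    (hsys : ∀ u : Fin q → Fin n, (∃ v, IsTransversalSystem x u v) →
      ∃ v, IsTransversalSystem y u v) : GreenR x y := by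
  obtain ⟨u, v, h⟩ := le_rank_iff.1 hx.ge
  obtain ⟨v', h'⟩ := hsys u ⟨v, h⟩
  have hmem : ∀ {z : PartitionMonoid n} {w : Fin q → Fin n}, IsTransversalSystem z u w →
      ∀ i m, z.rel (Sum.inl i) (Sum.inr (w m)) ↔ z.rel (Sum.inl i) (Sum.inl (u m)) :=
    fun {z w} hz i m =>
    ⟨fun hh => z.rel.trans' hh (z.rel.symm' ((hz m m).2 rfl)),
      fun hh => z.rel.trans' hh ((hz m m).2 rfl)⟩
  have heq : x * flip (sel v) = y * flip (sel v') := by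
    refine ext_iff'.2 ⟨fun i j => ?_, fun i j => ?_, fun i j => ?_⟩
    · rw [mul_flip_sel_rel_inl_inl, mul_flip_sel_rel_inl_inl, hker]
    · rw [mul_flip_sel_rel_inl_inr, mul_flip_sel_rel_inl_inr]
      refine exists_congr fun m => and_congr_right fun _ => ?_
      rw [hmem h, hmem h', hker]
    · rw [mul_flip_sel_rel_inr_inr, mul_flip_sel_rel_inr_inr]
      refine or_congr_right (exists_congr fun m => exists_congr fun k =>
        and_congr_right fun _ => and_congr_right fun _ => ?_)
      constructor
      · intro hh
        rw [h.symm.left_rel (i := m) (j := k) hh]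
      · intro hh
        rw [h'.symm.left_rel (i := m) (j := k) hh]
  refine greenR_iff.2 ⟨⟨flip (sel v') * (sel u * x), ?_⟩, flip (sel v) * (sel u * y), ?_⟩
  · rw [← mul_assoc, ← heq, h.mul_mul_eq hx]
  · rw [← mul_assoc, heq, h'.mul_mul_eq hy]

/-- Partitions of equal positive rank that are not `R`-related can be separated by a left
multiplication that lowers the rank of exactly one of them. If the transversals agree, then a
non-transversal upper block of one of them is merged with a transversal, which reduces to the case
where the transversals differ. -/
theorem greenR_of_rank_mul_iff {x y : PartitionMonoid n} {q : ℕ} (hq : 1 ≤ q) (hx : x.rank = q)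
    (hy : y.rank = q) (H : ∀ g : PartitionMonoid n, q ≤ (g * x).rank ↔ q ≤ (g * y).rank) :
    GreenR x y := by
  have key : ∀ x y : PartitionMonoid n, x.rank = q → y.rank = q →
      (∀ g : PartitionMonoid n, q ≤ (g * x).rank ↔ q ≤ (g * y).rank) →
      ∀ i j, x.rel (Sum.inl i) (Sum.inl j) → y.rel (Sum.inl i) (Sum.inl j) := by
    intro x y hx hy H i j hij
    obtain ⟨hd, -⟩ := dom_iff_of_rank_mul_iff hx fun g => (H g).1
    obtain ⟨hd', hk⟩ := dom_iff_of_rank_mul_iff hy fun g => (H g).2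
    by_cases hi : dom x i
    · have hj : dom x j := by
        obtain ⟨k, hk⟩ := hi
        exact ⟨k, x.rel.trans' (x.rel.symm' hij) hk⟩
      exact hk i j (hd i hi) (hd j hj) hij
    · by_contra hno
      have hj : ¬ dom x j := fun ⟨k, hk⟩ => hi ⟨k, x.rel.trans' hij hk⟩
      obtain ⟨u, v, h⟩ := le_rank_iff.1 hx.ge
      -- merging the block of `j` with a transversal through `k` keeps the rank of `x`, and it makes
      -- `i` a vertex of a transversal of the product with `x` but not of the product with `y`
      set k := u ⟨0, hq⟩ with hk0
      have hkx : dom x k := ⟨v ⟨0, hq⟩, (h _ _).2 rfl⟩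
      have hμx : (merge j k * x).rank = q := by
        refine le_antisymm ((rank_mul_le_right _ _).trans hx.le) (le_rank_iff.2 ⟨u, v, ?_⟩)
        intro m l
        refine ⟨fun hml => ?_, ?_⟩
        · rcases rel_or_of_rel_merge_mul j k x hml with h1 | ⟨h1 | h1, h2⟩
          · exact (h m l).1 h1
          · exact absurd ⟨v m, x.rel.trans' (x.rel.symm' h1) ((h m m).2 rfl)⟩ hj
          · rcases h2 with h2 | h2
            · exact absurd ⟨v l, x.rel.symm' h2⟩ hj
            · exact (h m l).1 (x.rel.trans' h1 (x.rel.symm' h2))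
        · rintro rfl
          exact rel_merge_mul_of_rel j k x ((h m m).2 rfl)
      have hμy : (merge j k * y).rank = q :=
        le_antisymm ((rank_mul_le_right _ _).trans hy.le) ((H _).1 hμx.ge)
      obtain ⟨hd2, -⟩ := dom_iff_of_rank_mul_iff (y := merge j k * y) hμx fun g => by
        rw [← mul_assoc, ← mul_assoc]
        exact (H _).1
      have h1 : dom (merge j k * x) i := by
        refine ⟨v ⟨0, hq⟩, Setoid.trans' _ (rel_merge_mul_of_rel j k x hij)
          (Setoid.trans' _ (rel_merge_mul_self j k x) (rel_merge_mul_of_rel j k x ?_))⟩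
        exact (h _ _).2 rfl
      obtain ⟨l, hl⟩ := hd2 i h1
      rcases rel_or_of_rel_merge_mul j k y hl with h2 | ⟨h2 | h2, -⟩
      · exact hi (hd' i ⟨l, h2⟩)
      · exact hno h2
      · obtain ⟨c, hc⟩ := hd k hkx
        exact hi (hd' i ⟨c, y.rel.trans' h2 hc⟩)
  refine greenR_of_pattern hx hy
    (fun i j => ⟨key x y hx hy H i j, key y x hy hx (fun g => (H g).symm) i j⟩)
    (fun u hu => (exists_isTransversalSystem_iff u).2
      ((H _).1 ((exists_isTransversalSystem_iff u).1 hu)))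

theorem DropsRank.of_not_greenR {θ : Con (PartitionMonoid n)} {q : ℕ} (hq : 1 ≤ q)
    {x y : PartitionMonoid n} (hx : x.rank = q) (hy : y.rank = q) (h : θ x y)
    (hR : ¬ GreenR x y) : DropsRank θ q := by
  by_contra hno
  apply hR
  refine greenR_of_rank_mul_iff hq hx hy fun g => ?_
  have hgx : (g * x).rank ≤ q := hx ▸ rank_mul_le_right g x
  have hgy : (g * y).rank ≤ q := hy ▸ rank_mul_le_right g y
  constructor
  · intro h1
    by_contra h2
    exact hno ⟨_, _, rel_mul_left h g, le_antisymm hgx h1, not_le.1 h2⟩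
  · intro h1
    by_contra h2
    exact hno ⟨_, _, θ.symm (rel_mul_left h g), le_antisymm hgy h1, not_le.1 h2⟩

theorem greenR_flip {x y : PartitionMonoid n} (h : GreenR (flip x) (flip y)) : GreenL x y := by
  obtain ⟨⟨s, hs⟩, t, ht⟩ := greenR_iff.1 h
  refine greenL_iff.2 ⟨⟨flip s, ?_⟩, flip t, ?_⟩
  · rw [← flip_flip x, hs, flip_mul, flip_flip]
  · rw [← flip_flip y, ht, flip_mul, flip_flip]

/-- Related partitions of equal positive rank are `H`-related unless the congruence drops that
rank. -/
theorem DropsRank.of_not_greenH {θ : Con (PartitionMonoid n)} {q : ℕ} (hq : 1 ≤ q)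
    {x y : PartitionMonoid n} (hx : x.rank = q) (hy : y.rank = q) (h : θ x y)
    (hH : ¬ GreenH x y) : DropsRank θ q := by
  by_cases hR : GreenR x y
  · have hL : ¬ GreenR (flip x) (flip y) := fun hL => hH ⟨hR, greenR_flip hL⟩
    have h' : conFlip θ (flip x) (flip y) := by
      rw [conFlip_rel, flip_flip, flip_flip]
      exact h
    have := DropsRank.of_not_greenR hq (by rwa [rank_flip]) (by rwa [rank_flip]) h' hL
    have := this.reflect
    obtain ⟨a, b, hab, ha, hb⟩ := this
    refine ⟨a, b, ?_, ha, hb⟩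
    rwa [conFlip_rel, conFlip_rel, flip_flip, flip_flip] at hab
  · exact DropsRank.of_not_greenR hq hx hy h hR

/-! #### `H`-related pairs -/

/-- The permutations of `q` letters whose images are related to the identity. -/
def conPerm (θ : Con (PartitionMonoid n)) (q : ℕ) (hq : q ≤ n) : Subgroup (Equiv.Perm (Fin q)) where
  carrier := {σ | θ (eps n q) (bar n σ)}
  one_mem' := θ.refl _
  mul_mem' {σ τ} h h' := by
    have := θ.mul h' h
    rwa [eps_mul_eps hq, bar_mul_bar hq] at this
  inv_mem' {σ} h := by
    have := rel_mul_right h (bar n σ⁻¹)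
    rw [bar_mul_bar hq, bar_mul_bar hq, mul_one, inv_mul_cancel] at this
    exact θ.symm this

theorem mem_conPerm {θ : Con (PartitionMonoid n)} {q : ℕ} (hq : q ≤ n)
    {σ : Equiv.Perm (Fin q)} : σ ∈ conPerm θ q hq ↔ θ (eps n q) (bar n σ) := Iff.rfl

theorem conPerm_normal (θ : Con (PartitionMonoid n)) {q : ℕ} (hq : q ≤ n) :
    (conPerm θ q hq).Normal := by
  refine ⟨fun σ h τ => ?_⟩
  have := rel_mul_mul ((mem_conPerm hq).1 h) (bar n τ⁻¹) (bar n τ)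
  rw [bar_mul_bar hq, bar_mul_bar hq, bar_mul_bar hq, bar_mul_bar hq, one_mul,
    mul_inv_cancel] at this
  rwa [mem_conPerm, mul_assoc]

theorem groupBar_conPerm (θ : Con (PartitionMonoid n)) {q : ℕ} (hq : q ≤ n) :
    groupBar n (conPerm θ q hq) = conSubgroup θ (eps n q) := by
  ext a
  constructor
  · rintro ⟨σ, hσ, rfl⟩
    exact ⟨(greenH_eps_iff hq).2 ⟨σ, rfl⟩, hσ⟩
  · rintro ⟨h, h'⟩
    obtain ⟨σ, rfl⟩ := (greenH_eps_iff hq).1 h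
    exact ⟨σ, h', rfl⟩

theorem rel_of_nuRel_groupBar {θ : Con (PartitionMonoid n)} {q : ℕ} {hq : q ≤ n}
    {N : Subgroup (Equiv.Perm (Fin q))} (hN : N ≤ conPerm θ q hq) {x y : PartitionMonoid n}
    (h : nuRel (groupBar n N) x y) : θ x y := by
  refine rel_of_nuRel (e := eps n q) ?_ h
  rintro _ ⟨σ, hσ, rfl⟩
  exact (mem_conPerm hq).1 (hN hσ)

theorem nuRel_conPerm {θ : Con (PartitionMonoid n)} {q : ℕ} (hq : q ≤ n)
    {x y : PartitionMonoid n} (hx : x.rank = q) (hxy : GreenH x y) (h : θ x y) :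
    nuRel (groupBar n (conPerm θ q hq)) x y := by
  rw [groupBar_conPerm]
  exact nuRel_conSubgroup (eps_mul_eps hq) ((greenJ_eps hq).2 hx) hxy.symm h

theorem eq_of_nuRel_bot {q : ℕ} {x y : PartitionMonoid n}
    (h : nuRel (groupBar n (⊥ : Subgroup (Equiv.Perm (Fin q)))) x y) : x = y := by
  obtain ⟨_, ⟨σ, hσ, rfl⟩, _, ⟨τ, hτ, rfl⟩, s, t, rfl, rfl, -, -⟩ := h
  rw [SetLike.mem_coe, Subgroup.mem_bot] at hσ hτ
  rw [hσ, hτ]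

/-- On both sides, remove the image of a point `i` moved by `σ`. This leaves the identity with rank
`q`, but the partition of `σ` with smaller rank, as `i` has lost its image. -/
theorem DropsRank.of_conPerm {θ : Con (PartitionMonoid n)} {q : ℕ} {hq : q + 1 ≤ n}
    (h : conPerm θ (q + 1) hq ≠ ⊥) : DropsRank θ q := by
  obtain ⟨σ, hne⟩ := Subgroup.ne_bot_iff_exists_ne_one.1 h
  have hσ := σ.2
  obtain ⟨i, hi⟩ : ∃ i, σ.1 i ≠ i := by
    by_contra hno
    push Not at hno
    exact hne (Subtype.ext (Equiv.ext hno))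
  have hrel := (mem_conPerm hq).1 hσ
  set A := (initial n (q + 1)).erase (Fin.castLE hq (σ.1 i)) with hA
  have hmem : ∀ j : Fin (q + 1), Fin.castLE hq j ∈ initial n (q + 1) := fun j =>
    mem_initial.2 j.2
  have hAc : A.card = q := by
    rw [hA, Finset.card_erase_of_mem (hmem _), card_initial hq]; rfl
  have hiA : Fin.castLE hq i ∈ A :=
    Finset.mem_erase.2 ⟨fun h => hi (Fin.castLE_injective hq h).symm, hmem i⟩
  refine ⟨_, _, rel_mul_mul hrel (restr A) (restr A), ?_, ?_⟩
  · rw [restr_mul_eps (Finset.erase_subset _ _), restr_mul_restr, Finset.inter_self, rank_restr,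
      hAc]
  · refine (rank_le_of_dom (A.erase (Fin.castLE hq i)) ?_).trans_lt ?_
    · rintro j ⟨k, hk⟩
      obtain ⟨hkA, hk⟩ := mul_restr_rel_inl_inr A hk
      obtain ⟨hjA, hk⟩ := (restr_mul_rel_inl_inr A).1 hk
      refine Finset.mem_erase.2 ⟨?_, hjA⟩
      rintro rfl
      obtain ⟨m, hm, hkm⟩ := bar_rel_inl_inr.1 hk
      have him : i = m := Fin.ext hm
      subst him
      have : k = Fin.castLE hq (σ.1 i) := Fin.ext hkm
      rw [this, hA] at hkA
      exact (Finset.mem_erase.1 hkA).1 rfl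
    · exact (Finset.card_erase_lt_of_mem hiA).trans_eq hAc

end PartitionMonoid

/-! ### The normal subgroups of the symmetric groups -/

namespace PartitionMonoid

open Equiv Equiv.Perm

theorem eq_alternatingGroup_or_eq_top {q : ℕ} {N : Subgroup (Perm (Fin q))}
    (h : alternatingGroup (Fin q) ≤ N) : N = alternatingGroup (Fin q) ∨ N = ⊤ := by
  by_cases hN : N ≤ alternatingGroup (Fin q)
  · exact Or.inl (le_antisymm hN h)
  · right
    obtain ⟨σ, hσ, hσ'⟩ := SetLike.not_le_iff_exists.1 hN
    have h1 : sign σ = -1 :=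
      (Int.units_eq_one_or _).resolve_left fun h => hσ' (mem_alternatingGroup.2 h)
    rw [eq_top_iff]
    intro τ _
    rcases Int.units_eq_one_or (sign τ) with hτ | hτ
    · exact h (mem_alternatingGroup.2 hτ)
    · have : σ * τ ∈ N := h (mem_alternatingGroup.2 (by rw [map_mul, h1, hτ]; rfl))
      exact (N.mul_mem_cancel_left hσ).1 this

theorem alternatingGroup_le_of_isThreeCycle_mem {q : ℕ} {N : Subgroup (Perm (Fin q))}
    (hN : N.Normal) {σ : Perm (Fin q)} (hσ : σ.IsThreeCycle) (h : σ ∈ N) :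
    alternatingGroup (Fin q) ≤ N := by
  rw [← closure_three_cycles_eq_alternating, Subgroup.closure_le]
  intro τ (hτ : τ.IsThreeCycle)
  obtain ⟨ρ, rfl⟩ := isConj_iff.1 (isConj_iff_cycleType_eq.2 (hσ.cycleType.trans hτ.cycleType.symm))
  exact hN.conj_mem σ h ρ

/-- In the symmetric groups of degree `3` and `4`, the elements of this form include a three-cycle
whenever `σ` is not the identity and not in the Klein four-group. -/
theorem mul_conj_mem {q : ℕ} {N : Subgroup (Perm (Fin q))} (hN : N.Normal) {σ : Perm (Fin q)}
    (h : σ ∈ N) (ρ : Perm (Fin q)) : ρ * σ * ρ⁻¹ * σ ∈ N :=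
  N.mul_mem (hN.conj_mem σ h ρ) h

theorem mem_klein {σ : Perm (Fin 4)} : σ ∈ klein ↔ σ = 1 ∨ σ = swap 0 1 * swap 2 3 ∨
    σ = swap 0 2 * swap 1 3 ∨ σ = swap 0 3 * swap 1 2 := Iff.rfl

theorem klein_normal : klein.Normal := by
  refine ⟨fun σ hσ ρ => ?_⟩
  rw [mem_klein] at hσ ⊢
  rcases hσ with rfl | rfl | rfl | rfl <;> revert ρ <;> decide

theorem klein_ne_bot : klein ≠ ⊥ := by
  intro h
  have h1 : swap 0 1 * swap 2 3 ∈ klein := mem_klein.2 (Or.inr (Or.inl rfl))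
  rw [h, Subgroup.mem_bot] at h1
  revert h1
  decide

theorem klein_le_alternatingGroup : klein ≤ alternatingGroup (Fin 4) := by
  intro σ hσ
  rw [mem_klein] at hσ
  rw [mem_alternatingGroup]
  rcases hσ with rfl | rfl | rfl | rfl <;> decide

theorem klein_ne_alternatingGroup : klein ≠ alternatingGroup (Fin 4) := by
  intro h
  have h1 : swap 0 1 * swap 1 2 ∈ klein := by
    rw [h, mem_alternatingGroup]; decide
  rw [mem_klein] at h1
  revert h1
  decide

theorem alternatingGroup_ne_top {q : ℕ} (hq : 2 ≤ q) : alternatingGroup (Fin q) ≠ ⊤ := by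
  intro h
  have h1 : swap (⟨0, by omega⟩ : Fin q) ⟨1, by omega⟩ ∈ alternatingGroup (Fin q) := by
    rw [h]; exact Subgroup.mem_top _
  rw [mem_alternatingGroup, sign_swap (by simp)] at h1
  revert h1
  decide

theorem alternatingGroup_ne_bot {q : ℕ} (hq : 3 ≤ q) : alternatingGroup (Fin q) ≠ ⊥ :=
  (Subgroup.nontrivial_iff_ne_bot _).1
    (alternatingGroup.nontrivial_of_three_le_card (by simpa using hq))

theorem normal_perm_three {N : Subgroup (Perm (Fin 3))} (hN : N.Normal) (hne : N ≠ ⊥) :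
    alternatingGroup (Fin 3) ≤ N := by
  obtain ⟨⟨σ, hσ⟩, h1⟩ := Subgroup.ne_bot_iff_exists_ne_one.1 hne
  have key : ∀ σ : Perm (Fin 3), σ ≠ 1 → ∃ ρ : Perm (Fin 3),
      (ρ * σ * ρ⁻¹ * σ).support.card = 3 := by decide
  obtain ⟨ρ, hρ⟩ := key σ fun h => h1 (Subtype.ext h)
  exact alternatingGroup_le_of_isThreeCycle_mem hN (card_support_eq_three_iff.1 hρ)
    (mul_conj_mem hN hσ ρ)

set_option maxRecDepth 10000 in
theorem exists_support_card_eq_three : ∀ σ : Perm (Fin 4),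
    ¬ (σ = 1 ∨ σ = swap 0 1 * swap 2 3 ∨ σ = swap 0 2 * swap 1 3 ∨ σ = swap 0 3 * swap 1 2) →
    ∃ ρ : Perm (Fin 4), (ρ * σ * ρ⁻¹ * σ).support.card = 3 := by decide

theorem normal_perm_four {N : Subgroup (Perm (Fin 4))} (hN : N.Normal) (hne : N ≠ ⊥) :
    N = klein ∨ alternatingGroup (Fin 4) ≤ N := by
  by_cases h : N ≤ klein
  · left
    refine le_antisymm h ?_
    obtain ⟨⟨σ, hσ⟩, h1⟩ := Subgroup.ne_bot_iff_exists_ne_one.1 hne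
    have h1 : σ ≠ 1 := fun h => h1 (Subtype.ext h)
    have hσK := mem_klein.1 (h hσ)
    have key : ∀ τ ∈ klein, τ = 1 ∨ ∃ ρ : Perm (Fin 4), ρ * σ * ρ⁻¹ = τ := by
      intro τ hτ
      rw [mem_klein] at hτ
      rcases hσK with rfl | rfl | rfl | rfl
      · exact absurd rfl h1
      all_goals rcases hτ with rfl | rfl | rfl | rfl <;> decide
    intro τ hτ
    rcases key τ hτ with rfl | ⟨ρ, rfl⟩
    · exact N.one_mem
    · exact hN.conj_mem σ hσ ρ
  · right
    obtain ⟨σ, hσ, hσ'⟩ := SetLike.not_le_iff_exists.1 h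
    obtain ⟨ρ, hρ⟩ := exists_support_card_eq_three σ hσ'
    exact alternatingGroup_le_of_isThreeCycle_mem hN (card_support_eq_three_iff.1 hρ)
      (mul_conj_mem hN hσ ρ)

open Classical in
/-- The position of a normal subgroup of the symmetric group in the chain formed by the trivial
group, the Klein four-group (if there are four letters), the alternating group and the symmetric
group. The value `1` is given to everything that is not one of the other three; among normal
subgroups that leaves only the Klein four-group. -/
noncomputable def code {q : ℕ} (N : Subgroup (Perm (Fin q))) : ℕ :=
  if N = ⊥ then 0 else if N = ⊤ then 3 else if N = alternatingGroup (Fin q) then 2 else 1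

theorem code_le {q : ℕ} (N : Subgroup (Perm (Fin q))) : code N ≤ 3 := by
  unfold code; split_ifs <;> omega

@[simp] theorem code_bot {q : ℕ} : code (⊥ : Subgroup (Perm (Fin q))) = 0 := if_pos rfl

theorem code_eq_zero {q : ℕ} {N : Subgroup (Perm (Fin q))} : code N = 0 ↔ N = ⊥ := by
  unfold code; split_ifs with h <;> simp [h]

theorem top_ne_bot {q : ℕ} (hq : 2 ≤ q) : (⊤ : Subgroup (Perm (Fin q))) ≠ ⊥ := by
  intro h
  exact alternatingGroup_ne_top hq (le_antisymm le_top (h ▸ bot_le))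

theorem code_top {q : ℕ} (hq : 2 ≤ q) : code (⊤ : Subgroup (Perm (Fin q))) = 3 := by
  unfold code; rw [if_neg (top_ne_bot hq), if_pos rfl]

theorem code_alternatingGroup {q : ℕ} (hq : 3 ≤ q) : code (alternatingGroup (Fin q)) = 2 := by
  unfold code
  rw [if_neg (alternatingGroup_ne_bot hq), if_neg (alternatingGroup_ne_top (by omega)), if_pos rfl]

theorem code_klein : code klein = 1 := by
  unfold code
  rw [if_neg klein_ne_bot, if_neg, if_neg klein_ne_alternatingGroup]
  intro h
  exact alternatingGroup_ne_top (q := 4) (by omega)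
    (le_antisymm le_top (h ▸ klein_le_alternatingGroup))

/-- The normal subgroups of the symmetric groups. -/
theorem normal_cases {q : ℕ} {N : Subgroup (Perm (Fin q))} (hN : N.Normal) :
    N = ⊥ ∨ (2 ≤ q ∧ N = ⊤) ∨ (3 ≤ q ∧ N = alternatingGroup (Fin q)) ∨
      ∃ h : q = 4, N = h.symm ▸ klein := by
  by_cases hne : N = ⊥
  · exact Or.inl hne
  right
  have hq : 2 ≤ q := by
    by_contra hq
    obtain ⟨⟨σ, hσ⟩, h1⟩ := Subgroup.ne_bot_iff_exists_ne_one.1 hne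
    refine h1 (Subtype.ext (Equiv.ext fun i => Fin.ext ?_))
    have := (σ i).2
    have := i.2
    change (σ i).val = i.val
    omega
  have hA : alternatingGroup (Fin q) ≤ N → (2 ≤ q ∧ N = ⊤) ∨
      (3 ≤ q ∧ N = alternatingGroup (Fin q)) ∨ ∃ h : q = 4, N = h.symm ▸ klein := by
    intro h
    rcases eq_alternatingGroup_or_eq_top h with h' | h'
    · refine Or.inr (Or.inl ⟨?_, h'⟩)
      by_contra hq3
      refine hne (h'.trans (alternatingGroup.eq_bot_of_card_le_two ?_))
      rw [Nat.card_fin]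
      omega
    · exact Or.inl ⟨hq, h'⟩
  rcases Nat.lt_or_ge q 5 with h5 | h5
  · obtain rfl | rfl | rfl : q = 2 ∨ q = 3 ∨ q = 4 := by omega
    · exact Or.inl ⟨hq, (subgroup_perm_two N).resolve_left hne⟩
    · exact hA (normal_perm_three hN hne)
    · rcases normal_perm_four hN hne with h | h
      · exact Or.inr (Or.inr ⟨rfl, h⟩)
      · exact hA h
  · exact hA (alternatingGroup_le_of_normal (by simpa using h5)
      ((Subgroup.nontrivial_iff_ne_bot N).2 hne))

theorem le_iff_code_le {q : ℕ} {N M : Subgroup (Perm (Fin q))} (hN : N.Normal) (hM : M.Normal) :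
    N ≤ M ↔ code N ≤ code M := by
  have hmono : ∀ {N M : Subgroup (Perm (Fin q))}, N.Normal → M.Normal → code N ≤ code M →
      N ≤ M := by
    intro N M hN hM h
    rcases normal_cases hN with rfl | ⟨hq, rfl⟩ | ⟨hq, rfl⟩ | ⟨rfl, rfl⟩
    · exact bot_le
    · rw [code_top hq] at h
      rcases normal_cases hM with rfl | ⟨-, rfl⟩ | ⟨hq3, rfl⟩ | ⟨rfl, rfl⟩
      · simp at h
      · exact le_rfl
      · rw [code_alternatingGroup hq3] at h; omega
      · rw [code_klein] at h; omega
    · rw [code_alternatingGroup hq] at h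
      rcases normal_cases hM with rfl | ⟨-, rfl⟩ | ⟨-, rfl⟩ | ⟨rfl, rfl⟩
      · simp at h
      · exact le_top
      · exact le_rfl
      · rw [code_klein] at h; omega
    · rcases normal_cases hM with rfl | ⟨-, rfl⟩ | ⟨-, rfl⟩ | ⟨-, rfl⟩
      · rw [code_bot, code_klein] at h; omega
      · exact le_top
      · exact klein_le_alternatingGroup
      · exact le_rfl
  refine ⟨fun h => ?_, hmono hN hM⟩
  by_contra hlt
  have h' := hmono hM hN (by omega)
  rw [le_antisymm h h'] at hlt
  exact hlt le_rfl

theorem code_eq_one {q : ℕ} {N : Subgroup (Perm (Fin q))} (hN : N.Normal) (h : code N = 1) :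
    q = 4 := by
  rcases normal_cases hN with rfl | ⟨hq, rfl⟩ | ⟨hq, rfl⟩ | ⟨hq, -⟩
  · simp at h
  · rw [code_top hq] at h; omega
  · rw [code_alternatingGroup hq] at h; omega
  · exact hq

theorem code_eq_two {q : ℕ} {N : Subgroup (Perm (Fin q))} (hN : N.Normal) (h : code N = 2) :
    3 ≤ q := by
  rcases normal_cases hN with rfl | ⟨hq, rfl⟩ | ⟨hq, rfl⟩ | ⟨hq, -⟩
  · simp at h
  · rw [code_top hq] at h; omega
  · exact hq
  · omega

end PartitionMonoid

/-! ### The invariants of a congruence -/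

namespace PartitionMonoid

open SemigroupCong

variable {n : ℕ}

theorem DropsRank.of_le {θ : Con (PartitionMonoid n)} {p q : ℕ} (hp : 1 ≤ p) (hpq : p ≤ q)
    (h : DropsRank θ q) : DropsRank θ p := by
  induction q, hpq using Nat.le_induction with
  | base => exact h
  | succ q hq ih => exact ih (h.pred (hp.trans hq))

theorem DropsRank.mono {θ θ' : Con (PartitionMonoid n)} (hle : θ ≤ θ') {q : ℕ}
    (h : DropsRank θ q) : DropsRank θ' q := by
  obtain ⟨x, y, hxy, h⟩ := h
  exact ⟨x, y, hle hxy, h⟩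

theorem SeparatesUker.mono {θ θ' : Con (PartitionMonoid n)} (hle : θ ≤ θ')
    (h : SeparatesUker θ) : SeparatesUker θ' := by
  obtain ⟨x, y, hxy, h⟩ := h
  exact ⟨x, y, hle hxy, h⟩

theorem SeparatesLker.mono {θ θ' : Con (PartitionMonoid n)} (hle : θ ≤ θ')
    (h : SeparatesLker θ) : SeparatesLker θ' := by
  obtain ⟨x, y, hxy, h⟩ := h
  exact ⟨x, y, hle hxy, h⟩

/-- The position of the group `conPerm θ q`, with value `0` for `q > n`. -/
noncomputable def conCode (θ : Con (PartitionMonoid n)) (q : ℕ) : ℕ :=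
  if h : q ≤ n then code (conPerm θ q h) else 0

theorem conCode_of_le (θ : Con (PartitionMonoid n)) {q : ℕ} (h : q ≤ n) :
    conCode θ q = code (conPerm θ q h) := dif_pos h

theorem conCode_le (θ : Con (PartitionMonoid n)) (q : ℕ) : conCode θ q ≤ 3 := by
  unfold conCode
  split_ifs
  · exact code_le _
  · omega

/-- The congruence `θ` has height `p` if `p` is the largest rank that it drops, or `0` if there is
no such rank. -/
structure HasHeight (θ : Con (PartitionMonoid n)) (p : ℕ) : Prop where
  drops : p = 0 ∨ DropsRank θ p
  not_drops : ¬ DropsRank θ (p + 1)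

theorem exists_hasHeight (θ : Con (PartitionMonoid n)) : ∃ p, HasHeight θ p := by
  by_contra hno
  have h : ∀ p, p = 0 ∨ DropsRank θ p := by
    intro p
    induction p with
    | zero => exact Or.inl rfl
    | succ p ih => exact Or.inr (by_contra fun h => hno ⟨p, ih, h⟩)
  have h1 := ((h (n + 1)).resolve_left (Nat.succ_ne_zero n)).le
  omega

theorem HasHeight.le {θ : Con (PartitionMonoid n)} {p : ℕ} (h : HasHeight θ p) : p ≤ n := by
  rcases h.drops with rfl | h
  · exact Nat.zero_le n
  · exact h.le

theorem HasHeight.not_drops_of_lt {θ : Con (PartitionMonoid n)} {p q : ℕ} (h : HasHeight θ p)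
    (hpq : p < q) : ¬ DropsRank θ q := fun hq => h.not_drops (hq.of_le (by omega) hpq)

theorem HasHeight.separates {θ : Con (PartitionMonoid n)} {p : ℕ} (h : HasHeight θ p)
    (hp : 2 ≤ p) : SeparatesUker θ ∧ SeparatesLker θ := by
  have h2 : DropsRank θ 2 := (h.drops.resolve_left (by omega)).of_le (by omega) hp
  exact ⟨h2.separatesUker, h2.separatesLker⟩

theorem HasHeight.rel_hat {θ : Con (PartitionMonoid n)} {p : ℕ} (h : HasHeight θ p) (hp : p ≤ 1)
    {x : PartitionMonoid n} (hx : x.rank ≤ p) : θ x (hat x) := by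
  rcases h.drops with rfl | h
  · rw [hat_eq_self (Nat.le_zero.1 hx)]
    exact θ.refl x
  · obtain rfl : p = 1 := le_antisymm hp (Nat.pos_of_ne_zero (by
      rintro rfl
      obtain ⟨_, _, _, _, h0⟩ := h
      exact absurd h0 (Nat.not_lt_zero _)))
    exact h.rel_hat hx

/-- A congruence is contained in the relation built from its height `p`, from its permutations of
`p + 1` letters and from the kernels that it preserves on the minimal ideal. -/
theorem HasHeight.cases_of_rel {θ : Con (PartitionMonoid n)} {p : ℕ} (h : HasHeight θ p)
    {x y : PartitionMonoid n} (hxy : θ x y) :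
    x = y ∨ (∃ hp : p + 1 ≤ n, x.rank = p + 1 ∧ nuRel (groupBar n (conPerm θ (p + 1) hp)) x y) ∨
      (x.rank ≤ p ∧ y.rank ≤ p ∧ kerRel (¬ SeparatesUker θ) (¬ SeparatesLker θ) x y) := by
  have hle : ∀ x y : PartitionMonoid n, θ x y → y.rank < x.rank → x.rank ≤ p :=
    fun x y hxy hr => not_lt.1 fun hp => h.not_drops_of_lt hp ⟨x, y, hxy, rfl, hr⟩
  by_cases hp : x.rank ≤ p ∧ y.rank ≤ p
  · refine Or.inr (Or.inr ⟨hp.1, hp.2, fun hu => ?_, fun hl => ?_⟩)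
    · have hp1 : p ≤ 1 := not_lt.1 fun hp => hu (h.separates hp).1
      by_contra hne
      exact hu ⟨hat x, hat y, θ.trans (θ.symm (h.rel_hat hp1 hp.1))
        (θ.trans hxy (h.rel_hat hp1 hp.2)), rank_hat x, rank_hat y, by simpa using hne⟩
    · have hp1 : p ≤ 1 := not_lt.1 fun hp => hl (h.separates hp).2
      by_contra hne
      exact hl ⟨hat x, hat y, θ.trans (θ.symm (h.rel_hat hp1 hp.1))
        (θ.trans hxy (h.rel_hat hp1 hp.2)), rank_hat x, rank_hat y, by simpa using hne⟩
  have hr : x.rank = y.rank := by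
    rcases lt_trichotomy x.rank y.rank with hlt | heq | hlt
    · exact absurd ⟨hlt.le.trans (hle y x (θ.symm hxy) hlt), hle y x (θ.symm hxy) hlt⟩ hp
    · exact heq
    · exact absurd ⟨hle x y hxy hlt, hlt.le.trans (hle x y hxy hlt)⟩ hp
  have hpx : p < x.rank := by omega
  have hH : GreenH x y := by
    by_contra hH
    exact h.not_drops_of_lt hpx (DropsRank.of_not_greenH (by omega) rfl hr.symm hxy hH)
  obtain ⟨r, hr'⟩ : ∃ r, x.rank = r + 1 := ⟨x.rank - 1, by omega⟩
  have hrn : r + 1 ≤ n := hr' ▸ rank_le x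
  have hnu := nuRel_conPerm hrn hr' hH hxy
  by_cases hbot : conPerm θ (r + 1) hrn = ⊥
  · rw [hbot] at hnu
    exact Or.inl (eq_of_nuRel_bot hnu)
  · have hrp : ¬ p < r := fun hrp => h.not_drops_of_lt hrp (DropsRank.of_conPerm hbot)
    obtain rfl : r = p := by omega
    exact Or.inr (Or.inl ⟨hrn, hr', hnu⟩)

theorem HasHeight.rel_of_kerRel {θ : Con (PartitionMonoid n)} {p : ℕ} (h : HasHeight θ p)
    {x y : PartitionMonoid n} (hx : x.rank ≤ p) (hy : y.rank ≤ p)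
    (hxy : kerRel (¬ SeparatesUker θ) (¬ SeparatesLker θ) x y) : θ x y := by
  rcases le_or_gt 2 p with hp | hp
  · exact (h.drops.resolve_left (by omega)).rel hp hx hy
  have hp1 : p ≤ 1 := by omega
  suffices θ (hat x) (hat y) from
    θ.trans (h.rel_hat hp1 hx) (θ.trans this (θ.symm (h.rel_hat hp1 hy)))
  -- change first the upper and then the lower kernel
  have h1 : θ (hat x) (ofKer (uker y) (lker x)) := by
    by_cases hu : SeparatesUker θ
    · exact rel_of_lker_eq hu (rank_hat x) (rank_ofKer _ _) (by simp)
    · rw [← hxy.1 hu]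
      exact θ.refl _
  have h2 : θ (ofKer (uker y) (lker x)) (hat y) := by
    by_cases hl : SeparatesLker θ
    · exact rel_of_uker_eq hl (rank_ofKer _ _) (rank_hat y) (by simp)
    · rw [hxy.2 hl]
      exact θ.refl _
  exact θ.trans h1 h2

/-- The order of congruences in terms of their invariants. The height and the group are packed into
one number, in which the height takes precedence. -/
theorem HasHeight.le_iff {θ θ' : Con (PartitionMonoid n)} {p p' : ℕ} (h : HasHeight θ p)
    (h' : HasHeight θ' p') : θ ≤ θ' ↔ (SeparatesUker θ → SeparatesUker θ') ∧
      (SeparatesLker θ → SeparatesLker θ') ∧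
      4 * p + conCode θ (p + 1) ≤ 4 * p' + conCode θ' (p' + 1) := by
  have hc := conCode_le θ (p + 1)
  have hc' := conCode_le θ' (p' + 1)
  constructor
  · intro hle
    refine ⟨fun hu => hu.mono hle, fun hl => hl.mono hle, ?_⟩
    have hpp : p ≤ p' := by
      rcases h.drops with rfl | hd
      · exact Nat.zero_le _
      · exact not_lt.1 fun hlt => h'.not_drops_of_lt hlt (hd.mono hle)
    rcases hpp.lt_or_eq with hlt | rfl
    · omega
    · by_cases hp : p + 1 ≤ n
      · rw [conCode_of_le θ hp, conCode_of_le θ' hp]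
        have := (le_iff_code_le (conPerm_normal θ hp) (conPerm_normal θ' hp)).1
          fun σ hσ => hle ((mem_conPerm hp).1 hσ)
        omega
      · simp [conCode, hp]
  · rintro ⟨hu, hl, hlev⟩ x y hxy
    rcases h.cases_of_rel hxy with rfl | ⟨hp, hx, hnu⟩ | ⟨hx, hy, hk⟩
    · exact θ'.refl x
    · rcases lt_or_ge p p' with hlt | hge
      · have hr : y.rank = p + 1 := (greenJ_eps hp).1
          (hnu.greenJ (groupBar_isNormal hp (conPerm_normal θ hp))).2
        rcases Nat.eq_zero_or_pos p with rfl | hpos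
        · -- the symmetric group on one letter is trivial
          have : conPerm θ (0 + 1) hp = ⊥ := by
            rw [Subgroup.eq_bot_iff_forall]
            exact fun σ _ => Subsingleton.elim (α := Equiv.Perm (Fin 1)) σ 1
          rw [this] at hnu
          rw [eq_of_nuRel_bot hnu]
          exact θ'.refl y
        · exact (h'.drops.resolve_left (by omega)).rel (by omega) (by omega) (by omega)
      · obtain rfl : p = p' := by omega
        rw [conCode_of_le θ hp, conCode_of_le θ' hp] at hlev
        exact rel_of_nuRel_groupBar ((le_iff_code_le (conPerm_normal θ hp)
          (conPerm_normal θ' hp)).2 (by omega)) hnu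
    · have hpp : p ≤ p' := by omega
      exact h'.rel_of_kerRel (hx.trans hpp) (hy.trans hpp)
        ⟨fun hu' => hk.1 fun h => hu' (hu h), fun hl' => hk.2 fun h => hl' (hl h)⟩

/-- The invariants of a congruence which is given in the form of the classification. For `p = n`
there is no group, and `N` is taken to be trivial. -/
theorem hasHeight_of_rel_iff (hn : 2 ≤ n) {θ : Con (PartitionMonoid n)} {p : ℕ} (hp : p ≤ n)
    {N : Subgroup (Equiv.Perm (Fin (p + 1)))} (hN : N.Normal) (hbot : p = n → N = ⊥) {u l : Prop}
    (H : ∀ x y, θ x y ↔ x = y ∨ nuRel (groupBar n N) x y ∨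
      (x.rank ≤ p ∧ y.rank ≤ p ∧ kerRel u l x y)) :
    HasHeight θ p ∧ conCode θ (p + 1) = code N ∧ (SeparatesUker θ ↔ ¬ u) ∧
      (SeparatesLker θ ↔ ¬ l) := by
  have hnu : ∀ x y : PartitionMonoid n, nuRel (groupBar n N) x y →
      x = y ∨ (x.rank = p + 1 ∧ y.rank = p + 1) := by
    intro x y hxy
    rcases hp.eq_or_lt with rfl | hp'
    · rw [hbot rfl] at hxy
      exact Or.inl (eq_of_nuRel_bot hxy)
    · have := hxy.greenJ (groupBar_isNormal hp' hN)
      exact Or.inr ⟨(greenJ_eps hp').1 this.1, (greenJ_eps hp').1 this.2⟩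
  have hne : (⊥ : Setoid (Fin n)) ≠ ⊤ := by
    intro h
    have h1 : (⊥ : Setoid (Fin n)) ⟨0, by omega⟩ ⟨1, by omega⟩ := h ▸ trivial
    have h2 : (⟨0, by omega⟩ : Fin n) = ⟨1, by omega⟩ := h1
    simp at h2
  refine ⟨⟨?_, ?_⟩, ?_, ⟨?_, fun hu => ?_⟩, ⟨?_, fun hl => ?_⟩⟩
  · rcases Nat.eq_zero_or_pos p with h0 | hpos
    · exact Or.inl h0
    · exact Or.inr ⟨eps n p, hat (eps n p), (H _ _).2 (Or.inr (Or.inr ⟨(rank_bar hp _).le,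
        by simp, fun _ => by simp, fun _ => by simp⟩)), rank_bar hp _, by simpa using hpos⟩
  · rintro ⟨x, y, hxy, hx, hy⟩
    rcases (H x y).1 hxy with rfl | h | ⟨h, -⟩
    · omega
    · rcases hnu x y h with rfl | ⟨-, h⟩ <;> omega
    · omega
  · rcases hp.eq_or_lt with h | hp'
    · rw [hbot h, code_bot]
      exact dif_neg (by omega)
    · replace hp' : p + 1 ≤ n := hp'
      rw [conCode_of_le θ hp']
      congr 1
      ext σ
      rw [mem_conPerm, H]
      have hr : (eps n (p + 1)).rank = p + 1 := rank_bar hp' 1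
      constructor
      · rintro (h | h | ⟨h, -⟩)
        · rw [← bar_injective hp' h]
          exact N.one_mem
        · obtain ⟨τ, hτ, h⟩ := (nuRel_idem_iff (eps_mul_eps hp') (groupBar_isNormal hp' hN)).1 h
          rwa [← bar_injective hp' h]
        · omega
      · exact fun h => Or.inr (Or.inl
          ((nuRel_idem_iff (eps_mul_eps hp') (groupBar_isNormal hp' hN)).2 ⟨σ, h, rfl⟩))
  · rintro ⟨x, y, hxy, hx, hy, hne⟩ hu
    rcases (H x y).1 hxy with rfl | h | ⟨-, -, h⟩
    · exact hne rfl
    · rcases hnu x y h with rfl | ⟨-, h⟩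
      · exact hne rfl
      · omega
    · exact hne (h.1 hu)
  · refine ⟨ofKer ⊥ ⊥, ofKer ⊤ ⊥, (H _ _).2 (Or.inr (Or.inr ⟨by simp, by simp,
      fun h => absurd h hu, fun _ => by simp⟩)), by simp, by simp, by simpa using hne⟩
  · rintro ⟨x, y, hxy, hx, hy, hne⟩ hl
    rcases (H x y).1 hxy with rfl | h | ⟨-, -, h⟩
    · exact hne rfl
    · rcases hnu x y h with rfl | ⟨-, h⟩
      · exact hne rfl
      · omega
    · exact hne (h.2 hl)
  · refine ⟨ofKer ⊥ ⊥, ofKer ⊥ ⊤, (H _ _).2 (Or.inr (Or.inr ⟨by simp, by simp,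
      fun _ => by simp, fun h => absurd h hl⟩)), by simp, by simp, by simpa using hne⟩

end PartitionMonoid

/-! ### The lattice of congruences -/

namespace PartitionMonoid

open SemigroupCong

variable {n : ℕ}

/-- `1` if the congruence with the given name separates upper kernels, `0` if it preserves them on
the minimal ideal. -/
def CongName.upper : CongName n → ℕ
  | .R _ _ | .RN _ _ _ _ _ _ | .lam _ => 1
  | .rho _ | .mu _ => 0

/-- `1` if the congruence with the given name separates lower kernels, `0` if it preserves them on
the minimal ideal. -/
def CongName.lower : CongName n → ℕ
  | .R _ _ | .RN _ _ _ _ _ _ | .rho _ => 1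
  | .lam _ | .mu _ => 0

/-- The level of a retractable pair: four times the rank of the ideal plus the position of the
group. -/
def RetractablePair.level : RetractablePair → ℕ
  | .c0 => 0
  | .c1 => 4
  | .cS2 => 7

/-- The level of a congruence name: four times the height plus the position of the group. -/
noncomputable def CongName.level : CongName n → ℕ
  | .R q _ => 4 * q
  | .RN q _ _ N _ _ => 4 * (q - 1) + code N
  | .lam C | .rho C | .mu C => C.level

theorem RetractablePair.level_eq (C : RetractablePair) :
    C.level = 4 * C.idealRank + code C.subgroup := by
  cases C
  · exact (congrArg (4 * 0 + ·) (code_bot (q := 1))).symm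
  · exact (congrArg (4 * 1 + ·) (code_bot (q := 2))).symm
  · exact (congrArg (4 * 1 + ·) (code_top (q := 2) le_rfl)).symm

theorem CongName.hasHeight_toCon (hn : 2 ≤ n) (c : CongName n) :
    ∃ p, HasHeight (c.toCon hn) p ∧ c.level = 4 * p + conCode (c.toCon hn) (p + 1) ∧
      (SeparatesUker (c.toCon hn) ↔ c.upper = 1) ∧ (SeparatesLker (c.toCon hn) ↔ c.lower = 1) := by
  have hret : ∀ (C : RetractablePair) (u l : Prop), ∃ p, HasHeight (retractCon hn C u l) p ∧
      C.level = 4 * p + conCode (retractCon hn C u l) (p + 1) ∧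
      (SeparatesUker (retractCon hn C u l) ↔ ¬ u) ∧
      (SeparatesLker (retractCon hn C u l) ↔ ¬ l) := by
    intro C u l
    have h1 := C.idealRank_le
    obtain ⟨h, hc, hu, hl⟩ := hasHeight_of_rel_iff hn (θ := retractCon hn C u l)
      (by omega : C.idealRank ≤ n) C.subgroup_normal (by omega)
      fun x y => retractCon_rel_iff hn C u l
    exact ⟨_, h, by rw [hc, C.level_eq], hu, hl⟩
  cases c with
  | R q hq =>
    obtain ⟨h, hc, hu, hl⟩ := hasHeight_of_rel_iff hn (θ := reesCon n q) hq
      (N := ⊥) inferInstance (fun _ => rfl) (u := False) (l := False) (fun x y => by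
        constructor
        · rintro (h | ⟨h1, h2⟩)
          · exact Or.inl h
          · exact Or.inr (Or.inr ⟨h1, h2, False.elim, False.elim⟩)
        · rintro (h | h | ⟨h1, h2, -⟩)
          · exact Or.inl h
          · exact Or.inl (eq_of_nuRel_bot h)
          · exact Or.inr ⟨h1, h2⟩)
    exact ⟨q, h, by simp [toCon, level, hc], by simpa [toCon, upper] using hu,
      by simpa [toCon, lower] using hl⟩
  | RN q h2 hq N hN hne =>
    obtain ⟨p, rfl⟩ : ∃ p, q = p + 1 := ⟨q - 1, by omega⟩
    obtain ⟨h, hc, hu, hl⟩ := hasHeight_of_rel_iff hn (θ := inCon hq hN) (p := p) (by omega)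
      hN (by omega) (u := False) (l := False) (fun x y => by
        refine (layerCon_rel hq hN _ _ _).trans ?_
        simp only [kerRel, Nat.lt_succ_iff, false_imp_iff, and_true])
    exact ⟨p, h, by simp [toCon, level, hc], by simpa [toCon, upper] using hu,
      by simpa [toCon, lower] using hl⟩
  | lam C => simpa [toCon, level, upper, lower] using hret C False True
  | rho C => simpa [toCon, level, upper, lower] using hret C True False
  | mu C => simpa [toCon, level, upper, lower] using hret C True True

theorem CongName.upper_le (c : CongName n) : c.upper ≤ 1 := by cases c <;> simp [upper]

theorem CongName.lower_le (c : CongName n) : c.lower ≤ 1 := by cases c <;> simp [lower]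

theorem CongName.toCon_le_iff (hn : 2 ≤ n) {c d : CongName n} : c.toCon hn ≤ d.toCon hn ↔
    c.upper ≤ d.upper ∧ c.lower ≤ d.lower ∧ c.level ≤ d.level := by
  obtain ⟨p, hp, hlev, hu, hl⟩ := c.hasHeight_toCon hn
  obtain ⟨p', hp', hlev', hu', hl'⟩ := d.hasHeight_toCon hn
  rw [hp.le_iff hp', ← hlev, ← hlev', hu, hl, hu', hl']
  have := c.upper_le
  have := c.lower_le
  have := d.upper_le
  have := d.lower_le
  refine and_congr ?_ (and_congr_left' ?_) <;> omega

theorem code_pos {q : ℕ} {N : Subgroup (Equiv.Perm (Fin q))} (h : N ≠ ⊥) : 1 ≤ code N :=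
  Nat.one_le_iff_ne_zero.2 fun h0 => h (code_eq_zero.1 h0)

/-- The positions that a non-trivial normal subgroup can take. -/
theorem level_RN {q : ℕ} (h2 : 2 ≤ q) {N : Subgroup (Equiv.Perm (Fin q))} (hN : N.Normal)
    (hne : N ≠ ⊥) : code N = 3 ∨ (code N = 2 ∧ 3 ≤ q) ∨ (code N = 1 ∧ q = 4) := by
  have h1 := code_pos hne
  have h3 := code_le N
  have hk := code_eq_one hN
  have ha := code_eq_two hN
  omega

/-- The possible levels: modulo `4` they are `0` for trivial groups, `3` for symmetric groups and
`2` for alternating groups, and `13` is the level of the Klein four-group on top of height `3`. -/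
theorem CongName.level_cases (hn : 2 ≤ n) (c : CongName n) : c.level ≤ 4 * n ∧
    (c.level % 4 = 0 ∨ (c.level % 4 = 3 ∧ 7 ≤ c.level) ∨ (c.level % 4 = 2 ∧ 10 ≤ c.level) ∨
      c.level = 13) ∧ (8 ≤ c.level → c.upper = 1 ∧ c.lower = 1) := by
  have hret : ∀ C : RetractablePair, C.level = 0 ∨ C.level = 4 ∨ C.level = 7 := by
    rintro (_ | _ | _) <;> simp [RetractablePair.level]
  cases c with
  | R q hq =>
    simp only [level]
    exact ⟨by omega, by omega, fun _ => ⟨rfl, rfl⟩⟩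
  | RN q h2 hq N hN hne =>
    have := level_RN h2 hN hne
    simp only [level]
    exact ⟨by omega, by omega, fun _ => ⟨rfl, rfl⟩⟩
  | lam C => have := hret C; simp only [level, upper, lower]; omega
  | rho C => have := hret C; simp only [level, upper, lower]; omega
  | mu C => have := hret C; simp only [level, upper, lower]; omega

theorem RetractablePair.level_injective : Function.Injective RetractablePair.level := by
  rintro (_ | _ | _) (_ | _ | _) h <;> first | rfl | simp [level] at h

theorem CongName.eq_of_invariants {c d : CongName n} (hu : c.upper = d.upper)
    (hl : c.lower = d.lower) (hlev : c.level = d.level) : c = d := by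
  cases c with
  | R q hq =>
    cases d with
    | R q' hq' =>
      obtain rfl : q = q' := by simpa [level] using hlev
      rfl
    | RN q' h2 hq' N hN hne =>
      have := code_pos hne
      have := code_le N
      simp only [level] at hlev
      omega
    | lam C => simp [lower] at hl
    | rho C => simp [upper] at hu
    | mu C => simp [upper] at hu
  | RN q h2 hq N hN hne =>
    have := code_pos hne
    have := code_le N
    cases d with
    | R q' hq' => simp only [level] at hlev; omega
    | RN q' h2' hq' N' hN' hne' =>
      have := code_pos hne'
      have := code_le N'
      simp only [level] at hlev
      obtain rfl : q = q' := by omega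
      obtain rfl : N = N' := le_antisymm ((le_iff_code_le hN hN').2 (by omega))
        ((le_iff_code_le hN' hN).2 (by omega))
      rfl
    | lam C => simp [lower] at hl
    | rho C => simp [upper] at hu
    | mu C => simp [upper] at hu
  | lam C =>
    cases d with
    | lam C' => rw [RetractablePair.level_injective hlev]
    | _ => simp [upper, lower] at hu hl
  | rho C =>
    cases d with
    | rho C' => rw [RetractablePair.level_injective hlev]
    | _ => simp [upper, lower] at hu hl
  | mu C =>
    cases d with
    | mu C' => rw [RetractablePair.level_injective hlev]
    | _ => simp [upper, lower] at hu hl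

theorem CongName.toCon_injective (hn : 2 ≤ n) :
    Function.Injective (CongName.toCon hn : CongName n → Con (PartitionMonoid n)) := by
  intro c d h
  obtain ⟨h1, h2, h3⟩ := (toCon_le_iff hn).1 h.le
  obtain ⟨h1', h2', h3'⟩ := (toCon_le_iff hn).1 h.ge
  exact eq_of_invariants (le_antisymm h1 h1') (le_antisymm h2 h2') (le_antisymm h3 h3')

/-- Every possible combination of invariants has a name. -/
theorem CongName.exists_of_invariants {θ : Con (PartitionMonoid n)} {p : ℕ} (h : HasHeight θ p) :
    ∃ c : CongName n, c.level = 4 * p + conCode θ (p + 1) ∧ (c.upper = 1 ↔ SeparatesUker θ) ∧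
      (c.lower = 1 ↔ SeparatesLker θ) := by
  by_cases h0 : conCode θ (p + 1) = 0
  · rw [h0, add_zero]
    have hret : ∀ C : RetractablePair, C.level = 4 * p → ∃ c : CongName n, c.level = 4 * p ∧
        (c.upper = 1 ↔ SeparatesUker θ) ∧ (c.lower = 1 ↔ SeparatesLker θ) := by
      intro C hC
      by_cases hu : SeparatesUker θ <;> by_cases hl : SeparatesLker θ
      · exact ⟨.R p h.le, by simp [level, upper, lower, hu, hl]⟩
      · exact ⟨.lam C, by simp [level, upper, lower, hu, hl, hC]⟩
      · exact ⟨.rho C, by simp [level, upper, lower, hu, hl, hC]⟩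
      · exact ⟨.mu C, by simp [level, upper, lower, hu, hl, hC]⟩
    rcases le_or_gt 2 p with hp | hp
    · have := h.separates hp
      exact ⟨.R p h.le, by simp [level, upper, lower, this.1, this.2]⟩
    · interval_cases p
      · exact hret .c0 rfl
      · exact hret .c1 rfl
  · have hpn : p + 1 ≤ n := by
      by_contra hpn
      exact h0 (dif_neg hpn)
    rw [conCode_of_le θ hpn] at h0 ⊢
    have hN := conPerm_normal θ hpn
    have hne : conPerm θ (p + 1) hpn ≠ ⊥ := fun h => h0 (code_eq_zero.2 h)
    have hp : 1 ≤ p := by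
      by_contra hp
      obtain rfl : p = 0 := by omega
      exact hne ((Subgroup.eq_bot_iff_forall _).2
        fun σ _ => Subsingleton.elim (α := Equiv.Perm (Fin 1)) σ 1)
    have hR : SeparatesUker θ → SeparatesLker θ → ∃ c : CongName n,
        c.level = 4 * p + code (conPerm θ (p + 1) hpn) ∧ (c.upper = 1 ↔ SeparatesUker θ) ∧
        (c.lower = 1 ↔ SeparatesLker θ) := fun hu hl =>
      ⟨.RN (p + 1) (by omega) hpn _ hN hne, by simp [level, upper, lower, hu, hl]⟩
    rcases hp.eq_or_lt with rfl | hp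
    · have hC : RetractablePair.cS2.level = 4 * 1 + code (conPerm θ (1 + 1) hpn) := by
        rcases level_RN le_rfl hN hne with h | h | h
        · rw [h]; rfl
        · omega
        · omega
      by_cases hu : SeparatesUker θ <;> by_cases hl : SeparatesLker θ
      · exact hR hu hl
      · exact ⟨.lam .cS2, hC, by simp [upper, lower, hu, hl]⟩
      · exact ⟨.rho .cS2, hC, by simp [upper, lower, hu, hl]⟩
      · exact ⟨.mu .cS2, hC, by simp [upper, lower, hu, hl]⟩
    · have := h.separates hp
      exact hR this.1 this.2

theorem CongName.toCon_surjective (hn : 2 ≤ n) :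
    Function.Surjective (CongName.toCon hn : CongName n → Con (PartitionMonoid n)) := by
  intro θ
  obtain ⟨p, hp⟩ := exists_hasHeight θ
  obtain ⟨c, hlev, hu, hl⟩ := exists_of_invariants hp
  obtain ⟨p', hp', hlev', hu', hl'⟩ := c.hasHeight_toCon hn
  refine ⟨c, le_antisymm ((hp'.le_iff hp).2 ?_) ((hp.le_iff hp').2 ?_)⟩
  · exact ⟨fun h => hu.1 (hu'.1 h), fun h => hl.1 (hl'.1 h), by omega⟩
  · exact ⟨fun h => hu'.2 (hu.2 h), fun h => hl'.2 (hl.2 h), by omega⟩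

/-- The congruences and their names. -/
noncomputable def congEquiv (hn : 2 ≤ n) : CongName n ≃ Con (PartitionMonoid n) :=
  Equiv.ofBijective (CongName.toCon hn) ⟨CongName.toCon_injective hn, CongName.toCon_surjective hn⟩

theorem CongName.toCon_lt_iff (hn : 2 ≤ n) {c d : CongName n} : c.toCon hn < d.toCon hn ↔
    (c.upper ≤ d.upper ∧ c.lower ≤ d.lower ∧ c.level ≤ d.level) ∧
      (c.upper < d.upper ∨ c.lower < d.lower ∨ c.level < d.level) := by
  rw [lt_iff_le_not_ge, toCon_le_iff, toCon_le_iff]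
  omega

/-- The invariants of the two ends of an edge are such that there is no room for further possible
values in between. -/
theorem HasseEdge.covBy (hn : 2 ≤ n) {c d : CongName n} (h : HasseEdge n c d) :
    c.toCon hn ⋖ d.toCon hn := by
  have ht := code_top (q := 2) le_rfl
  suffices H : ((c.upper ≤ d.upper ∧ c.lower ≤ d.lower ∧ c.level ≤ d.level) ∧
      (c.upper < d.upper ∨ c.lower < d.lower ∨ c.level < d.level)) ∧ ∀ u l m : ℕ,
      (m % 4 = 0 ∨ (m % 4 = 3 ∧ 7 ≤ m) ∨ (m % 4 = 2 ∧ 10 ≤ m) ∨ m = 13) →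
      ¬ (((c.upper ≤ u ∧ c.lower ≤ l ∧ c.level ≤ m) ∧
        (c.upper < u ∨ c.lower < l ∨ c.level < m)) ∧
        (u ≤ d.upper ∧ l ≤ d.lower ∧ m ≤ d.level) ∧
        (u < d.upper ∨ l < d.lower ∨ m < d.level)) by
    refine ⟨(CongName.toCon_lt_iff hn).2 H.1, fun θ h1 h2 => ?_⟩
    obtain ⟨e, rfl⟩ := CongName.toCon_surjective hn θ
    exact H.2 e.upper e.lower e.level (e.level_cases hn).2.1
      ⟨(CongName.toCon_lt_iff hn).1 h1, (CongName.toCon_lt_iff hn).1 h2⟩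
  cases h with
  | sym_R q h2 h hN hne h' =>
    have := code_top h2
    simp only [CongName.level, CongName.upper, CongName.lower]
    exact ⟨by omega, by omega⟩
  | alt_sym q h3 h2 h hN hne hN' hne' =>
    have := code_top h2
    have := code_alternatingGroup h3
    simp only [CongName.level, CongName.upper, CongName.lower]
    exact ⟨by omega, by omega⟩
  | R_alt q h3 h4 h h2 h' hN hne =>
    have := code_alternatingGroup (q := q + 1) (by omega)
    simp only [CongName.level, CongName.upper, CongName.lower]
    exact ⟨by omega, by omega⟩
  | R_klein h h2 h' hN hne =>
    have := code_klein
    simp only [CongName.level, CongName.upper, CongName.lower]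
    exact ⟨by omega, by omega⟩
  | klein_alt h2 h hN hne hN' hne' =>
    have := code_klein
    have := code_alternatingGroup (q := 4) (by omega)
    simp only [CongName.level, CongName.upper, CongName.lower]
    exact ⟨by omega, by omega⟩
  | _ =>
    simp only [CongName.level, CongName.upper, CongName.lower, RetractablePair.level]
    exact ⟨by omega, by omega⟩

/-- From every congruence, an edge of the Hasse diagram leads towards each larger one. -/
theorem CongName.exists_hasseEdge (hn : 2 ≤ n) {c d : CongName n}
    (h : c.toCon hn < d.toCon hn) : ∃ e, HasseEdge n c e ∧ e.toCon hn ≤ d.toCon hn := by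
  simp only [toCon_le_iff]
  obtain ⟨h, h'⟩ := (toCon_lt_iff hn).1 h
  obtain ⟨hdn, hd, hd8⟩ := d.level_cases hn
  have hu := d.upper_le
  have hl := d.lower_le
  have ht2 := code_top (q := 2) le_rfl
  have htb := top_ne_bot (q := 2) le_rfl
  generalize d.upper = du at *
  generalize d.lower = dl at *
  generalize d.level = dm at *
  cases c with
  | mu C =>
    simp only [upper, lower, level] at h h'
    by_cases hdu : du = 1
    · exact ⟨_, .mu_lam C, by simp only [upper, lower, level]; omega⟩
    by_cases hdl : dl = 1
    · exact ⟨_, .mu_rho C, by simp only [upper, lower, level]; omega⟩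
    cases C <;> simp only [RetractablePair.level] at h h'
    · exact ⟨_, .mu_01, by simp only [upper, lower, level, RetractablePair.level]; omega⟩
    · exact ⟨_, .mu_1S2, by simp only [upper, lower, level, RetractablePair.level]; omega⟩
    · omega
  | lam C =>
    simp only [upper, lower, level] at h h'
    cases C <;> simp only [RetractablePair.level] at h h' <;> by_cases hdl : dl = 1
    · exact ⟨_, .lam_R0 (by omega), by simp only [upper, lower, level]; omega⟩
    · exact ⟨_, .lam_01, by simp only [upper, lower, level, RetractablePair.level]; omega⟩
    · exact ⟨_, .lam_R1 (by omega), by simp only [upper, lower, level]; omega⟩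
    · exact ⟨_, .lam_1S2, by simp only [upper, lower, level, RetractablePair.level]; omega⟩
    · exact ⟨_, .lam_RS2 le_rfl hn inferInstance htb, by simp only [upper, lower, level]; omega⟩
    · omega
  | rho C =>
    simp only [upper, lower, level] at h h'
    cases C <;> simp only [RetractablePair.level] at h h' <;> by_cases hdu : du = 1
    · exact ⟨_, .rho_R0 (by omega), by simp only [upper, lower, level]; omega⟩
    · exact ⟨_, .rho_01, by simp only [upper, lower, level, RetractablePair.level]; omega⟩
    · exact ⟨_, .rho_R1 (by omega), by simp only [upper, lower, level]; omega⟩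
    · exact ⟨_, .rho_1S2, by simp only [upper, lower, level, RetractablePair.level]; omega⟩
    · exact ⟨_, .rho_RS2 le_rfl hn inferInstance htb, by simp only [upper, lower, level]; omega⟩
    · omega
  | R q hq =>
    simp only [upper, lower, level] at h h'
    by_cases hq0 : q = 0
    · subst hq0
      exact ⟨_, .R_01 _ (by omega), by simp only [upper, lower, level]; omega⟩
    by_cases hq1 : q = 1
    · subst hq1
      exact ⟨_, .R_1S2 _ le_rfl hn inferInstance htb, by simp only [upper, lower, level]; omega⟩
    by_cases hq3 : q = 3
    · subst hq3
      have := code_klein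
      exact ⟨_, .R_klein _ (by omega) (by omega) klein_normal klein_ne_bot,
        by simp only [upper, lower, level]; omega⟩
    have := code_alternatingGroup (q := q + 1) (by omega)
    exact ⟨_, .R_alt q (by omega) hq3 _ (by omega) (by omega) inferInstance
      (alternatingGroup_ne_bot (by omega)), by simp only [upper, lower, level]; omega⟩
  | RN q h2 hq N hN hne =>
    simp only [upper, lower, level] at h h'
    rcases normal_cases hN with rfl | ⟨-, rfl⟩ | ⟨h3, rfl⟩ | ⟨rfl, rfl⟩
    · exact absurd rfl hne
    · have := code_top h2
      exact ⟨_, .sym_R q h2 hq hN hne hq, by simp only [upper, lower, level]; omega⟩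
    · have := code_top h2
      have := code_alternatingGroup h3
      exact ⟨_, .alt_sym q h3 h2 hq hN hne inferInstance (top_ne_bot h2),
        by simp only [upper, lower, level]; omega⟩
    · have hk := code_klein
      have := code_alternatingGroup (q := 4) (by omega)
      simp only [hk] at h h'
      exact ⟨_, .klein_alt h2 hq hN hne inferInstance (alternatingGroup_ne_bot (by omega)),
        by simp only [upper, lower, level]; omega⟩

theorem CongName.toCon_covBy_iff (hn : 2 ≤ n) {c d : CongName n} :
    c.toCon hn ⋖ d.toCon hn ↔ HasseEdge n c d := by
  refine ⟨fun h => ?_, HasseEdge.covBy hn⟩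
  obtain ⟨e, he, hed⟩ := exists_hasseEdge hn h.lt
  rcases hed.eq_or_lt with heq | hlt
  · rwa [← toCon_injective hn heq]
  · exact absurd hlt (h.2 (he.covBy hn).lt)

theorem CongName.toCon_mu_c0 (hn : 2 ≤ n) : (CongName.mu .c0 : CongName n).toCon hn = ⊥ := by
  refine le_bot_iff.1 ?_
  obtain ⟨c, hc⟩ := toCon_surjective hn (⊥ : Con (PartitionMonoid n))
  rw [← hc, toCon_le_iff]
  simp [upper, lower, level, RetractablePair.level]

theorem CongName.toCon_R_self (hn : 2 ≤ n) : (CongName.R n le_rfl).toCon hn = ⊤ := by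
  refine top_le_iff.1 ?_
  obtain ⟨c, hc⟩ := toCon_surjective hn (⊤ : Con (PartitionMonoid n))
  rw [← hc, toCon_le_iff]
  exact ⟨c.upper_le, c.lower_le, (c.level_cases hn).1⟩

/-! ### The description of the congruences of the partition monoid -/

theorem isProperINPair_groupBar {q : ℕ} {N : Subgroup (Equiv.Perm (Fin q))} (h2 : 2 ≤ q)
    (hq : q ≤ n) (hN : N.Normal) (hne : N ≠ ⊥) :
    IsProperINPair (rankIdeal n (q - 1)) (groupBar n N) := by
  obtain ⟨p, rfl⟩ : ∃ p, q = p + 1 := ⟨q - 1, by omega⟩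
  refine ⟨isINPair_groupBar hq hN, ?_⟩
  obtain ⟨σ, hσ⟩ := Subgroup.ne_bot_iff_exists_ne_one.1 hne
  exact ⟨bar n σ.1, ⟨σ.1, σ.2, rfl⟩, bar n 1, ⟨1, N.one_mem, rfl⟩,
    fun h => hσ (Subtype.ext (bar_injective hq h))⟩

theorem exists_of_isProperINPair {I N' : Set (PartitionMonoid n)} (h : IsProperINPair I N') :
    ∃ (q : ℕ) (N : Subgroup (Equiv.Perm (Fin q))), 2 ≤ q ∧ q ≤ n ∧ N.Normal ∧ N ≠ ⊥ ∧
      I = rankIdeal n (q - 1) ∧ nuRel N' = nuRel (groupBar n N) ∧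
      (N' ⊆ groupBar n (⊤ : Subgroup (Equiv.Perm (Fin q))) → N' = groupBar n N) := by
  obtain ⟨p, N, hp, hN, hI, hnu, hne, hsub⟩ := exists_of_isINPair h.1
  refine ⟨p + 1, N, ?_, hp, hN, hne h.2, hI, hnu, hsub⟩
  by_contra hp
  obtain rfl : p = 0 := by omega
  exact hne h.2 ((Subgroup.eq_bot_iff_forall _).2
    fun σ _ => Subsingleton.elim (α := Equiv.Perm (Fin 1)) σ 1)

end PartitionMonoid

open SemigroupCong PartitionMonoid in
theorem theorem5p4 (n : ℕ) (hn : 2 ≤ n) :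
    -- the ideals
    (∀ I : Set (PartitionMonoid n), IsIdeal I ↔ ∃ q ≤ n, I = rankIdeal n q) ∧
    -- the proper IN-pairs
    (∀ (q : ℕ) (N : Subgroup (Equiv.Perm (Fin q))), 2 ≤ q → q ≤ n → N.Normal → N ≠ ⊥ →
      IsProperINPair (rankIdeal n (q - 1)) (groupBar n N)) ∧
    (∀ I N' : Set (PartitionMonoid n), IsProperINPair I N' →
      ∃ (q : ℕ) (N : Subgroup (Equiv.Perm (Fin q))), 2 ≤ q ∧ q ≤ n ∧ N.Normal ∧ N ≠ ⊥ ∧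
        I = rankIdeal n (q - 1) ∧ nuRel N' = nuRel (groupBar n N) ∧
        (N' ⊆ groupBar n (⊤ : Subgroup (Equiv.Perm (Fin q))) → N' = groupBar n N)) ∧
    -- the retractable IN-pairs
    (∀ C : RetractablePair, IsRetractableINPair (C.ideal n) (C.group n)) ∧
    (∀ I N' : Set (PartitionMonoid n), IsRetractableINPair I N' →
      ∃ C : RetractablePair, I = C.ideal n ∧ nuRel N' = nuRel (C.group n) ∧
        (N' ⊆ groupBar n (⊤ : Subgroup (Equiv.Perm (Fin (C.idealRank + 1)))) →
          N' = C.group n)) ∧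
    -- the congruences, without repetition, and the Hasse diagram of the congruence lattice
    ∃ Φ : CongName n ≃ Con (PartitionMonoid n),
      (∀ (c : CongName n) (a b : PartitionMonoid n), Φ c a b ↔ c.toRel a b) ∧
      (∀ c d : CongName n, Φ c ⋖ Φ d ↔ HasseEdge n c d) ∧
      Φ (.mu .c0) = ⊥ ∧ Φ (.R n le_rfl) = ⊤ := by
  exact ⟨fun I => isIdeal_iff, fun q N h2 hq hN hne => isProperINPair_groupBar h2 hq hN hne,
    fun I N' h => exists_of_isProperINPair h, fun C => C.isRetractableINPair hn,
    fun I N' h => exists_of_isRetractableINPair h, congEquiv hn,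
    fun c a b => c.toCon_rel hn, fun c d => CongName.toCon_covBy_iff hn,
    CongName.toCon_mu_c0 hn, CongName.toCon_R_self hn⟩
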